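/- **Setting.** Consider an episodic two-player zero-sum Markov game with horizon $H$, measurable state space $\mathcal X$ (possibly infinite), finite action sets $\mathcal A,\mathcal B$, transition kernels $\mathbb P_h$, deterministic measurable rewards $r^h\in[0,1]$ and fixed initial state $x^1$. For Markov policies $\mu,\nu$ of the max- and min-player let $V_h^{\mu,\nu}$, $Q_h^{\mu,\nu}$ be the value functions, $V_h^{\mu,\dagger}=\inf_\nu V_h^{\mu,\nu}$, and $Q_h^{\mu,\dagger}=r^h+\mathbb P_hV_{h+1}^{\mu,\dagger}$. Let $\mathcal F=\mathcal F_1\times\dots\times\mathcal F_H$ be a class of measurable functions $f^h:\mathcal X\times\mathcal A\times\mathcal B\to\mathbb R$ with prior probabilities $p_0^h$ on $\mathcal F_h$, and put $f^{H+1}=0$. For $f,g\in\mathcal F$ and a policy $\mu$ of the max-player put $$V_{f,h}(x)=\max_{p\in\Delta_{\mathcal A}}\min_{q\in\Delta_{\mathcal B}}p^\top f^h(x,\cdot,\cdot)q,\qquad V^\mu_{g,h}(x)=\min_{q\in\Delta_{\mathcal B}}\mu_h(x)^\top g^h(x,\cdot,\cdot)q .$$ Let $\mu_f$ be a policy attaining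 the maximum in $V_{f,h}(x)$, and $\nu_{f,g}$ a policy attaining the minimum in $V_{g,h}^{\mu_f}(x)$, for all $(x,h)$ (ties are broken by any fixed measurable rule). Let $\mathcal T_h^\mu g=r^h+\mathbb P_hV^\mu_{g,h+1}$ and $\mathcal E_h^\mu(g;\cdot)=g^h-\mathcal T_h^\mu g$. **Algorithm.** In episode $t$, given the data $S_{t-1}=\{(x_s^h,a_s^h,b_s^h,r_s^h)\}_{s<t,\,h\le H}$, the main agent draws $f_t\sim p_t$ and plays $\mu_t=\mu_{f_t}$; the booster agent then draws $g_t\sim p_t^{\mu_t}$ and plays $\nu_t=\nu_{f_t,g_t}$; the trajectory of $(\mu_t,\nu_t)$ is added to the data. Here $$p_t^{\mu}(g)\propto e^{-\lambda V^\mu_{g,1}(x^1)}\prod_{h=1}^H\frac{p_0^h(g^h)\,e^{-\eta L_\mu^h(g^h,g^{h+1})}}{\mathbb E_{\tilde g\sim p_0^h}e^{-\eta L_\mu^h(\tilde g,g^{h+1})}},\qquad L^h_\mu(g^h,g^{h+1})=\sum_{s<t}\big[g^h(x_s^h,a_s^h,b_s^h)-r_s^h-V^\mu_{g,h+1}(x_s^{h+1})\big]^2,$$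 and $p_t(f)$ is given by the same formula with $V^\mu_{g,h}$ replaced by $V_{f,h}$ and $-\lambda$ replaced by $+\lambda$. **Complexity measures.** Let $$\kappa(\epsilon)=\sup_{f,g\in\mathcal F}\sum_{h=1}^H\ln\frac1{p_0^h(\{g'\in\mathcal F_h:\ \sup_{x,a,b}|g'-\mathcal T_h^{\mu_f}g|\le\epsilon\})}.$$ For $m>0$ let the decoupling coefficient $dc(m)$ be the smallest integer $K\ge 0$ (or $\infty$) such that for all sequences $f_t,g_t\in\mathcal F$, with $\pi_t=(\mu_{f_t},\nu_{f_t,g_t})$, and both for $w_t=g_t$ and for $w_t=f_t$, $$\Big|\sum_{h=1}^H\sum_{t=1}^T\mathbb E_{\pi_t}\mathcal E_h^{\mu_{f_t}}(w_t;x^h,a^h,b^h)\Big|\le m\sum_{h=1}^H\sum_{t=1}^T\sum_{s<t}\mathbb E_{\pi_s}\big[\mathcal E_h^{\mu_{f_t}}(w_t;x^h,a^h,b^h)^2\big]+\frac K{4m}.$$ **Theorem.** There is a universal constant $C>0$ such that the following holds. Assume * realizability: $Q_h^{\mu^*,\nu^*}\in\mathcal F_h$ for a Nash equilibrium $(\mu^*,\nu^*)$,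 and $Q_h^{\mu_f,\dagger}\in\mathcal F_h$ for all $f\in\mathcal F$, $h\le H$; * completeness: $\mathcal T_h^{\mu_f}g\in\mathcal F_h$ for all $f,g\in\mathcal F$, $h\le H$; * boundedness: for some $\beta>1$, all functions in all $\mathcal F_h$ have values in $[0,\beta-1]$. Write $\kappa=\kappa(\beta/T^2)$ and assume $\kappa<\infty$. Let $dc\ge1$ be a real number with $dc\ge\sup_{0<m\le1}dc(m)$, and let $\eta=\frac1{4\beta^2}$, $\lambda=\sqrt{\frac{T\kappa}{\beta^2dc}}$, where $\lambda\beta^2\ge1$ and $T\ge\beta\sqrt H$. Then $$\sum_{t=1}^T\mathbb E_{S_{t-1}}\mathbb E_{f_t\sim p_t}\mathbb E_{g_t\sim p_t^{\mu_t}}\big[V_1^{\mu_t,\nu_t}(x^1)-V_1^{\mu_t,\dagger}(x^1)\big]\le C\Big(\beta\sqrt{dc\cdot\kappa\cdot T}+dc\Big).$$ -/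

import Mathlib

open MeasureTheory ProbabilityTheory

universe u v w z

noncomputable section

namespace MarkovGames



/-! ### Matrix games -/

section Matrix

variable {A : Type v} {B : Type w} [Fintype A] [Fintype B]

/-- The bilinear payoff `pᵀ M q` of the mixed actions `p`, `q` in the matrix game `M`. -/
def payoff (p : A → ℝ) (M : A → B → ℝ) (q : B → ℝ) : ℝ :=
  ∑ a, ∑ b, p a * M a b * q b

/-- `min_{q ∈ Δ_B} pᵀ M q`, the value of the min-player's best answer to `p`. -/
def minAgainst (p : A → ℝ) (M : A → B → ℝ) : ℝ :=
  ⨅ q : stdSimplex ℝ B, payoff p M q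

/-- `max_{p ∈ Δ_A} min_{q ∈ Δ_B} pᵀ M q`. -/
def maxMin (M : A → B → ℝ) : ℝ :=
  ⨆ p : stdSimplex ℝ A, minAgainst (p : A → ℝ) M

end Matrix

/-! ### Games, policies, value functions -/

/-- A Markov policy of a player with action set `A`: for every step and every state a probability
vector on `A`, depending measurably on the state. -/
structure MarkovPolicy (X : Type u) (A : Type v) [MeasurableSpace X] [Fintype A] where
  prob : ℕ → X → A → ℝ
  prob_mem : ∀ h x, prob h x ∈ stdSimplex ℝ A
  measurable_prob : ∀ h a, Measurable fun x => prob h x a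

/-- An episodic two-player zero-sum Markov game with horizon `H`, transition kernels `P`,
deterministic rewards `r` in `[0, 1]` and fixed initial state `x₁`. Steps are numbered
`0, …, H - 1`; the data at later steps play no role. -/
structure MarkovGame (X : Type u) (A : Type v) (B : Type w)
    [MeasurableSpace X] [MeasurableSpace A] [MeasurableSpace B] where
  H : ℕ
  P : ℕ → Kernel (X × A × B) X
  markov : ∀ h, IsMarkovKernel (P h)
  r : ℕ → X → A → B → ℝ
  measurable_r : ∀ h a b, Measurable fun x => r h x a b
  r_mem : ∀ h x a b, r h x a b ∈ Set.Icc (0 : ℝ) 1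
  x₁ : X

/-- One record `(x, a, b, x')` for each of `n` consecutive steps: the state, the two actions and
the next state. (Rewards are functions of `(x, a, b)`.) -/
abbrev Trajectory (X : Type u) (A : Type v) (B : Type w) (n : ℕ) : Type (max u v w) :=
  Fin n → X × A × B × X

section Game

variable {X : Type u} {A : Type v} {B : Type w} [MeasurableSpace X]
  [Fintype A] [MeasurableSpace A] [Fintype B] [MeasurableSpace B]

/-- The law of the next `n` steps of play when the policies `μ`, `ν` are executed from state `x`
at step `h`. -/
def rollout (G : MarkovGame X A B) (μ : MarkovPolicy X A) (ν : MarkovPolicy X B) :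
    (n : ℕ) → (h : ℕ) → X → Measure (Trajectory X A B n)
  | 0, _, _ => Measure.dirac fun i => i.elim0
  | n + 1, h, x =>
      ∑ a, ∑ b, ENNReal.ofReal (μ.prob h x a * ν.prob h x b) •
        (G.P h (x, a, b)).bind fun x' =>
          (rollout G μ ν n (h + 1) x').map fun ζ =>
            Fin.cons (α := fun _ => X × A × B × X) (x, a, b, x') ζ

/-- The law of the trajectory of one whole episode under `(μ, ν)`. -/
def episodeLaw (G : MarkovGame X A B) (μ : MarkovPolicy X A) (ν : MarkovPolicy X B) :
    Measure (Trajectory X A B G.H) :=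
  rollout G μ ν G.H 0 G.x₁

/-- `V_h^{μ,ν}(x)`: the expected sum of the rewards from step `h` on, starting at `x`. -/
def value (G : MarkovGame X A B) (μ : MarkovPolicy X A) (ν : MarkovPolicy X B)
    (h : ℕ) (x : X) : ℝ :=
  ∫ ζ, ∑ i : Fin (G.H - h), G.r (h + i) (ζ i).1 (ζ i).2.1 (ζ i).2.2.1
    ∂(rollout G μ ν (G.H - h) h x)

/-- `Q_h^{μ,ν}(x,a,b)`: the immediate reward plus the expected value at the next state. -/
def qValue (G : MarkovGame X A B) (μ : MarkovPolicy X A) (ν : MarkovPolicy X B)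
    (h : ℕ) (x : X) (a : A) (b : B) : ℝ :=
  G.r h x a b + ∫ x', value G μ ν (h + 1) x' ∂(G.P h (x, a, b))

/-- `V_h^{μ,†}(x) = inf_ν V_h^{μ,ν}(x)`. -/
def bestValue (G : MarkovGame X A B) (μ : MarkovPolicy X A) (h : ℕ) (x : X) : ℝ :=
  ⨅ ν : MarkovPolicy X B, value G μ ν h x

/-- `Q_h^{μ,†}(x,a,b)`: the action value of `μ` against its best response. -/
def bestQ (G : MarkovGame X A B) (μ : MarkovPolicy X A) (h : ℕ) (x : X) (a : A) (b : B) : ℝ :=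
  G.r h x a b + ∫ x', bestValue G μ (h + 1) x' ∂(G.P h (x, a, b))

/-- `V_h^{†,ν}(x) = sup_μ V_h^{μ,ν}(x)`. -/
def maxBestValue (G : MarkovGame X A B) (ν : MarkovPolicy X B) (h : ℕ) (x : X) : ℝ :=
  ⨆ μ : MarkovPolicy X A, value G μ ν h x

/-- `(μ, ν)` is a Nash equilibrium: each policy is optimal against its own best response, at every
step and state. -/
def IsNash (G : MarkovGame X A B) (μ : MarkovPolicy X A) (ν : MarkovPolicy X B) : Prop :=
  ∀ h < G.H, ∀ x,
    (bestValue G μ h x = ⨆ μ' : MarkovPolicy X A, bestValue G μ' h x) ∧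
    (maxBestValue G ν h x = ⨅ ν' : MarkovPolicy X B, maxBestValue G ν' h x)

end Game

/-! ### Function classes -/

/-- A function class `F = F_0 × ⋯ × F_{H-1}` with a product prior. The class `F_h` is the range of
a jointly measurable family `val h`, indexed by a measurable space `Θ h` (for a set of functions,
take `Θ h` to be the set itself), and `prior h` is the prior `p_0^h`. -/
structure FunctionClass (X : Type u) (A : Type v) (B : Type w) [MeasurableSpace X] (H : ℕ) where
  Θ : Fin H → Type z
  mΘ : ∀ h, MeasurableSpace (Θ h)
  val : ∀ h, Θ h → X → A → B → ℝ
  measurable_val : ∀ h a b, Measurable fun p : Θ h × X => val h p.1 p.2 a b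
  prior : ∀ h, Measure (Θ h)
  isProb : ∀ h, IsProbabilityMeasure (prior h)

attribute [instance] FunctionClass.mΘ
attribute [instance] FunctionClass.isProb

/-- Measurable rules which choose, among the maximizers (minimizers) over mixed actions, the one
that is played. -/
structure TieBreak (X : Type u) (A : Type v) (B : Type w) [MeasurableSpace X]
    [Fintype A] [Fintype B] where
  maxSel : ℕ → X → (A → B → ℝ) → A → ℝ
  maxSel_mem : ∀ h x M, maxSel h x M ∈ stdSimplex ℝ A
  maxSel_opt : ∀ h x M, ∀ p ∈ stdSimplex ℝ A, minAgainst p M ≤ minAgainst (maxSel h x M) M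
  measurable_maxSel : ∀ h, Measurable fun y : X × (A → B → ℝ) => maxSel h y.1 y.2
  minSel : ℕ → X → (A → ℝ) → (A → B → ℝ) → B → ℝ
  minSel_mem : ∀ h x p M, minSel h x p M ∈ stdSimplex ℝ B
  minSel_opt : ∀ h x p M, ∀ q ∈ stdSimplex ℝ B, payoff p M (minSel h x p M) ≤ payoff p M q
  measurable_minSel : ∀ h,
    Measurable fun y : X × (A → ℝ) × (A → B → ℝ) => minSel h y.1 y.2.1 y.2.2

section Class

variable {X : Type u} {A : Type v} {B : Type w} [MeasurableSpace X] {H : ℕ}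

/-- The elements `f = (f^0, …, f^{H-1})` of the product class. -/
abbrev FunctionClass.Elem (F : FunctionClass.{u, v, w, z} X A B H) : Type z := ∀ h, F.Θ h

/-- The product prior `p_0(f) = ∏_h p_0^h(f^h)`. -/
def FunctionClass.prodPrior (F : FunctionClass.{u, v, w, z} X A B H) : Measure F.Elem :=
  Measure.pi F.prior

/-- The matrix `f^h(x, ·, ·)`, with `f^h = 0` for `h ≥ H`. -/
def FunctionClass.eval (F : FunctionClass.{u, v, w, z} X A B H) (f : F.Elem) (h : ℕ) (x : X) :
    A → B → ℝ :=
  if hh : h < H then F.val ⟨h, hh⟩ (f ⟨h, hh⟩) x else 0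

theorem FunctionClass.measurable_eval (F : FunctionClass.{u, v, w, z} X A B H) (f : F.Elem)
    (h : ℕ) : Measurable (F.eval f h) := by
  unfold FunctionClass.eval
  by_cases hh : h < H
  · simp only [hh, dif_pos]
    refine measurable_pi_lambda _ fun a => measurable_pi_lambda _ fun b => ?_
    exact (F.measurable_val ⟨h, hh⟩ a b).comp measurable_prodMk_left
  · simp only [hh, dif_neg, not_false_eq_true]
    exact measurable_const

variable [Fintype A] [Fintype B]

/-- The policy `μ_f` of the max-player induced by `f`. -/
def mainPolicy (σ : TieBreak X A B) (F : FunctionClass.{u, v, w, z} X A B H) (f : F.Elem) :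
    MarkovPolicy X A where
  prob h x := σ.maxSel h x (F.eval f h x)
  prob_mem h x := σ.maxSel_mem h x _
  measurable_prob h a :=
    (measurable_pi_apply a).comp
      ((σ.measurable_maxSel h).comp (measurable_id.prodMk (F.measurable_eval f h)))

/-- The policy of the min-player which answers `μ` optimally according to `g`. -/
def answerPolicy (σ : TieBreak X A B) (F : FunctionClass.{u, v, w, z} X A B H)
    (μ : MarkovPolicy X A) (g : F.Elem) : MarkovPolicy X B where
  prob h x := σ.minSel h x (μ.prob h x) (F.eval g h x)
  prob_mem h x := σ.minSel_mem h x _ _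
  measurable_prob h b :=
    (measurable_pi_apply b).comp
      ((σ.measurable_minSel h).comp
        (measurable_id.prodMk
          ((measurable_pi_lambda _ fun a => μ.measurable_prob h a).prodMk
            (F.measurable_eval g h))))

/-- `ν_{f,g}`, the booster agent's policy when the main agent draws `f` and the booster draws
`g`. -/
def boosterPolicy (σ : TieBreak X A B) (F : FunctionClass.{u, v, w, z} X A B H)
    (f g : F.Elem) : MarkovPolicy X B :=
  answerPolicy σ F (mainPolicy σ F f) g

end Class

section Learning

variable {X : Type u} {A : Type v} {B : Type w} [MeasurableSpace X]
  [Fintype A] [MeasurableSpace A] [Fintype B] [MeasurableSpace B]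

/-- The Bellman operator `(T_h^μ g)(x,a,b) = r^h(x,a,b) + E_{x'} V^μ_{g,h+1}(x')`, where
`V^μ_{g,h}(x) = min_q μ_h(x)ᵀ g^h(x,·,·) q`. -/
def bellman (G : MarkovGame X A B) (F : FunctionClass.{u, v, w, z} X A B G.H)
    (μ : MarkovPolicy X A) (g : F.Elem) (h : ℕ) (x : X) (a : A) (b : B) : ℝ :=
  G.r h x a b +
    ∫ x', minAgainst (μ.prob (h + 1) x') (F.eval g (h + 1) x') ∂(G.P h (x, a, b))

/-- The Bellman residual `E_h^μ(g;x,a,b) = g^h(x,a,b) - (T_h^μ g)(x,a,b)`. -/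
def residual (G : MarkovGame X A B) (F : FunctionClass.{u, v, w, z} X A B G.H)
    (μ : MarkovPolicy X A) (g : F.Elem) (h : ℕ) (x : X) (a : A) (b : B) : ℝ :=
  F.eval g h x a b - bellman G F μ g h x a b

/-! ### Standing assumptions -/

/-- Realizability: the classes contain the action values of a Nash equilibrium, and those of every
induced policy `μ_f` against its best response. -/
def Realizable (G : MarkovGame X A B) (σ : TieBreak X A B)
    (F : FunctionClass.{u, v, w, z} X A B G.H) : Prop :=
  (∃ (μ : MarkovPolicy X A) (ν : MarkovPolicy X B), IsNash G μ ν ∧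
    ∀ h : Fin G.H, ∃ θ : F.Θ h, F.val h θ = qValue G μ ν h) ∧
  ∀ (f : F.Elem) (h : Fin G.H), ∃ θ : F.Θ h, F.val h θ = bestQ G (mainPolicy σ F f) h

/-- Completeness: the classes are closed under the operators `T^{μ_f}`. -/
def Complete (G : MarkovGame X A B) (σ : TieBreak X A B)
    (F : FunctionClass.{u, v, w, z} X A B G.H) : Prop :=
  ∀ (f g : F.Elem) (h : Fin G.H), ∃ θ : F.Θ h,
    F.val h θ = bellman G F (mainPolicy σ F f) g h

/-- Boundedness: all members of the classes take values in `[0, β - 1]`. -/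
def BoundedBy {H : ℕ} (F : FunctionClass.{u, v, w, z} X A B H) (β : ℝ) : Prop :=
  ∀ h θ x a b, F.val h θ x a b ∈ Set.Icc (0 : ℝ) (β - 1)

/-! ### Complexity measures -/

/-- `κ(ε) = sup_f sup_g ∑_h ln (1 / p_0^h(F_h^{μ_f}(ε, g^{h+1})))`, with values in `[0, ∞]`. -/
def kappa (G : MarkovGame X A B) (σ : TieBreak X A B)
    (F : FunctionClass.{u, v, w, z} X A B G.H) (ε : ℝ) : EReal :=
  ⨆ f : F.Elem, ⨆ g : F.Elem, ∑ h : Fin G.H,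
    -ENNReal.log (F.prior h
      {θ | ∀ x a b, |F.val h θ x a b - bellman G F (mainPolicy σ F f) g h x a b| ≤ ε})

/-- `E_{(μ,ν)} φ(x^h, a^h, b^h)`. -/
def stepExpect (G : MarkovGame X A B) (μ : MarkovPolicy X A) (ν : MarkovPolicy X B)
    (h : Fin G.H) (φ : X → A → B → ℝ) : ℝ :=
  ∫ ζ, φ (ζ h).1 (ζ h).2.1 (ζ h).2.2.1 ∂(episodeLaw G μ ν)

/-- The decoupling inequality with parameter `m` and constant `K` along the sequences `f`, `g`,
`w`: episode `t` is played with `(μ_{f_t}, ν_{f_t,g_t})`, and the residual considered at time `t`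
is the `T^{μ_{f_t}}`-residual of `w_t`. -/
def DecouplingIneq (G : MarkovGame X A B) (σ : TieBreak X A B)
    (F : FunctionClass.{u, v, w, z} X A B G.H) (T : ℕ) (m K : ℝ)
    (f g w : ℕ → F.Elem) : Prop :=
  |∑ h : Fin G.H, ∑ t ∈ Finset.range T,
      stepExpect G (mainPolicy σ F (f t)) (boosterPolicy σ F (f t) (g t)) h
        (residual G F (mainPolicy σ F (f t)) (w t) h)| ≤
    m * (∑ h : Fin G.H, ∑ t ∈ Finset.range T, ∑ s ∈ Finset.range t,
      stepExpect G (mainPolicy σ F (f s)) (boosterPolicy σ F (f s) (g s)) h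
        (fun x a b => residual G F (mainPolicy σ F (f t)) (w t) h x a b ^ 2)) + K / (4 * m)

/-- The multi-agent decoupling coefficient: the smallest integer for which the decoupling
inequality holds for all sequences drawn from the class, both for the residuals of the booster
agent's functions `g_t` and for those of the main agent's functions `f_t` (`∞` if there is
none). -/
def decoupling (G : MarkovGame X A B) (σ : TieBreak X A B)
    (F : FunctionClass.{u, v, w, z} X A B G.H) (T : ℕ) (m : ℝ) : ℕ∞ :=
  ⨅ K ∈ {K : ℕ | ∀ f g : ℕ → F.Elem,
    DecouplingIneq G σ F T m K f g g ∧ DecouplingIneq G σ F T m K f g f}, (K : ℕ∞)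

/-! ### The posterior sampling algorithm -/

/-- Data of `t` episodes. -/
abbrev History (G : MarkovGame X A B) (t : ℕ) : Type (max u v w) :=
  Fin t → Trajectory X A B G.H

/-- The cumulative squared loss `L^h(θ, f^{h+1}; S)`. The rule `V` assigns to a step, a state and a
matrix `f^h(x,·,·)` the value of the state. -/
def loss (G : MarkovGame X A B) (F : FunctionClass.{u, v, w, z} X A B G.H)
    (V : ℕ → X → (A → B → ℝ) → ℝ) {t : ℕ} (S : History G t) (h : Fin G.H)
    (θ : F.Θ h) (f : F.Elem) : ℝ :=
  ∑ s, (F.val h θ (S s h).1 (S s h).2.1 (S s h).2.2.1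
    - G.r h (S s h).1 (S s h).2.1 (S s h).2.2.1
    - V (h + 1) (S s h).2.2.2 (F.eval f (h + 1) (S s h).2.2.2)) ^ 2

/-- The posterior with density proportional to
`exp (c V_{f,1}(x₁)) ∏_h exp (-η L^h(f^h, f^{h+1}; S)) / E_{θ ∼ p_0^h} exp (-η L^h(θ, f^{h+1}; S))`
with respect to the product prior. -/
def posterior (G : MarkovGame X A B) (F : FunctionClass.{u, v, w, z} X A B G.H)
    (V : ℕ → X → (A → B → ℝ) → ℝ) (η c : ℝ) {t : ℕ} (S : History G t) : Measure F.Elem :=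
  F.prodPrior.tilted fun f =>
    c * V 0 G.x₁ (F.eval f 0 G.x₁) +
      ∑ h, (-η * loss G F V S h (f h) f
        - Real.log (∫ θ, Real.exp (-η * loss G F V S h θ f) ∂(F.prior h)))

/-- The main agent's posterior `p(· | S)`. -/
def mainPosterior (G : MarkovGame X A B) (F : FunctionClass.{u, v, w, z} X A B G.H)
    (η lam : ℝ) {t : ℕ} (S : History G t) : Measure F.Elem :=
  posterior G F (fun _ _ M => maxMin M) η lam S

/-- The booster agent's posterior `p^μ(· | S)`. -/
def boosterPosterior (G : MarkovGame X A B) (F : FunctionClass.{u, v, w, z} X A B G.H)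
    (η lam : ℝ) (μ : MarkovPolicy X A) {t : ℕ} (S : History G t) : Measure F.Elem :=
  posterior G F (fun h x M => minAgainst (μ.prob h x) M) η (-lam) S

/-- The law of the data collected by the algorithm in the first `t` episodes: in each episode draw
`f` from the main agent's posterior, then `g` from the booster agent's posterior for `μ_f`, execute
`(μ_f, ν_{f,g})` and append the trajectory to the data. -/
def historyLaw (G : MarkovGame X A B) (σ : TieBreak X A B)
    (F : FunctionClass.{u, v, w, z} X A B G.H) (η lam : ℝ) : (t : ℕ) → Measure (History G t)
  | 0 => Measure.dirac fun i => i.elim0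
  | t + 1 =>
      (historyLaw G σ F η lam t).bind fun S =>
        (mainPosterior G F η lam S).bind fun f =>
          (boosterPosterior G F η lam (mainPolicy σ F f) S).bind fun g =>
            (episodeLaw G (mainPolicy σ F f) (boosterPolicy σ F f g)).map fun ζ =>
              Fin.snoc (α := fun _ => Trajectory X A B G.H) S ζ

/-- The booster agent's part of the regret over `T` episodes:
`∑_t E_{S_{t-1}} E_{f_t} E_{g_t} [V_1^{μ_t,ν_t}(x₁) - V_1^{μ_t,†}(x₁)]`. -/
def boosterRegret (G : MarkovGame X A B) (σ : TieBreak X A B)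
    (F : FunctionClass.{u, v, w, z} X A B G.H) (η lam : ℝ) (T : ℕ) : ℝ :=
  ∑ t ∈ Finset.range T,
    ∫ S, ∫ f, ∫ g,
      (value G (mainPolicy σ F f) (boosterPolicy σ F f g) 0 G.x₁
        - bestValue G (mainPolicy σ F f) 0 G.x₁)
      ∂(boosterPosterior G F η lam (mainPolicy σ F f) S)
      ∂(mainPosterior G F η lam S) ∂(historyLaw G σ F η lam t)

end Learning

end MarkovGames

end

set_option linter.unusedSectionVars false
set_option linter.unusedVariables false

noncomputable section

namespace MarkovGames

/-! Both posteriors are exponential tiltings of the product prior. The Gibbs inequality, posterior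
mean of `X` at most relative entropy plus `log ∫ exp X` under the prior (`integral_tilted_le`),
therefore trades every posterior mean for a prior mean, at the price of entropy. Under the prior the
drawn functions are independent of the data, and exponential moments along the run multiply up
episode by episode (`integral_exp_sum_runLaw_le`). The relative entropy itself is the mean exponent
minus the log-partition function.

Subtracting from each squared loss that of the Bellman backup leaves the exponent `c V - η (excess
loss) - (log normalizer)` (`posterior_exponent_eq`). The excess loss dominates the squared Bellman
residual up to bounded centred noise. The prior mass `exp (-κ)` near a backup controls the
normalizer and the log-partition function.

Let `A` be the main agent's mean entropy, let `R_f` and `R_g` be the cumulated squared residuals of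
the two draws, and put `c = 1/(24 β²)`. Up to errors of order `κ + λ ε` and a small discretization
term, `main_round` gives `15/24 A + c R_f ≤ λ E[V_f - V*]`, and `booster_round` gives `λ E[V_g^{μ_f}
- V^{μ_f,†}] + c R_g ≤ 13/24 A`. Here `A` enters the booster's bound because `f` itself depends on
the data. The benchmark `V*` is the value of a solution `f₀` of `f₀ = T^{μ_{f₀}} f₀`, which
completeness provides by backward recursion (`exists_backup_eq`).

The circle closes because optimism is bounded by the booster's own regret. On one side `V_g^{μ_f}`
equals the value of the played pair plus the residuals of `g` (`pairValue_eq_value_add`). On the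
other, `V_f` is at most that value plus the residuals of `f` (`pairValue_le_value_add`), while
`V^{μ_f,†} ≤ V*`, so `V_f - V*` is at most regret plus residuals of `f`. Decoupling with `m = c/λ`
bounds both sums of residuals by `(c/λ) R + λ d/(4c)`, and the `R` terms cancel against those of the
two round inequalities. What is left is `λ Reg ≤ 13/15 λ Reg + 28/15 (errors)`. Since `13/15 < 1`
the regret can be absorbed, and the prescribed `λ` balances the errors `T κ` and `λ² β² d`. -/

/-! ### Bounded measurable functions -/

/-- Bounded measurable real functions. -/
def BddMeas {α : Type*} [MeasurableSpace α] (f : α → ℝ) : Prop :=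
  Measurable f ∧ ∃ C, ∀ x, |f x| ≤ C

namespace BddMeas

variable {α β : Type*} [MeasurableSpace α] [MeasurableSpace β] {f g : α → ℝ}

theorem of_mem_Icc {a b : ℝ} (hf : Measurable f) (h : ∀ x, f x ∈ Set.Icc a b) : BddMeas f :=
  ⟨hf, max |a| |b|, fun x => abs_le_max_abs_abs (h x).1 (h x).2⟩

theorem const (c : ℝ) : BddMeas (fun _ : α => c) := ⟨measurable_const, |c|, fun _ => le_rfl⟩

theorem add (hf : BddMeas f) (hg : BddMeas g) : BddMeas (fun x => f x + g x) := by
  obtain ⟨hf, C, hC⟩ := hf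
  obtain ⟨hg, D, hD⟩ := hg
  exact ⟨hf.add hg, C + D, fun x => (abs_add_le _ _).trans (add_le_add (hC x) (hD x))⟩

theorem neg (hf : BddMeas f) : BddMeas (fun x => -f x) := by
  obtain ⟨hf, C, hC⟩ := hf
  exact ⟨hf.neg, C, fun x => by rw [abs_neg]; exact hC x⟩

theorem sub (hf : BddMeas f) (hg : BddMeas g) : BddMeas (fun x => f x - g x) := by
  simpa only [sub_eq_add_neg] using hf.add hg.neg

theorem mul (hf : BddMeas f) (hg : BddMeas g) : BddMeas (fun x => f x * g x) := by
  obtain ⟨hf, C, hC⟩ := hf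
  obtain ⟨hg, D, hD⟩ := hg
  refine ⟨hf.mul hg, C * D, fun x => ?_⟩
  rw [abs_mul]
  exact mul_le_mul (hC x) (hD x) (abs_nonneg _) ((abs_nonneg _).trans (hC x))

theorem const_mul (c : ℝ) (hf : BddMeas f) : BddMeas (fun x => c * f x) := (const c).mul hf

theorem pow (hf : BddMeas f) (n : ℕ) : BddMeas (fun x => f x ^ n) := by
  induction n with
  | zero => simpa using const 1
  | succ n ih => simpa only [pow_succ] using ih.mul hf

theorem sum {ι : Type*} {s : Finset ι} {f : ι → α → ℝ} (hf : ∀ i ∈ s, BddMeas (f i)) :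
    BddMeas (fun x => ∑ i ∈ s, f i x) := by
  classical
  induction s using Finset.induction_on with
  | empty => simpa using const 0
  | insert i s hi ih =>
    simp only [Finset.sum_insert hi]
    exact (hf i (Finset.mem_insert_self i s)).add
      (ih fun j hj => hf j (Finset.mem_insert_of_mem hj))

theorem exp (hf : BddMeas f) : BddMeas (fun x => Real.exp (f x)) := by
  obtain ⟨hf, C, hC⟩ := hf
  refine ⟨hf.exp, Real.exp C, fun x => ?_⟩
  rw [abs_of_pos (Real.exp_pos _)]
  exact Real.exp_le_exp.2 ((le_abs_self _).trans (hC x))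

theorem comp (hf : BddMeas f) {φ : β → α} (hφ : Measurable φ) : BddMeas (fun x => f (φ x)) :=
  ⟨hf.1.comp hφ, hf.2.imp fun _ h x => h (φ x)⟩

theorem log {δ : ℝ} (hδ : 0 < δ) (hf : BddMeas f) (h : ∀ x, δ ≤ f x) :
    BddMeas (fun x => Real.log (f x)) := by
  obtain ⟨hf, C, hC⟩ := hf
  refine ⟨hf.log, max |Real.log δ| |Real.log C|, fun x => ?_⟩
  exact abs_le_max_abs_abs (Real.log_le_log hδ (h x))
    (Real.log_le_log (hδ.trans_le (h x)) ((le_abs_self _).trans (hC x)))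

theorem integrable (hf : BddMeas f) (μ : Measure α) [IsFiniteMeasure μ] : Integrable f μ := by
  obtain ⟨hf, C, hC⟩ := hf
  exact Integrable.of_bound hf.aestronglyMeasurable C (Filter.Eventually.of_forall hC)

theorem abs_integral_le {C : ℝ} (hC : ∀ x, |f x| ≤ C) (μ : Measure α) [IsProbabilityMeasure μ] :
    |∫ x, f x ∂μ| ≤ C := by
  have := norm_integral_le_of_norm_le_const (μ := μ) (f := f) (C := C)
    (Filter.Eventually.of_forall hC)
  simpa using this

theorem integral_kernel {f : α → β → ℝ} (hf : BddMeas (fun p : α × β => f p.1 p.2))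
    (κ : Kernel α β) [IsMarkovKernel κ] : BddMeas (fun a => ∫ b, f a b ∂(κ a)) := by
  obtain ⟨hf, C, hC⟩ := hf
  refine ⟨?_, C, fun a => abs_integral_le (fun b => hC (a, b)) _⟩
  exact (StronglyMeasurable.integral_kernel_prod_right (κ := κ) (f := f)
    hf.stronglyMeasurable).measurable

theorem integral {f : α → β → ℝ} (hf : BddMeas (fun p : α × β => f p.1 p.2))
    (μ : Measure β) [IsProbabilityMeasure μ] : BddMeas (fun a => ∫ b, f a b ∂μ) := by
  simpa using hf.integral_kernel (Kernel.const α μ)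

theorem curry {f : α → β → ℝ} (hf : BddMeas (fun p : α × β => f p.1 p.2)) (a : α) :
    BddMeas (f a) := hf.comp (φ := fun b => (a, b)) (by fun_prop)

/-- A lower bound uniform in the parameter keeps logarithms and reciprocals of normalizers bounded,
so `BddMeas` is stable under tilting and integrability is automatic throughout. -/
theorem exists_integral_exp_bounds {f : α → β → ℝ} (hf : BddMeas (fun p : α × β => f p.1 p.2))
    (μ : Measure β) [IsProbabilityMeasure μ] :
    ∃ δ > 0, ∀ a, δ ≤ ∫ b, Real.exp (f a b) ∂μ := by
  obtain ⟨C, hC⟩ := hf.2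
  refine ⟨Real.exp (-C), Real.exp_pos _, fun a => ?_⟩
  have h := integral_mono (μ := μ) (integrable_const (Real.exp (-C)))
    ((hf.curry a).exp.integrable μ)
    (fun b => Real.exp_le_exp.2 (neg_le_of_abs_le (hC (a, b))))
  simpa using h

theorem log_integral_exp {f : α → β → ℝ} (hf : BddMeas (fun p : α × β => f p.1 p.2))
    (μ : Measure β) [IsProbabilityMeasure μ] :
    BddMeas (fun a => Real.log (∫ b, Real.exp (f a b) ∂μ)) := by
  obtain ⟨δ, hδ, h⟩ := hf.exists_integral_exp_bounds μ
  exact (integral (f := fun a b => Real.exp (f a b)) hf.exp μ).log hδ h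

theorem div_integral_exp {f : α → β → ℝ} (hf : BddMeas (fun p : α × β => f p.1 p.2))
    (μ : Measure β) [IsProbabilityMeasure μ] :
    BddMeas (fun p : α × β => Real.exp (f p.1 p.2) / ∫ b, Real.exp (f p.1 b) ∂μ) := by
  obtain ⟨δ, hδ, h⟩ := hf.exists_integral_exp_bounds μ
  have h1 := (hf.sub ((hf.log_integral_exp μ).comp measurable_fst)).exp
  have h2 : ∀ p : α × β, Real.exp (f p.1 p.2 - Real.log (∫ b, Real.exp (f p.1 b) ∂μ)) =
      Real.exp (f p.1 p.2) / ∫ b, Real.exp (f p.1 b) ∂μ := fun p => by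
    rw [Real.exp_sub, Real.exp_log (hδ.trans_le (h _))]
  simpa only [h2] using h1

theorem integral_tilted {u X : α → β → ℝ} (hu : BddMeas (fun p : α × β => u p.1 p.2))
    (hX : BddMeas (fun p : α × β => X p.1 p.2)) (μ : Measure β) [IsProbabilityMeasure μ] :
    BddMeas (fun a => ∫ b, X a b ∂(μ.tilted (u a))) := by
  simp only [MeasureTheory.integral_tilted, smul_eq_mul]
  exact integral (f := fun a b => Real.exp (u a b) / (∫ b, Real.exp (u a b) ∂μ) * X a b)
    ((hu.div_integral_exp μ).mul hX) μ

theorem isProbabilityMeasure_tilted {u : β → ℝ} (hu : BddMeas u) (μ : Measure β)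
    [IsProbabilityMeasure μ] : IsProbabilityMeasure (μ.tilted u) :=
  MeasureTheory.isProbabilityMeasure_tilted (hu.exp.integrable μ)

theorem measurable_tilted {u : α → β → ℝ} (hu : BddMeas (fun p : α × β => u p.1 p.2))
    (μ : Measure β) [IsProbabilityMeasure μ] : Measurable fun a => μ.tilted (u a) := by
  refine Measure.measurable_of_measurable_coe _ fun s hs => ?_
  simp only [tilted_apply' _ _ hs]
  have h := (hu.div_integral_exp μ).1.ennreal_ofReal
  exact Measurable.lintegral_prod_right' (ν := μ.restrict s)
    (f := fun p : α × β => ENNReal.ofReal (Real.exp (u p.1 p.2) / ∫ b, Real.exp (u p.1 b) ∂μ)) h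

end BddMeas

/-! ### Exponential tilting and the Gibbs variational inequality -/

section Tilting

variable {Ω Θ : Type*} [MeasurableSpace Ω] [MeasurableSpace Θ]

theorem exp_integral_le {f : Θ → ℝ} (hf : BddMeas f) (μ : Measure Θ) [IsProbabilityMeasure μ] :
    Real.exp (∫ x, f x ∂μ) ≤ ∫ x, Real.exp (f x) ∂μ :=
  convexOn_exp.map_integral_le Real.continuous_exp.continuousOn isClosed_univ
    (Filter.Eventually.of_forall fun _ => Set.mem_univ _) (hf.integrable μ) (hf.exp.integrable μ)

theorem integral_exp_pos' {f : Θ → ℝ} (hf : BddMeas f) (μ : Measure Θ) [IsProbabilityMeasure μ] :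
    0 < ∫ x, Real.exp (f x) ∂μ := (Real.exp_pos _).trans_le (exp_integral_le hf μ)

theorem integral_le_log {f : Θ → ℝ} (hf : BddMeas f) (μ : Measure Θ) [IsProbabilityMeasure μ] :
    ∫ x, f x ∂μ ≤ Real.log (∫ x, Real.exp (f x) ∂μ) :=
  (Real.le_log_iff_exp_le (integral_exp_pos' hf μ)).2 (exp_integral_le hf μ)

/-- The relative entropy of `μ.tilted u` with respect to `μ`. -/
def tiltKL (μ : Measure Θ) (u : Θ → ℝ) : ℝ :=
  ∫ x, u x ∂(μ.tilted u) - Real.log (∫ x, Real.exp (u x) ∂μ)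

/-- Gibbs variational inequality: Jensen for `exp (X - u)` under `μ.tilted u`, where its integral is
`∫ exp X / ∫ exp u`. -/
theorem integral_tilted_le {u X : Θ → ℝ} (hu : BddMeas u) (hX : BddMeas X) (μ : Measure Θ)
    [IsProbabilityMeasure μ] :
    ∫ x, X x ∂(μ.tilted u) ≤ tiltKL μ u + Real.log (∫ x, Real.exp (X x) ∂μ) := by
  have := hu.isProbabilityMeasure_tilted μ
  have h := integral_le_log (hX.sub hu) (μ.tilted u)
  rw [integral_exp_tilted] at h
  simp only [Pi.add_apply, add_sub_cancel] at h
  rw [Real.log_div (integral_exp_pos' hX μ).ne' (integral_exp_pos' hu μ).ne',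
    integral_sub (hX.integrable _) (hu.integrable _)] at h
  unfold tiltKL
  linarith

theorem tiltKL_nonneg {u : Θ → ℝ} (hu : BddMeas u) (μ : Measure Θ) [IsProbabilityMeasure μ] :
    0 ≤ tiltKL μ u := by
  simpa using integral_tilted_le hu (BddMeas.const 0) μ

theorem BddMeas.tiltKL {u : Ω → Θ → ℝ} (hu : BddMeas (fun p : Ω × Θ => u p.1 p.2))
    (μ : Measure Θ) [IsProbabilityMeasure μ] : BddMeas (fun a => tiltKL μ (u a)) :=
  (hu.integral_tilted hu μ).sub (hu.log_integral_exp μ)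

/-- The inverse moments of `∫ exp y` are controlled by those of `exp y` on a set of large prior
mass. -/
theorem integral_exp_neg_log_le {y : Ω → Θ → ℝ} (hy : BddMeas (fun p : Ω × Θ => y p.1 p.2))
    (P : Measure Ω) [IsProbabilityMeasure P] (μ : Measure Θ) [IsProbabilityMeasure μ]
    {k κ M : ℝ} (hk : 0 < k) {s : Set Θ} (hs : ENNReal.ofReal (Real.exp (-κ)) ≤ μ s)
    (h : ∀ θ ∈ s, ∫ ω, Real.exp (-k * y ω θ) ∂P ≤ M) :
    ∫ ω, Real.exp (k * -Real.log (∫ θ, Real.exp (y ω θ) ∂μ)) ∂P ≤ Real.exp (k * κ) * M := by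
  -- The set `s` need not be measurable (in use it is cut out by conditions at all states), so it is
  -- enlarged to the measurable set of all `θ` obeying the moment bound, and the prior is
  -- conditioned on that.
  set D : Set Θ := {θ | ∫ ω, Real.exp (-k * y ω θ) ∂P ≤ M} with hD
  have hyk : BddMeas (fun p : Ω × Θ => Real.exp (-k * y p.1 p.2)) := (hy.const_mul _).exp
  have hyk' : BddMeas (fun p : Θ × Ω => Real.exp (-k * y p.2 p.1)) := hyk.comp measurable_swap
  have hDm : MeasurableSet D :=
    measurableSet_le (BddMeas.integral (f := fun θ ω => Real.exp (-k * y ω θ)) hyk' P).1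
      measurable_const
  have hsD : s ⊆ D := h
  have hμD : ENNReal.ofReal (Real.exp (-κ)) ≤ μ D := hs.trans (measure_mono hsD)
  have hD0 : μ D ≠ 0 := (lt_of_lt_of_le (ENNReal.ofReal_pos.2 (Real.exp_pos _)) hμD).ne'
  have hpD : Real.exp (-κ) ≤ μ.real D := by
    rw [measureReal_def]
    exact (ENNReal.ofReal_le_iff_le_toReal (measure_ne_top _ _)).1 hμD
  set q : Measure Θ := ProbabilityTheory.cond μ D with hq
  have : IsProbabilityMeasure q := cond_isProbabilityMeasure hD0
  -- Jensen is used twice: for `∫ exp y` restricted to `D`, and again to bring the power `-k` back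
  -- inside the mean under `q`.
  have key : ∀ ω, Real.exp (k * -Real.log (∫ θ, Real.exp (y ω θ) ∂μ)) ≤
      Real.exp (k * κ) * ∫ θ, Real.exp (-k * y ω θ) ∂q := fun ω => by
    have hyω : BddMeas (y ω) := hy.curry ω
    have h1 : Real.exp (-κ) * Real.exp (∫ θ, y ω θ ∂q) ≤ ∫ θ, Real.exp (y ω θ) ∂μ := by
      calc Real.exp (-κ) * Real.exp (∫ θ, y ω θ ∂q)
          ≤ μ.real D * ∫ θ, Real.exp (y ω θ) ∂q :=
            mul_le_mul hpD (exp_integral_le hyω q) (Real.exp_pos _).le measureReal_nonneg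
        _ = ∫ θ in D, Real.exp (y ω θ) ∂μ := by
            rw [hq, ProbabilityTheory.cond, integral_smul_measure, ENNReal.toReal_inv,
              ← measureReal_def, smul_eq_mul, mul_inv_cancel_left₀]
            exact ((Real.exp_pos _).trans_le hpD).ne'
        _ ≤ ∫ θ, Real.exp (y ω θ) ∂μ :=
            setIntegral_le_integral (hyω.exp.integrable μ)
              (Filter.Eventually.of_forall fun _ => (Real.exp_pos _).le)
    rw [← Real.exp_add] at h1
    have h2 : -Real.log (∫ θ, Real.exp (y ω θ) ∂μ) ≤ κ - ∫ θ, y ω θ ∂q := by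
      have := (Real.le_log_iff_exp_le ((Real.exp_pos _).trans_le h1)).2 h1
      linarith
    calc Real.exp (k * -Real.log (∫ θ, Real.exp (y ω θ) ∂μ))
        ≤ Real.exp (k * κ + ∫ θ, -k * y ω θ ∂q) := by
          rw [Real.exp_le_exp, integral_const_mul]
          nlinarith
      _ ≤ _ := by
          rw [Real.exp_add]
          exact mul_le_mul_of_nonneg_left (exp_integral_le (hyω.const_mul _) q)
            (Real.exp_pos _).le
  calc ∫ ω, Real.exp (k * -Real.log (∫ θ, Real.exp (y ω θ) ∂μ)) ∂P
      ≤ ∫ ω, Real.exp (k * κ) * ∫ θ, Real.exp (-k * y ω θ) ∂q ∂P :=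
        integral_mono (((hy.log_integral_exp μ).neg.const_mul k).exp.integrable P)
          (((BddMeas.integral (f := fun ω θ => Real.exp (-k * y ω θ)) hyk q).const_mul
            _).integrable P) key
    _ = Real.exp (k * κ) * ∫ θ, ∫ ω, Real.exp (-k * y ω θ) ∂P ∂q := by
        rw [integral_const_mul, integral_integral_swap]
        exact hyk.integrable (P.prod q)
    _ ≤ Real.exp (k * κ) * M := by
        refine mul_le_mul_of_nonneg_left ?_ (Real.exp_pos _).le
        have h3 : ∀ᵐ θ ∂q, ∫ ω, Real.exp (-k * y ω θ) ∂P ≤ M := ae_cond_mem hDm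
        have h4 := integral_mono_ae
          ((BddMeas.integral (f := fun θ ω => Real.exp (-k * y ω θ)) hyk' P).integrable q)
          (integrable_const M) h3
        simpa using h4

/-- Jensen for the logarithm over the data, then Fubini: only moments over the data at a fixed `θ`
are needed. -/
theorem integral_log_integral_exp_le {X : Ω → Θ → ℝ} (hX : BddMeas (fun p : Ω × Θ => X p.1 p.2))
    (P : Measure Ω) [IsProbabilityMeasure P] (μ : Measure Θ) [IsProbabilityMeasure μ] {M : ℝ}
    (h : ∀ θ, ∫ ω, Real.exp (X ω θ) ∂P ≤ M) :
    ∫ ω, Real.log (∫ θ, Real.exp (X ω θ) ∂μ) ∂P ≤ Real.log M := by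
  refine (integral_le_log (hX.log_integral_exp μ) P).trans ?_
  have hpos : ∀ ω, 0 < ∫ θ, Real.exp (X ω θ) ∂μ := fun ω => integral_exp_pos' (hX.curry ω) μ
  refine Real.log_le_log (integral_exp_pos' (hX.log_integral_exp μ) P) ?_
  simp only [Real.exp_log (hpos _)]
  have hX' : BddMeas (fun p : Θ × Ω => Real.exp (X p.2 p.1)) := hX.exp.comp measurable_swap
  rw [integral_integral_swap (f := fun ω θ => Real.exp (X ω θ)) (hX.exp.integrable (P.prod μ))]
  have := integral_mono
    ((BddMeas.integral (f := fun θ ω => Real.exp (X ω θ)) hX' P).integrable μ)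
    (integrable_const M) h
  simpa using this

/-- A larger `k` makes the entropy cheaper but demands a higher exponential moment; the values `6`
and `24` are used below. -/
theorem integral_tilted_scaled_le {u X : Θ → ℝ} (hu : BddMeas u) (hX : BddMeas X) (μ : Measure Θ)
    [IsProbabilityMeasure μ] {k : ℝ} (hk : 0 < k) :
    ∫ x, X x ∂(μ.tilted u) ≤ k⁻¹ * (tiltKL μ u + Real.log (∫ x, Real.exp (k * X x) ∂μ)) := by
  have h := integral_tilted_le hu (hX.const_mul k) μ
  rw [integral_const_mul] at h
  rw [inv_mul_eq_div, le_div_iff₀ hk]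
  linarith

theorem integral_integral_tilted_le {u X : Ω → Θ → ℝ}
    (hu : BddMeas (fun p : Ω × Θ => u p.1 p.2)) (hX : BddMeas (fun p : Ω × Θ => X p.1 p.2))
    (P : Measure Ω) [IsProbabilityMeasure P] (μ : Measure Θ) [IsProbabilityMeasure μ] {k : ℝ}
    (hk : 0 < k) :
    ∫ ω, ∫ θ, X ω θ ∂(μ.tilted (u ω)) ∂P ≤ k⁻¹ * (∫ ω, tiltKL μ (u ω) ∂P +
      ∫ ω, Real.log (∫ θ, Real.exp (k * X ω θ) ∂μ) ∂P) := by
  have hL := BddMeas.log_integral_exp (f := fun ω θ => k * X ω θ) (hX.const_mul k) μ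
  rw [← integral_add ((hu.tiltKL μ).integrable P) (hL.integrable P), ← integral_const_mul]
  exact integral_mono ((hu.integral_tilted hX μ).integrable P)
    ((((hu.tiltKL μ).add hL).const_mul _).integrable P)
    fun ω => integral_tilted_scaled_le (hu.curry ω) (hX.curry ω) μ hk

end Tilting


/-! ### The Gibbs inequality for pairs, and for sums over consecutive coordinates -/

section Pairs

variable {Ω Θ : Type*} [MeasurableSpace Ω] [MeasurableSpace Θ]

theorem BddMeas.integral_tilted_pair {u X : Ω → Θ → Θ → ℝ}
    (hu : BddMeas (fun p : Ω × Θ × Θ => u p.1 p.2.1 p.2.2))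
    (hX : BddMeas (fun p : Ω × Θ × Θ => X p.1 p.2.1 p.2.2)) (μ : Measure Θ)
    [IsProbabilityMeasure μ] : BddMeas (fun p : Ω × Θ => ∫ g, X p.1 p.2 g ∂(μ.tilted (u p.1 p.2))) :=
  BddMeas.integral_tilted (u := fun (p : Ω × Θ) g => u p.1 p.2 g)
    (X := fun (p : Ω × Θ) g => X p.1 p.2 g)
    (hu.comp (φ := fun p : (Ω × Θ) × Θ => (p.1.1, p.1.2, p.2)) (by fun_prop))
    (hX.comp (φ := fun p : (Ω × Θ) × Θ => (p.1.1, p.1.2, p.2)) (by fun_prop)) μ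

theorem BddMeas.log_integral_exp_pair {X : Ω → Θ → Θ → ℝ}
    (hX : BddMeas (fun p : Ω × Θ × Θ => X p.1 p.2.1 p.2.2)) (μ : Measure Θ)
    [IsProbabilityMeasure μ] :
    BddMeas (fun p : Ω × Θ => Real.log (∫ g, Real.exp (X p.1 p.2 g) ∂μ)) :=
  BddMeas.log_integral_exp (f := fun (p : Ω × Θ) g => X p.1 p.2 g)
    (hX.comp (φ := fun p : (Ω × Θ) × Θ => (p.1.1, p.1.2, p.2)) (by fun_prop)) μ

theorem BddMeas.tiltKL_pair {u : Ω → Θ → Θ → ℝ}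
    (hu : BddMeas (fun p : Ω × Θ × Θ => u p.1 p.2.1 p.2.2)) (μ : Measure Θ)
    [IsProbabilityMeasure μ] : BddMeas (fun p : Ω × Θ => MarkovGames.tiltKL μ (u p.1 p.2)) :=
  (hu.integral_tilted_pair hu μ).sub (hu.log_integral_exp_pair μ)

/-- The Gibbs inequality is applied to `g` for fixed `f`, and then with scale `1` to the resulting
log-integral as a function of `f`. The outer exponential undoes the inner logarithm, so the two
entropies add and one double integral remains. -/
theorem integral_pair_tilted_le {uA : Ω → Θ → ℝ} {uB X : Ω → Θ → Θ → ℝ}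
    (hA : BddMeas (fun p : Ω × Θ => uA p.1 p.2))
    (hB : BddMeas (fun p : Ω × Θ × Θ => uB p.1 p.2.1 p.2.2))
    (hX : BddMeas (fun p : Ω × Θ × Θ => X p.1 p.2.1 p.2.2))
    (P : Measure Ω) [IsProbabilityMeasure P] (μ : Measure Θ) [IsProbabilityMeasure μ] {k : ℝ}
    (hk : 0 < k) :
    ∫ ω, ∫ f, ∫ g, X ω f g ∂(μ.tilted (uB ω f)) ∂(μ.tilted (uA ω)) ∂P ≤
      k⁻¹ * (∫ ω, tiltKL μ (uA ω) ∂P + ∫ ω, ∫ f, tiltKL μ (uB ω f) ∂(μ.tilted (uA ω)) ∂P +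
        ∫ ω, Real.log (∫ f, ∫ g, Real.exp (k * X ω f g) ∂μ ∂μ) ∂P) := by
  have hkX : BddMeas (fun p : Ω × Θ × Θ => k * X p.1 p.2.1 p.2.2) := hX.const_mul k
  have hY := BddMeas.log_integral_exp_pair (X := fun ω f g => k * X ω f g) hkX μ
  have hKB := hB.tiltKL_pair μ
  have hin := hB.integral_tilted_pair hX μ
  have h1 : ∫ ω, ∫ f, ∫ g, X ω f g ∂(μ.tilted (uB ω f)) ∂(μ.tilted (uA ω)) ∂P ≤
      ∫ ω, ∫ f, (k⁻¹ * tiltKL μ (uB ω f) +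
        k⁻¹ * Real.log (∫ g, Real.exp (k * X ω f g) ∂μ)) ∂(μ.tilted (uA ω)) ∂P := by
    have hr := (hKB.const_mul k⁻¹).add (hY.const_mul k⁻¹)
    refine integral_mono ((hA.integral_tilted
        (X := fun ω f => ∫ g, X ω f g ∂(μ.tilted (uB ω f))) hin μ).integrable P)
      ((hA.integral_tilted (X := fun ω f => k⁻¹ * tiltKL μ (uB ω f) +
        k⁻¹ * Real.log (∫ g, Real.exp (k * X ω f g) ∂μ)) hr μ).integrable P) fun ω => ?_
    have := (hA.curry ω).isProbabilityMeasure_tilted μ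
    refine integral_mono ((BddMeas.curry
        (f := fun ω f => ∫ g, X ω f g ∂(μ.tilted (uB ω f))) hin ω).integrable _)
      ((BddMeas.curry (f := fun ω f => k⁻¹ * tiltKL μ (uB ω f) +
        k⁻¹ * Real.log (∫ g, Real.exp (k * X ω f g) ∂μ)) hr ω).integrable _) fun f => ?_
    have h := integral_tilted_scaled_le (u := uB ω f) (X := X ω f)
      (hB.comp (φ := fun g => (ω, f, g)) (by fun_prop))
      (hX.comp (φ := fun g => (ω, f, g)) (by fun_prop)) μ hk
    rwa [mul_add] at h
  have h2 : ∫ ω, ∫ f, (k⁻¹ * tiltKL μ (uB ω f) +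
        k⁻¹ * Real.log (∫ g, Real.exp (k * X ω f g) ∂μ)) ∂(μ.tilted (uA ω)) ∂P =
      k⁻¹ * ∫ ω, ∫ f, tiltKL μ (uB ω f) ∂(μ.tilted (uA ω)) ∂P +
      k⁻¹ * ∫ ω, ∫ f, Real.log (∫ g, Real.exp (k * X ω f g) ∂μ) ∂(μ.tilted (uA ω)) ∂P := by
    rw [← integral_const_mul, ← integral_const_mul, ← integral_add]
    · refine integral_congr_ae (Filter.Eventually.of_forall fun ω => ?_)
      have := (hA.curry ω).isProbabilityMeasure_tilted μ
      simp only
      rw [← integral_const_mul, ← integral_const_mul, ← integral_add]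
      · exact ((BddMeas.curry (f := fun ω f => tiltKL μ (uB ω f)) hKB ω).const_mul _).integrable _
      · exact ((BddMeas.curry (f := fun ω f => Real.log (∫ g, Real.exp (k * X ω f g) ∂μ))
          hY ω).const_mul _).integrable _
    · exact ((hA.integral_tilted (X := fun ω f => tiltKL μ (uB ω f)) hKB μ).const_mul _).integrable P
    · exact ((hA.integral_tilted (X := fun ω f => Real.log (∫ g, Real.exp (k * X ω f g) ∂μ))
        hY μ).const_mul _).integrable P
  have h3 := integral_integral_tilted_le
    (X := fun ω f => Real.log (∫ g, Real.exp (k * X ω f g) ∂μ)) hA hY P μ one_pos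
  have h4 : ∀ ω f, Real.exp (Real.log (∫ g, Real.exp (k * X ω f g) ∂μ)) =
      ∫ g, Real.exp (k * X ω f g) ∂μ := fun ω f => by
    rw [Real.exp_log (integral_exp_pos' (f := fun g => k * X ω f g)
      (hkX.comp (φ := fun g => (ω, f, g)) (by fun_prop)) μ)]
  simp only [inv_one, one_mul, h4] at h3
  have h5 := mul_le_mul_of_nonneg_left h3 (inv_pos.2 hk).le
  linarith

theorem integral_integral_tilted_add {u X Y : Ω → Θ → ℝ}
    (hu : BddMeas (fun p : Ω × Θ => u p.1 p.2)) (hX : BddMeas (fun p : Ω × Θ => X p.1 p.2))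
    (hY : BddMeas (fun p : Ω × Θ => Y p.1 p.2))
    (P : Measure Ω) [IsProbabilityMeasure P] (μ : Measure Θ) [IsProbabilityMeasure μ] :
    ∫ ω, ∫ θ, (X ω θ + Y ω θ) ∂(μ.tilted (u ω)) ∂P =
      ∫ ω, ∫ θ, X ω θ ∂(μ.tilted (u ω)) ∂P + ∫ ω, ∫ θ, Y ω θ ∂(μ.tilted (u ω)) ∂P := by
  rw [← integral_add ((hu.integral_tilted hX μ).integrable P)
    ((hu.integral_tilted hY μ).integrable P)]
  refine integral_congr_ae (Filter.Eventually.of_forall fun ω => ?_)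
  have := (hu.curry ω).isProbabilityMeasure_tilted μ
  exact integral_add ((hX.curry ω).integrable _) ((hY.curry ω).integrable _)

theorem integral_pair_tilted_add {uA : Ω → Θ → ℝ} {uB X Y : Ω → Θ → Θ → ℝ}
    (hA : BddMeas (fun p : Ω × Θ => uA p.1 p.2))
    (hB : BddMeas (fun p : Ω × Θ × Θ => uB p.1 p.2.1 p.2.2))
    (hX : BddMeas (fun p : Ω × Θ × Θ => X p.1 p.2.1 p.2.2))
    (hY : BddMeas (fun p : Ω × Θ × Θ => Y p.1 p.2.1 p.2.2))
    (P : Measure Ω) [IsProbabilityMeasure P] (μ : Measure Θ) [IsProbabilityMeasure μ] :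
    ∫ ω, ∫ f, ∫ g, (X ω f g + Y ω f g) ∂(μ.tilted (uB ω f)) ∂(μ.tilted (uA ω)) ∂P =
      ∫ ω, ∫ f, ∫ g, X ω f g ∂(μ.tilted (uB ω f)) ∂(μ.tilted (uA ω)) ∂P +
      ∫ ω, ∫ f, ∫ g, Y ω f g ∂(μ.tilted (uB ω f)) ∂(μ.tilted (uA ω)) ∂P := by
  rw [← integral_integral_tilted_add (u := uA)
    (X := fun ω f => ∫ g, X ω f g ∂(μ.tilted (uB ω f)))
    (Y := fun ω f => ∫ g, Y ω f g ∂(μ.tilted (uB ω f))) hA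
    (hB.integral_tilted_pair hX μ) (hB.integral_tilted_pair hY μ) P μ]
  refine integral_congr_ae (Filter.Eventually.of_forall fun ω => ?_)
  refine integral_congr_ae (Filter.Eventually.of_forall fun f => ?_)
  have hBf : BddMeas (uB ω f) := hB.comp (φ := fun g => (ω, f, g)) (by fun_prop)
  have := hBf.isProbabilityMeasure_tilted μ
  exact integral_add ((hX.comp (φ := fun g => (ω, f, g)) (by fun_prop)).integrable _)
    ((hY.comp (φ := fun g => (ω, f, g)) (by fun_prop)).integrable _)

end Pairs

/-! ### Product priors and functions of neighbouring coordinates. -/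

section Product

variable {n : ℕ} {Θ : Fin n → Type*} [∀ i, MeasurableSpace (Θ i)] (μ : ∀ i, Measure (Θ i))
  [∀ i, IsProbabilityMeasure (μ i)]

theorem _root_.DependsOn.exists_measurable_factor {ψ : (∀ i, Θ i) → ℝ} (hψ : Measurable ψ)
    {S : Finset (Fin n)} (h : DependsOn ψ S) (θ₀ : ∀ i, Θ i) :
    ∃ φ : (∀ i : S, Θ i) → ℝ, Measurable φ ∧ ∀ θ, ψ θ = φ fun i => θ i := by
  refine ⟨fun x => ψ fun i => if hi : i ∈ S then x ⟨i, hi⟩ else θ₀ i,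
    hψ.comp (measurable_pi_lambda _ fun i => ?_), fun θ => h fun i hi => ?_⟩
  · by_cases hi : i ∈ S
    · simp only [hi, dif_pos]
      exact measurable_pi_apply _
    · simp only [hi, dif_neg, not_false_eq_true]
      exact measurable_const
  · have : i ∈ S := by simpa using hi
    simp [this]

theorem integral_prod_of_disjoint_support {ψ : Fin n → (∀ i, Θ i) → ℝ}
    (hψ : ∀ h, Measurable (ψ h)) {S : Fin n → Finset (Fin n)} (hS : ∀ h, DependsOn (ψ h) (S h))
    (E : Finset (Fin n)) (hE : ∀ h ∈ E, ∀ h' ∈ E, h ≠ h' → Disjoint (S h) (S h')) :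
    ∫ θ, ∏ h ∈ E, ψ h θ ∂(Measure.pi μ) = ∏ h ∈ E, ∫ θ, ψ h θ ∂(Measure.pi μ) := by
  classical
  obtain ⟨θ₀⟩ := nonempty_of_isProbabilityMeasure (Measure.pi μ)
  induction E using Finset.induction_on with
  | empty => simp
  | insert h₀ E hh ih =>
    rw [Finset.prod_insert hh, ← ih fun h hh h' hh' => hE h (Finset.mem_insert_of_mem hh) h'
      (Finset.mem_insert_of_mem hh')]
    simp only [Finset.prod_insert hh]
    have hind : iIndepFun (fun i (θ : ∀ i, Θ i) => θ i) (Measure.pi μ) :=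
      iIndepFun_pi (μ := μ) (X := fun i (x : Θ i) => x) fun i => aemeasurable_id
    have hdisj : Disjoint (S h₀) (E.biUnion S) := by
      rw [Finset.disjoint_biUnion_right]
      intro h hhE
      exact hE h₀ (Finset.mem_insert_self _ _) h (Finset.mem_insert_of_mem hhE)
        (fun e => hh (e ▸ hhE))
    have hI := hind.indepFun_finset _ _ hdisj fun i => measurable_pi_apply i
    have hprod : Measurable fun θ => ∏ h ∈ E, ψ h θ := Finset.measurable_fun_prod _ fun h _ => hψ h
    have hdep : DependsOn (fun θ => ∏ h ∈ E, ψ h θ) (E.biUnion S : Finset (Fin n)) := by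
      intro x y hxy
      refine Finset.prod_congr rfl fun h hhE => hS h fun i hi => hxy i ?_
      simp only [Finset.coe_biUnion, Set.mem_iUnion]
      exact ⟨h, hhE, hi⟩
    obtain ⟨φ₁, hφ₁, e₁⟩ := (hS h₀).exists_measurable_factor (hψ h₀) θ₀
    obtain ⟨φ₂, hφ₂, e₂⟩ := hdep.exists_measurable_factor hprod θ₀
    simp only [e₁, e₂]
    exact hI.integral_fun_comp_mul_comp
      (measurable_pi_lambda _ fun i => measurable_pi_apply _).aemeasurable
      (measurable_pi_lambda _ fun i => measurable_pi_apply _).aemeasurable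
      hφ₁.aestronglyMeasurable hφ₂.aestronglyMeasurable

variable {Ω : Type*} [MeasurableSpace Ω] (P : Measure Ω) [IsProbabilityMeasure P]

/-- The indices `h` and `h + 1`. -/
def nextPair (h : Fin n) : Finset (Fin n) := Finset.univ.filter fun i => i.1 = h ∨ i.1 = h + 1

/-- The indices which are congruent to `r` modulo `2`. -/
def parityClass (n r : ℕ) : Finset (Fin n) := Finset.univ.filter fun h => h.1 % 2 = r

theorem disjoint_nextPair {h h' : Fin n} (hne : h ≠ h') (hpar : h.1 % 2 = h'.1 % 2) :
    Disjoint (nextPair h) (nextPair h') := by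
  rw [Finset.disjoint_left]
  intro i hi hi'
  simp only [nextPair, Finset.mem_filter, Finset.mem_univ, true_and] at hi hi'
  have := Fin.val_ne_of_ne hne
  omega

/-- A residual at step `h` reads only the coordinates `h` and `h + 1`, so steps of equal parity read
disjoint blocks. Under the product prior the integral then factors and its logarithm is a sum. Hence
a moment bound for each single step suffices, and none is needed for several steps jointly. -/
theorem integral_log_integral_exp_sum_le {X : Ω → Fin n → (∀ i, Θ i) → ℝ}
    (hX : ∀ h, BddMeas (fun p : Ω × (∀ i, Θ i) => X p.1 h p.2))
    (hdep : ∀ ω h, DependsOn (X ω h) (nextPair h))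
    (h1 : ∀ h θ, ∫ ω, Real.exp (X ω h θ) ∂P ≤ 1) (r : ℕ) :
    ∫ ω, Real.log (∫ θ, Real.exp (∑ h ∈ parityClass n r, X ω h θ) ∂(Measure.pi μ)) ∂P ≤ 0 := by
  have hpos : ∀ ω h, 0 < ∫ θ, Real.exp (X ω h θ) ∂(Measure.pi μ) := fun ω h =>
    integral_exp_pos' (BddMeas.curry (f := fun ω θ => X ω h θ) (hX h) ω) _
  have e : ∀ ω, Real.log (∫ θ, Real.exp (∑ h ∈ parityClass n r, X ω h θ) ∂(Measure.pi μ)) =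
      ∑ h ∈ parityClass n r, Real.log (∫ θ, Real.exp (X ω h θ) ∂(Measure.pi μ)) := fun ω => by
    rw [← Real.log_prod fun h _ => (hpos ω h).ne']
    simp only [Real.exp_sum]
    rw [integral_prod_of_disjoint_support μ (ψ := fun h θ => Real.exp (X ω h θ))
      (fun h => (BddMeas.curry (f := fun ω θ => X ω h θ) (hX h) ω).1.exp)
      (fun h x y hxy => congrArg Real.exp (hdep ω h hxy))]
    intro h hh h' hh' hne
    simp only [parityClass, Finset.mem_filter, Finset.mem_univ, true_and] at hh hh'
    exact disjoint_nextPair hne (hh.trans hh'.symm)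
  simp only [e]
  rw [integral_finsetSum _ fun h _ =>
    (BddMeas.log_integral_exp (f := fun ω θ => X ω h θ) (hX h) _).integrable P]
  refine Finset.sum_nonpos fun h _ => ?_
  simpa using integral_log_integral_exp_le (X := fun ω θ => X ω h θ) (hX h) P (Measure.pi μ) (h1 h)

/-- Factor in `g` for fixed `f`; the factors are again local in `f`, so the same argument applies to
the outer integral. -/
theorem integral_log_integral_exp_sum_pair_le {X : Ω → Fin n → (∀ i, Θ i) → (∀ i, Θ i) → ℝ}
    (hX : ∀ h, BddMeas (fun p : Ω × (∀ i, Θ i) × (∀ i, Θ i) => X p.1 h p.2.1 p.2.2))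
    (hdep : ∀ ω h f, DependsOn (X ω h f) (nextPair h))
    (hdep' : ∀ ω h g, DependsOn (fun f => X ω h f g) (nextPair h))
    (h1 : ∀ h f g, ∫ ω, Real.exp (X ω h f g) ∂P ≤ 1) (r : ℕ) :
    ∫ ω, Real.log (∫ f, ∫ g, Real.exp (∑ h ∈ parityClass n r, X ω h f g) ∂(Measure.pi μ)
      ∂(Measure.pi μ)) ∂P ≤ 0 := by
  have hpr : ∀ h : Fin n, BddMeas (fun p : Ω × ((∀ i, Θ i) × (∀ i, Θ i)) =>
      (fun ω (q : (∀ i, Θ i) × (∀ i, Θ i)) => X ω h q.1 q.2) p.1 p.2) := hX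
  have hXω : ∀ ω h, BddMeas (fun q : (∀ i, Θ i) × (∀ i, Θ i) => X ω h q.1 q.2) :=
    fun ω h => (hX h).comp (φ := fun q => (ω, q)) (by fun_prop)
  have hfub : ∀ ω h, ∫ f, ∫ g, Real.exp (X ω h f g) ∂(Measure.pi μ) ∂(Measure.pi μ) =
      ∫ q, Real.exp (X ω h q.1 q.2) ∂((Measure.pi μ).prod (Measure.pi μ)) := fun ω h =>
    (integral_prod (fun q : (∀ i, Θ i) × (∀ i, Θ i) => Real.exp (X ω h q.1 q.2))
      ((hXω ω h).exp.integrable _)).symm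
  have e : ∀ ω, Real.log (∫ f, ∫ g, Real.exp (∑ h ∈ parityClass n r, X ω h f g) ∂(Measure.pi μ)
      ∂(Measure.pi μ)) = ∑ h ∈ parityClass n r,
      Real.log (∫ q, Real.exp (X ω h q.1 q.2) ∂((Measure.pi μ).prod (Measure.pi μ))) := fun ω => by
    rw [← Real.log_prod fun h _ => (integral_exp_pos' (hXω ω h) _).ne']
    simp only [Real.exp_sum]
    have hpar : ∀ h ∈ parityClass n r, ∀ h' ∈ parityClass n r, h ≠ h' →
        Disjoint (nextPair h) (nextPair h') := by
      intro h hh h' hh' hne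
      simp only [parityClass, Finset.mem_filter, Finset.mem_univ, true_and] at hh hh'
      exact disjoint_nextPair hne (hh.trans hh'.symm)
    have step : ∀ f, ∫ g, ∏ h ∈ parityClass n r, Real.exp (X ω h f g) ∂(Measure.pi μ) =
        ∏ h ∈ parityClass n r, ∫ g, Real.exp (X ω h f g) ∂(Measure.pi μ) := fun f =>
      integral_prod_of_disjoint_support μ (ψ := fun h g => Real.exp (X ω h f g))
        (fun h => (BddMeas.curry (f := fun f g => X ω h f g) (hXω ω h) f).1.exp)
        (fun h x y hxy => congrArg Real.exp (hdep ω h f hxy)) _ hpar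
    simp only [step]
    rw [integral_prod_of_disjoint_support μ
      (ψ := fun h f => ∫ g, Real.exp (X ω h f g) ∂(Measure.pi μ))
      (fun h => (BddMeas.integral (f := fun f g => Real.exp (X ω h f g)) (hXω ω h).exp _).1)
      (S := nextPair) ?_ _ hpar]
    · simp only [hfub]
    · intro h x y hxy
      have : ∀ g, X ω h x g = X ω h y g := fun g => hdep' ω h g hxy
      simp only [this]
  simp only [e]
  rw [integral_finsetSum _ fun h _ => ((hpr h).log_integral_exp _).integrable P]
  refine Finset.sum_nonpos fun h _ => ?_
  simpa using integral_log_integral_exp_le (hpr h) P ((Measure.pi μ).prod (Measure.pi μ))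
    (fun q => h1 h q.1 q.2)

theorem sum_parity (a : Fin n → ℝ) :
    ∑ h, a h = (∑ h ∈ parityClass n 0, a h) + ∑ h ∈ parityClass n 1, a h := by
  rw [← Finset.sum_filter_add_sum_filter_not Finset.univ (fun h : Fin n => h.1 % 2 = 0)]
  refine congrArg₂ (· + ·) rfl (Finset.sum_congr ?_ fun _ _ => rfl)
  ext h
  simp [parityClass]

/-- Even and odd steps are treated separately, each paying the entropy once; this is the factor `2`.
-/
theorem integral_tilted_sum_le {u : Ω → (∀ i, Θ i) → ℝ} {X : Ω → Fin n → (∀ i, Θ i) → ℝ}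
    (hu : BddMeas (fun p : Ω × (∀ i, Θ i) => u p.1 p.2))
    (hX : ∀ h, BddMeas (fun p : Ω × (∀ i, Θ i) => X p.1 h p.2))
    (hdep : ∀ ω h, DependsOn (X ω h) (nextPair h)) {k : ℝ} (hk : 0 < k)
    (h1 : ∀ h θ, ∫ ω, Real.exp (k * X ω h θ) ∂P ≤ 1) :
    ∫ ω, ∫ θ, ∑ h, X ω h θ ∂((Measure.pi μ).tilted (u ω)) ∂P ≤
      2 * k⁻¹ * ∫ ω, tiltKL (Measure.pi μ) (u ω) ∂P := by
  have hs : ∀ r : ℕ, BddMeas (fun p : Ω × (∀ i, Θ i) =>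
      (fun ω θ => ∑ h ∈ parityClass n r, X ω h θ) p.1 p.2) :=
    fun r => BddMeas.sum fun h _ => hX h
  have key : ∀ r : ℕ, ∫ ω, ∫ θ, ∑ h ∈ parityClass n r, X ω h θ ∂((Measure.pi μ).tilted (u ω)) ∂P ≤
      k⁻¹ * ∫ ω, tiltKL (Measure.pi μ) (u ω) ∂P := fun r => by
    refine (integral_integral_tilted_le hu (hs r) P _ hk).trans ?_
    have := integral_log_integral_exp_sum_le μ P (X := fun ω h θ => k * X ω h θ)
      (fun h => (hX h).const_mul k) (fun ω h x y hxy => by simp only [hdep ω h hxy]) h1 r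
    simp only [Finset.mul_sum]
    nlinarith [inv_pos.2 hk]
  have e := integral_integral_tilted_add
    (X := fun ω θ => ∑ h ∈ parityClass n 0, X ω h θ)
    (Y := fun ω θ => ∑ h ∈ parityClass n 1, X ω h θ) hu (hs 0) (hs 1) P (Measure.pi μ)
  have hs' : ∀ ω θ, ∑ h, X ω h θ = (∑ h ∈ parityClass n 0, X ω h θ) +
      ∑ h ∈ parityClass n 1, X ω h θ := fun ω θ => sum_parity _
  simp only [hs']
  rw [e]
  exact (add_le_add (key 0) (key 1)).trans_eq (by ring)

theorem integral_pair_tilted_sum_le {uA : Ω → (∀ i, Θ i) → ℝ}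
    {uB : Ω → (∀ i, Θ i) → (∀ i, Θ i) → ℝ} {X : Ω → Fin n → (∀ i, Θ i) → (∀ i, Θ i) → ℝ}
    (hA : BddMeas (fun p : Ω × (∀ i, Θ i) => uA p.1 p.2))
    (hB : BddMeas (fun p : Ω × (∀ i, Θ i) × (∀ i, Θ i) => uB p.1 p.2.1 p.2.2))
    (hX : ∀ h, BddMeas (fun p : Ω × (∀ i, Θ i) × (∀ i, Θ i) => X p.1 h p.2.1 p.2.2))
    (hdep : ∀ ω h f, DependsOn (X ω h f) (nextPair h))
    (hdep' : ∀ ω h g, DependsOn (fun f => X ω h f g) (nextPair h)) {k : ℝ} (hk : 0 < k)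
    (h1 : ∀ h f g, ∫ ω, Real.exp (k * X ω h f g) ∂P ≤ 1) :
    ∫ ω, ∫ f, ∫ g, ∑ h, X ω h f g ∂((Measure.pi μ).tilted (uB ω f))
        ∂((Measure.pi μ).tilted (uA ω)) ∂P ≤
      2 * k⁻¹ * (∫ ω, tiltKL (Measure.pi μ) (uA ω) ∂P +
        ∫ ω, ∫ f, tiltKL (Measure.pi μ) (uB ω f) ∂((Measure.pi μ).tilted (uA ω)) ∂P) := by
  have hs : ∀ r : ℕ, BddMeas (fun p : Ω × (∀ i, Θ i) × (∀ i, Θ i) =>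
      (fun ω f g => ∑ h ∈ parityClass n r, X ω h f g) p.1 p.2.1 p.2.2) :=
    fun r => BddMeas.sum fun h _ => hX h
  have key : ∀ r : ℕ, ∫ ω, ∫ f, ∫ g, ∑ h ∈ parityClass n r, X ω h f g
        ∂((Measure.pi μ).tilted (uB ω f)) ∂((Measure.pi μ).tilted (uA ω)) ∂P ≤
      k⁻¹ * (∫ ω, tiltKL (Measure.pi μ) (uA ω) ∂P +
        ∫ ω, ∫ f, tiltKL (Measure.pi μ) (uB ω f) ∂((Measure.pi μ).tilted (uA ω)) ∂P) :=
    fun r => by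
    refine (integral_pair_tilted_le hA hB (hs r) P _ hk).trans ?_
    have := integral_log_integral_exp_sum_pair_le μ P (X := fun ω h f g => k * X ω h f g)
      (fun h => (hX h).const_mul k) (fun ω h f x y hxy => by simp only [hdep ω h f hxy])
      (fun ω h g x y hxy => congrArg (k * ·) (hdep' ω h g hxy)) h1 r
    simp only [Finset.mul_sum]
    nlinarith [inv_pos.2 hk]
  have e := integral_pair_tilted_add
    (X := fun ω f g => ∑ h ∈ parityClass n 0, X ω h f g)
    (Y := fun ω f g => ∑ h ∈ parityClass n 1, X ω h f g) hA hB (hs 0) (hs 1) P (Measure.pi μ)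
  have hs' : ∀ ω f g, ∑ h, X ω h f g = (∑ h ∈ parityClass n 0, X ω h f g) +
      ∑ h ∈ parityClass n 1, X ω h f g := fun ω f g => sum_parity _
  simp only [hs']
  rw [e]
  exact (add_le_add (key 0) (key 1)).trans_eq (by ring)

end Product


/-! ### Matrix games -/

section Matrix

variable {A : Type v} {B : Type w} [Fintype A] [Fintype B] {p : A → ℝ} {M N : A → B → ℝ}
  {q : B → ℝ}

theorem sum_mul_eq_one (hp : p ∈ stdSimplex ℝ A) (hq : q ∈ stdSimplex ℝ B) :
    ∑ a, ∑ b, p a * q b = 1 := by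
  simp only [← Finset.mul_sum, hq.2, mul_one, hp.2]

theorem payoff_eq : payoff p M q = ∑ a, ∑ b, p a * q b * M a b := by
  unfold payoff
  exact Finset.sum_congr rfl fun a _ => Finset.sum_congr rfl fun b _ => by ring

theorem sum_mul_const (hp : p ∈ stdSimplex ℝ A) (hq : q ∈ stdSimplex ℝ B) (c : ℝ) :
    ∑ a, ∑ b, p a * q b * c = c := by
  simp only [← Finset.sum_mul, sum_mul_eq_one hp hq, one_mul]

theorem sum_mul_mono (hp : p ∈ stdSimplex ℝ A) (hq : q ∈ stdSimplex ℝ B)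
    (h : ∀ a b, M a b ≤ N a b) : ∑ a, ∑ b, p a * q b * M a b ≤ ∑ a, ∑ b, p a * q b * N a b :=
  Finset.sum_le_sum fun a _ => Finset.sum_le_sum fun b _ =>
    mul_le_mul_of_nonneg_left (h a b) (mul_nonneg (hp.1 a) (hq.1 b))

theorem payoff_le_add (hp : p ∈ stdSimplex ℝ A) (hq : q ∈ stdSimplex ℝ B) {c : ℝ}
    (h : ∀ a b, M a b ≤ N a b + c) : payoff p M q ≤ payoff p N q + c := by
  have := sum_mul_mono hp hq h
  simp only [mul_add, Finset.sum_add_distrib, sum_mul_const hp hq] at this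
  simpa only [payoff_eq] using this

theorem bddBelow_payoff (p : A → ℝ) (M : A → B → ℝ) :
    BddBelow (Set.range fun q : stdSimplex ℝ B => payoff p M q) := by
  refine ⟨-∑ a, ∑ b, |p a * M a b|, ?_⟩
  rintro _ ⟨q, rfl⟩
  simp only [payoff, ← Finset.sum_neg_distrib]
  refine Finset.sum_le_sum fun a _ => Finset.sum_le_sum fun b _ => ?_
  have h0 := q.2.1 b
  have h1 : q.1 b ≤ 1 := by
    rw [← q.2.2]
    exact Finset.single_le_sum (fun i _ => q.2.1 i) (Finset.mem_univ b)
  have h2 : -|p a * M a b| ≤ p a * M a b := neg_abs_le _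
  have h3 : -|p a * M a b| ≤ 0 := neg_nonpos.2 (abs_nonneg _)
  change _ ≤ p a * M a b * q.1 b
  nlinarith

theorem minAgainst_le (hq : q ∈ stdSimplex ℝ B) : minAgainst p M ≤ payoff p M q :=
  ciInf_le (bddBelow_payoff p M) (⟨q, hq⟩ : stdSimplex ℝ B)

theorem nonempty_stdSimplex [Nonempty B] : Nonempty (stdSimplex ℝ B) := by
  classical
  exact ⟨⟨_, single_mem_stdSimplex ℝ (Classical.arbitrary B)⟩⟩

theorem le_minAgainst [Nonempty B] {c : ℝ} (h : ∀ q ∈ stdSimplex ℝ B, c ≤ payoff p M q) :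
    c ≤ minAgainst p M :=
  have := nonempty_stdSimplex (B := B)
  le_ciInf fun q => h q q.2

variable [Nonempty B]

theorem minAgainst_le_add (hp : p ∈ stdSimplex ℝ A) {c : ℝ}
    (h : ∀ a b, M a b ≤ N a b + c) : minAgainst p M ≤ minAgainst p N + c := by
  rw [← sub_le_iff_le_add]
  refine le_minAgainst fun q hq => ?_
  have := (minAgainst_le hq).trans (payoff_le_add hp hq h)
  linarith

theorem minAgainst_mono (hp : p ∈ stdSimplex ℝ A) (h : ∀ a b, M a b ≤ N a b) :
    minAgainst p M ≤ minAgainst p N := by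
  simpa using minAgainst_le_add (c := 0) hp (by simpa using h)

theorem minAgainst_zero (p : A → ℝ) : minAgainst p (0 : A → B → ℝ) = 0 := by
  have := nonempty_stdSimplex (B := B)
  simp [minAgainst, payoff]

theorem minAgainst_mem_Icc (hp : p ∈ stdSimplex ℝ A) {c : ℝ}
    (h : ∀ a b, M a b ∈ Set.Icc 0 c) : minAgainst p M ∈ Set.Icc 0 c := by
  constructor
  · rw [← minAgainst_zero (B := B) p]
    exact minAgainst_mono hp fun a b => (h a b).1
  · have := minAgainst_le_add (M := M) (N := 0) (c := c) hp (by simpa using fun a b => (h a b).2)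
    rwa [minAgainst_zero, zero_add] at this

variable {X : Type u} [MeasurableSpace X] (σ : TieBreak X A B)

theorem minAgainst_eq (h : ℕ) (x : X) (p : A → ℝ) (M : A → B → ℝ) :
    minAgainst p M = payoff p M (σ.minSel h x p M) :=
  le_antisymm (minAgainst_le (σ.minSel_mem h x p M)) (le_minAgainst (σ.minSel_opt h x p M))

theorem isGreatest_minAgainst (h : ℕ) (x : X) (M : A → B → ℝ) :
    IsGreatest (Set.range fun p : stdSimplex ℝ A => minAgainst p M)
      (minAgainst (σ.maxSel h x M) M) := by
  refine ⟨⟨⟨_, σ.maxSel_mem h x M⟩, rfl⟩, ?_⟩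
  rintro _ ⟨p, rfl⟩
  exact σ.maxSel_opt h x M p p.2

theorem maxMin_eq (h : ℕ) (x : X) (M : A → B → ℝ) :
    maxMin M = minAgainst (σ.maxSel h x M) M :=
  (isGreatest_minAgainst σ h x M).csSup_eq

end Matrix

/-! ### Measurability and bounds for the functions induced by the class -/

section Class

variable {X : Type u} {A : Type v} {B : Type w} [MeasurableSpace X] {H : ℕ}

theorem FunctionClass.measurable_eval_joint (F : FunctionClass.{u, v, w, z} X A B H) (h : ℕ) :
    Measurable fun p : F.Elem × X => F.eval p.1 h p.2 := by
  unfold FunctionClass.eval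
  by_cases hh : h < H
  · simp only [hh, dif_pos]
    refine measurable_pi_lambda _ fun a => measurable_pi_lambda _ fun b => ?_
    exact (F.measurable_val ⟨h, hh⟩ a b).comp
      (((measurable_pi_apply _).comp measurable_fst).prodMk measurable_snd)
  · simp only [hh, dif_neg, not_false_eq_true]
    exact measurable_const

theorem FunctionClass.eval_of_lt (F : FunctionClass.{u, v, w, z} X A B H) (f : F.Elem) {h : ℕ}
    (hh : h < H) (x : X) : F.eval f h x = F.val ⟨h, hh⟩ (f ⟨h, hh⟩) x := by
  simp [FunctionClass.eval, hh]

theorem FunctionClass.eval_fin (F : FunctionClass.{u, v, w, z} X A B H) (f : F.Elem) (h : Fin H)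
    (x : X) : F.eval f h x = F.val h (f h) x := F.eval_of_lt f h.2 x

theorem FunctionClass.eval_of_le (F : FunctionClass.{u, v, w, z} X A B H) (f : F.Elem) {h : ℕ}
    (hh : H ≤ h) (x : X) : F.eval f h x = 0 := by
  simp [FunctionClass.eval, hh.not_gt]

theorem FunctionClass.eval_congr (F : FunctionClass.{u, v, w, z} X A B H) {f f' : F.Elem} {h : ℕ}
    (hf : ∀ hh : h < H, f ⟨h, hh⟩ = f' ⟨h, hh⟩) (x : X) : F.eval f h x = F.eval f' h x := by
  unfold FunctionClass.eval
  split_ifs with hh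
  · rw [hf hh]
  · rfl

theorem BoundedBy.eval_mem {F : FunctionClass.{u, v, w, z} X A B H} {β : ℝ} (hF : BoundedBy F β)
    (hβ : 1 ≤ β) (f : F.Elem) (h : ℕ) (x : X) (a : A) (b : B) :
    F.eval f h x a b ∈ Set.Icc 0 (β - 1) := by
  unfold FunctionClass.eval
  split_ifs with hh
  · exact hF _ _ x a b
  · exact ⟨le_rfl, sub_nonneg.2 hβ⟩

variable [Fintype A] [Fintype B] (σ : TieBreak X A B)
  (F : FunctionClass.{u, v, w, z} X A B H)

theorem measurable_mainPolicy (h : ℕ) :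
    Measurable fun p : F.Elem × X => (mainPolicy σ F p.1).prob h p.2 :=
  (σ.measurable_maxSel h).comp (measurable_snd.prodMk (F.measurable_eval_joint h))

theorem measurable_boosterPolicy (h : ℕ) :
    Measurable fun p : F.Elem × F.Elem × X => (boosterPolicy σ F p.1 p.2.1).prob h p.2.2 :=
  (σ.measurable_minSel h).comp (measurable_snd.snd.prodMk
    (((measurable_mainPolicy σ F h).comp (measurable_fst.prodMk measurable_snd.snd)).prodMk
      ((F.measurable_eval_joint h).comp measurable_snd)))

/-- `V^{μ_f}_{g,h}(x)`. -/
def pairValue (f g : F.Elem) (h : ℕ) (x : X) : ℝ :=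
  minAgainst ((mainPolicy σ F f).prob h x) (F.eval g h x)

theorem pairValue_congr {f f' g g' : F.Elem} {h : ℕ}
    (hf : ∀ hh : h < H, f ⟨h, hh⟩ = f' ⟨h, hh⟩) (hg : ∀ hh : h < H, g ⟨h, hh⟩ = g' ⟨h, hh⟩)
    (x : X) : pairValue σ F f g h x = pairValue σ F f' g' h x := by
  unfold pairValue
  rw [F.eval_congr hg x]
  simp only [mainPolicy, F.eval_congr hf x]

variable [Nonempty B]

theorem measurable_pairValue (h : ℕ) :
    Measurable fun p : F.Elem × F.Elem × X => pairValue σ F p.1 p.2.1 h p.2.2 := by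
  have e : ∀ p : F.Elem × F.Elem × X, pairValue σ F p.1 p.2.1 h p.2.2 =
      ∑ a, ∑ b, (mainPolicy σ F p.1).prob h p.2.2 a * F.eval p.2.1 h p.2.2 a b *
        (boosterPolicy σ F p.1 p.2.1).prob h p.2.2 b := fun p =>
    minAgainst_eq σ h p.2.2 _ _
  simp only [e]
  have h1 := (measurable_mainPolicy σ F h).comp
    ((measurable_fst.prodMk measurable_snd.snd) : Measurable fun p : F.Elem × F.Elem × X => _)
  have h2 := (F.measurable_eval_joint h).comp
    (measurable_snd : Measurable fun p : F.Elem × F.Elem × X => p.2)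
  have h3 := measurable_boosterPolicy σ F h
  refine Finset.measurable_fun_sum _ fun a _ => Finset.measurable_fun_sum _ fun b _ => ?_
  exact (((measurable_pi_apply a).comp h1).mul
    ((measurable_pi_apply b).comp ((measurable_pi_apply a).comp h2))).mul
    ((measurable_pi_apply b).comp h3)

/-- This makes the main agent's quantities the diagonal case `g = f` of the booster's, so both
posteriors share one calculus. -/
theorem pairValue_eq_maxMin (f : F.Elem) (h : ℕ) (x : X) :
    maxMin (F.eval f h x) = pairValue σ F f f h x := maxMin_eq σ h x _

theorem pairValue_le_self (f f' : F.Elem) (h : ℕ) (x : X) :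
    minAgainst ((mainPolicy σ F f').prob h x) (F.eval f h x) ≤ pairValue σ F f f h x :=
  σ.maxSel_opt h x _ _ ((mainPolicy σ F f').prob_mem h x)

variable {F} in
theorem pairValue_mem {β : ℝ} (hF : BoundedBy F β) (hβ : 1 ≤ β) (f g : F.Elem) (h : ℕ) (x : X) :
    pairValue σ F f g h x ∈ Set.Icc 0 (β - 1) :=
  minAgainst_mem_Icc ((mainPolicy σ F f).prob_mem h x) fun a b => hF.eval_mem hβ g h x a b

theorem pairValue_of_le (f g : F.Elem) {h : ℕ} (hh : H ≤ h) (x : X) :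
    pairValue σ F f g h x = 0 := by
  rw [pairValue, F.eval_of_le g hh, minAgainst_zero]

end Class

/-! ### Bellman backups and residuals: bounds and joint measurability. -/

section Residual

variable {X : Type u} {A : Type v} {B : Type w} [MeasurableSpace X]
  [Fintype A] [MeasurableSpace A] [DiscreteMeasurableSpace A]
  [Fintype B] [MeasurableSpace B] [DiscreteMeasurableSpace B]

theorem measurable_uncurry_actions {Ω : Type*} [MeasurableSpace Ω] {φ : Ω → A → B → ℝ}
    (h : ∀ a b, Measurable fun ω => φ ω a b) :
    Measurable fun p : Ω × A × B => φ p.1 p.2.1 p.2.2 :=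
  measurable_from_prod_countable_left fun y => h y.1 y.2

variable (G : MarkovGame X A B) (σ : TieBreak X A B) (F : FunctionClass.{u, v, w, z} X A B G.H)

instance (h : ℕ) : IsMarkovKernel (G.P h) := G.markov h

/-- The Bellman backup `T_h^{μ_f} g`. -/
abbrev backup (f g : F.Elem) (h : ℕ) (x : X) (a : A) (b : B) : ℝ :=
  bellman G F (mainPolicy σ F f) g h x a b

theorem backup_eq (f g : F.Elem) (h : ℕ) (x : X) (a : A) (b : B) :
    backup G σ F f g h x a b =
      G.r h x a b + ∫ x', pairValue σ F f g (h + 1) x' ∂(G.P h (x, a, b)) := rfl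

/-- The difference `θ^h - T_h^{μ_f} g`. -/
def excess (θ f g : F.Elem) (h : ℕ) (x : X) (a : A) (b : B) : ℝ :=
  F.eval θ h x a b - backup G σ F f g h x a b

variable {G F} [Nonempty B] {β : ℝ} (hF : BoundedBy F β) (hβ : 1 ≤ β)
include hF hβ

theorem bddMeas_pairValue (h : ℕ) :
    BddMeas fun p : F.Elem × F.Elem × X => pairValue σ F p.1 p.2.1 h p.2.2 :=
  .of_mem_Icc (measurable_pairValue σ F h) fun p => pairValue_mem σ hF hβ _ _ h _

theorem integral_pairValue_mem (f g : F.Elem) (h : ℕ) (P : Measure X) [IsProbabilityMeasure P] :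
    ∫ x, pairValue σ F f g h x ∂P ∈ Set.Icc 0 (β - 1) := by
  have hi := ((bddMeas_pairValue σ hF hβ h).comp (φ := fun x => (f, g, x))
    (by fun_prop)).integrable P
  constructor
  · exact integral_nonneg fun x => (pairValue_mem σ hF hβ f g h x).1
  · have := integral_mono hi (integrable_const (β - 1))
      fun x => (pairValue_mem σ hF hβ f g h x).2
    simpa using this

theorem backup_mem (f g : F.Elem) (h : ℕ) (x : X) (a : A) (b : B) :
    backup G σ F f g h x a b ∈ Set.Icc 0 β := by
  rw [backup_eq]
  have h1 := G.r_mem h x a b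
  have h2 := integral_pairValue_mem σ hF hβ f g (h + 1) (G.P h (x, a, b))
  exact ⟨add_nonneg h1.1 h2.1, by linarith [h1.2, h2.2]⟩

theorem bddMeas_backup (h : ℕ) : BddMeas fun p : (F.Elem × F.Elem × X) × A × B =>
    backup G σ F p.1.1 p.1.2.1 h p.1.2.2 p.2.1 p.2.2 := by
  refine .of_mem_Icc (measurable_uncurry_actions
    (φ := fun (q : F.Elem × F.Elem × X) a b => backup G σ F q.1 q.2.1 h q.2.2 a b)
    fun a b => ?_) fun p => backup_mem σ hF hβ _ _ h _ _ _
  simp only [backup_eq]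
  refine ((G.measurable_r h a b).comp measurable_snd.snd).add ?_
  have hm : Measurable fun q : F.Elem × F.Elem × X => (q.2.2, a, b) := by fun_prop
  exact (BddMeas.integral_kernel
    (f := fun (q : F.Elem × F.Elem × X) x' => pairValue σ F q.1 q.2.1 (h + 1) x')
    ((bddMeas_pairValue σ hF hβ (h + 1)).comp
      (φ := fun p : (F.Elem × F.Elem × X) × X => (p.1.1, p.1.2.1, p.2)) (by fun_prop))
    ((G.P h).comap _ hm)).1

theorem abs_excess_le (θ f g : F.Elem) (h : ℕ) (x : X) (a : A) (b : B) :
    |excess G σ F θ f g h x a b| ≤ β := by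
  have h1 := hF.eval_mem hβ θ h x a b
  have h2 := backup_mem σ hF hβ f g h x a b
  rw [excess, abs_le]
  constructor <;> linarith [h1.1, h1.2, h2.1, h2.2]

theorem bddMeas_excess (h : ℕ) : BddMeas fun p : (F.Elem × F.Elem × F.Elem) × X × A × B =>
    excess G σ F p.1.1 p.1.2.1 p.1.2.2 h p.2.1 p.2.2.1 p.2.2.2 := by
  refine ⟨Measurable.sub ?_ ?_, β, fun p => abs_excess_le σ hF hβ _ _ _ h _ _ _⟩
  · have := measurable_uncurry_actions (φ := fun (q : F.Elem × X) a b => F.eval q.1 h q.2 a b)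
      fun a b => (measurable_pi_apply b).comp
        ((measurable_pi_apply a).comp (F.measurable_eval_joint h))
    exact this.comp (by fun_prop : Measurable
      fun p : (F.Elem × F.Elem × F.Elem) × X × A × B => ((p.1.1, p.2.1), p.2.2))
  · exact ((bddMeas_backup σ hF hβ h).comp
      (φ := fun p : (F.Elem × F.Elem × F.Elem) × X × A × B =>
        ((p.1.2.1, p.1.2.2, p.2.1), p.2.2)) (by fun_prop)).1

end Residual


/-! ### The law of the play -/

theorem BddMeas.integral_bind {α β : Type*} [MeasurableSpace α] [MeasurableSpace β]
    {f : β → ℝ} (hf : BddMeas f) (m : Measure α) [IsProbabilityMeasure m] {κ : α → Measure β}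
    (hκ : Measurable κ) (hp : ∀ a, IsProbabilityMeasure (κ a)) :
    ∫ b, f b ∂(m.bind κ) = ∫ a, ∫ b, f b ∂(κ a) ∂m := by
  let K : Kernel α β := ⟨κ, hκ⟩
  have : IsMarkovKernel K := ⟨hp⟩
  have e : m.bind κ = (K ∘ₖ Kernel.const Unit m) () := Measure.comp_eq_comp_const_apply (κ := K)
  rw [e, Kernel.integral_comp (hf.integrable _)]
  rfl

theorem isProbabilityMeasure_bind' {α β : Type*} [MeasurableSpace α] [MeasurableSpace β]
    (m : Measure α) [IsProbabilityMeasure m] {κ : α → Measure β} (hκ : Measurable κ)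
    (hp : ∀ a, IsProbabilityMeasure (κ a)) : IsProbabilityMeasure (m.bind κ) := by
  constructor
  rw [Measure.bind_apply MeasurableSet.univ hκ.aemeasurable]
  simp

section Rollout

variable {X : Type u} {A : Type v} {B : Type w} [MeasurableSpace X]
  [Fintype A] [MeasurableSpace A] [DiscreteMeasurableSpace A]
  [Fintype B] [MeasurableSpace B] [DiscreteMeasurableSpace B]

theorem measurable_cons (n : ℕ) :
    Measurable fun p : (X × A × B × X) × Trajectory X A B n =>
      (Fin.cons (α := fun _ => X × A × B × X) p.1 p.2 : Trajectory X A B (n + 1)) := by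
  refine measurable_pi_lambda _ fun i => ?_
  refine Fin.cases ?_ (fun i => ?_) i
  · simpa using measurable_fst
  · simp only [Fin.cons_succ]
    exact (measurable_pi_apply i).comp measurable_snd

variable (G : MarkovGame X A B)

/-- Measurability and total mass are proved in one induction because the step needs the shorter
rollout as a Markov kernel. The parameter space `Λ` is later the space of drawn pairs, or a point
for fixed policies. -/
theorem measurable_rollout_and_prob {Λ : Type*} [MeasurableSpace Λ] {μ : Λ → MarkovPolicy X A}
    {ν : Λ → MarkovPolicy X B} (hμ : ∀ h a, Measurable fun p : Λ × X => (μ p.1).prob h p.2 a)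
    (hν : ∀ h b, Measurable fun p : Λ × X => (ν p.1).prob h p.2 b) (n h : ℕ) :
    (Measurable fun p : Λ × X => rollout G (μ p.1) (ν p.1) n h p.2) ∧
      ∀ p : Λ × X, IsProbabilityMeasure (rollout G (μ p.1) (ν p.1) n h p.2) := by
  induction n generalizing h with
  | zero =>
    exact ⟨measurable_const, fun p => by unfold rollout; infer_instance⟩
  | succ n ih =>
    obtain ⟨ihm, ihp⟩ := ih (h + 1)
    let K : Kernel (Λ × X) (Trajectory X A B n) :=
      ⟨fun p => rollout G (μ p.1) (ν p.1) n (h + 1) p.2, ihm⟩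
    have hK : IsMarkovKernel K := ⟨ihp⟩
    have hcons : ∀ (z : X × A × B × X), Measurable fun ζ : Trajectory X A B n =>
        (Fin.cons (α := fun _ => X × A × B × X) z ζ : Trajectory X A B (n + 1)) := fun z =>
      (measurable_cons n).comp measurable_prodMk_left
    have hmap : ∀ (l : Λ) (x : X) (a : A) (b : B), Measurable fun x' =>
        (rollout G (μ l) (ν l) n (h + 1) x').map fun ζ =>
          (Fin.cons (α := fun _ => X × A × B × X) (x, a, b, x') ζ : Trajectory X A B (n + 1)) := by
      intro l x a b
      refine Measure.measurable_of_measurable_coe _ fun s hs => ?_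
      have e : ∀ x', ((rollout G (μ l) (ν l) n (h + 1) x').map fun ζ =>
          (Fin.cons (α := fun _ => X × A × B × X) (x, a, b, x') ζ : Trajectory X A B (n + 1))) s =
          K.comap (fun x' : X => (l, x')) (by fun_prop) x' (Prod.mk x' ⁻¹'
            {q : X × Trajectory X A B n | (Fin.cons (α := fun _ => X × A × B × X)
              (x, a, b, q.1) q.2 : Trajectory X A B (n + 1)) ∈ s}) := fun x' => by
        rw [Measure.map_apply (hcons _) hs]
        rfl
      simp only [e]
      refine Kernel.measurable_kernel_prodMk_left ?_
      exact ((measurable_cons n).comp (by fun_prop : Measurable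
        fun q : X × Trajectory X A B n => (((x, a, b, q.1) : X × A × B × X), q.2))) hs
    have hmapp : ∀ (l : Λ) (x : X) (a : A) (b : B) x', IsProbabilityMeasure
        ((rollout G (μ l) (ν l) n (h + 1) x').map fun ζ =>
          (Fin.cons (α := fun _ => X × A × B × X) (x, a, b, x') ζ :
            Trajectory X A B (n + 1))) := fun l x a b x' =>
      have := ihp (l, x')
      Measure.isProbabilityMeasure_map (hcons _).aemeasurable
    constructor
    · refine Measure.measurable_of_measurable_coe _ fun s hs => ?_
      have e : ∀ p : Λ × X, rollout G (μ p.1) (ν p.1) (n + 1) h p.2 s =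
          ∑ a, ∑ b, ENNReal.ofReal ((μ p.1).prob h p.2 a * (ν p.1).prob h p.2 b) *
            ∫⁻ x', K.comap (fun q : (Λ × X) × X => (q.1.1, q.2)) (by fun_prop) (p, x')
              (Prod.mk (p, x') ⁻¹' {q : ((Λ × X) × X) × Trajectory X A B n |
                (Fin.cons (α := fun _ => X × A × B × X) (q.1.1.2, a, b, q.1.2) q.2 :
                  Trajectory X A B (n + 1)) ∈ s}) ∂((G.P h).comap
                    (fun p : Λ × X => (p.2, a, b)) (by fun_prop) p) := fun p => by
        simp only [rollout, Measure.finsetSum_apply, Measure.smul_apply, smul_eq_mul]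
        refine Finset.sum_congr rfl fun a _ => Finset.sum_congr rfl fun b _ => ?_
        rw [Measure.bind_apply hs (hmap p.1 p.2 a b).aemeasurable]
        congr 1
        refine lintegral_congr fun x' => ?_
        rw [Measure.map_apply (hcons _) hs]
        rfl
      simp only [e]
      refine Finset.measurable_fun_sum _ fun a _ => Finset.measurable_fun_sum _ fun b _ => ?_
      refine ((hμ h a).mul (hν h b)).ennreal_ofReal.mul ?_
      refine Measurable.lintegral_kernel_prod_right' (f := fun q : (Λ × X) × X =>
        K.comap (fun q : (Λ × X) × X => (q.1.1, q.2)) (by fun_prop) q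
              (Prod.mk q ⁻¹' {q : ((Λ × X) × X) × Trajectory X A B n |
                (Fin.cons (α := fun _ => X × A × B × X) (q.1.1.2, a, b, q.1.2) q.2 :
                  Trajectory X A B (n + 1)) ∈ s})) ?_
      refine Kernel.measurable_kernel_prodMk_left ?_
      exact ((measurable_cons n).comp (by fun_prop : Measurable
        fun q : ((Λ × X) × X) × Trajectory X A B n =>
          (((q.1.1.2, a, b, q.1.2) : X × A × B × X), q.2))) hs
    · intro p
      constructor
      simp only [rollout, Measure.finsetSum_apply, Measure.smul_apply, smul_eq_mul]
      have : ∀ a b, ((G.P h (p.2, a, b)).bind fun x' =>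
          (rollout G (μ p.1) (ν p.1) n (h + 1) x').map fun ζ =>
          (Fin.cons (α := fun _ => X × A × B × X) (p.2, a, b, x') ζ :
            Trajectory X A B (n + 1))) Set.univ = 1 := fun a b =>
        have := isProbabilityMeasure_bind' (G.P h (p.2, a, b)) (hmap p.1 p.2 a b)
          (hmapp p.1 p.2 a b)
        measure_univ
      simp only [this, mul_one]
      have hμ0 := ((μ p.1).prob_mem h p.2)
      have hν0 := ((ν p.1).prob_mem h p.2)
      have hs := sum_mul_eq_one hμ0 hν0
      have h0 : ∀ a b, 0 ≤ (μ p.1).prob h p.2 a * (ν p.1).prob h p.2 b := fun a b =>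
        mul_nonneg (hμ0.1 a) (hν0.1 b)
      rw [← ENNReal.ofReal_one, ← hs, ENNReal.ofReal_sum_of_nonneg
        fun a _ => Finset.sum_nonneg fun b _ => h0 a b]
      exact Finset.sum_congr rfl fun a _ =>
        (ENNReal.ofReal_sum_of_nonneg fun b _ => h0 a b).symm

variable (μ : MarkovPolicy X A) (ν : MarkovPolicy X B)

theorem measurable_rollout (n h : ℕ) : Measurable (rollout G μ ν n h) := by
  have := (measurable_rollout_and_prob G (Λ := Unit) (μ := fun _ => μ) (ν := fun _ => ν)
    (fun h a => (μ.measurable_prob h a).comp measurable_snd)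
    (fun h b => (ν.measurable_prob h b).comp measurable_snd) n h).1
  exact this.comp (by fun_prop : Measurable fun x : X => ((), x))

instance isProbabilityMeasure_rollout (n h : ℕ) (x : X) :
    IsProbabilityMeasure (rollout G μ ν n h x) :=
  (measurable_rollout_and_prob G (Λ := Unit) (μ := fun _ => μ) (ν := fun _ => ν)
    (fun h a => (μ.measurable_prob h a).comp measurable_snd)
    (fun h b => (ν.measurable_prob h b).comp measurable_snd) n h).2 ((), x)

instance : IsProbabilityMeasure (episodeLaw G μ ν) := isProbabilityMeasure_rollout G μ ν _ _ _

theorem bddMeas_integral_rollout {Ω : Type*} [MeasurableSpace Ω] {n : ℕ} (h : ℕ)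
    {Φ : Ω → Trajectory X A B n → ℝ} (hΦ : BddMeas fun p : Ω × Trajectory X A B n => Φ p.1 p.2) :
    BddMeas fun p : Ω × X => ∫ ζ, Φ p.1 ζ ∂(rollout G μ ν n h p.2) := by
  let K : Kernel X (Trajectory X A B n) := ⟨rollout G μ ν n h, measurable_rollout G μ ν n h⟩
  have : IsMarkovKernel K := ⟨fun x => isProbabilityMeasure_rollout G μ ν n h x⟩
  exact BddMeas.integral_kernel (f := fun (p : Ω × X) ζ => Φ p.1 ζ)
    (hΦ.comp (φ := fun p : (Ω × X) × Trajectory X A B n => (p.1.1, p.2)) (by fun_prop))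
    (K.comap Prod.snd measurable_snd)

theorem integral_rollout_succ {n : ℕ} (h : ℕ) (x : X) {Φ : Trajectory X A B (n + 1) → ℝ}
    (hΦ : BddMeas Φ) :
    ∫ ζ, Φ ζ ∂(rollout G μ ν (n + 1) h x) =
      ∑ a, ∑ b, μ.prob h x a * ν.prob h x b * ∫ x', ∫ ζ,
        Φ (Fin.cons (α := fun _ => X × A × B × X) (x, a, b, x') ζ)
          ∂(rollout G μ ν n (h + 1) x') ∂(G.P h (x, a, b)) := by
  have hcons : ∀ z : X × A × B × X, Measurable fun ζ : Trajectory X A B n =>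
      (Fin.cons (α := fun _ => X × A × B × X) z ζ : Trajectory X A B (n + 1)) := fun z =>
    (measurable_cons n).comp measurable_prodMk_left
  have hm : ∀ a b, Measurable fun x' => (rollout G μ ν n (h + 1) x').map fun ζ =>
      (Fin.cons (α := fun _ => X × A × B × X) (x, a, b, x') ζ : Trajectory X A B (n + 1)) := by
    intro a b
    let K : Kernel X (Trajectory X A B n) :=
      ⟨rollout G μ ν n (h + 1), measurable_rollout G μ ν n (h + 1)⟩
    have : IsMarkovKernel K := ⟨fun x => isProbabilityMeasure_rollout G μ ν n (h + 1) x⟩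
    refine Measure.measurable_of_measurable_coe _ fun s hs => ?_
    have e : ∀ x', ((rollout G μ ν n (h + 1) x').map fun ζ =>
        (Fin.cons (α := fun _ => X × A × B × X) (x, a, b, x') ζ : Trajectory X A B (n + 1))) s =
        K x' (Prod.mk x' ⁻¹' {q : X × Trajectory X A B n |
          (Fin.cons (α := fun _ => X × A × B × X)
            (x, a, b, q.1) q.2 : Trajectory X A B (n + 1)) ∈ s}) := fun x' => by
      rw [Measure.map_apply (hcons _) hs]
      rfl
    simp only [e]
    refine Kernel.measurable_kernel_prodMk_left ?_
    exact ((measurable_cons n).comp (by fun_prop : Measurable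
      fun q : X × Trajectory X A B n => (((x, a, b, q.1) : X × A × B × X), q.2))) hs
  have hp : ∀ a b x', IsProbabilityMeasure ((rollout G μ ν n (h + 1) x').map fun ζ =>
      (Fin.cons (α := fun _ => X × A × B × X) (x, a, b, x') ζ : Trajectory X A B (n + 1))) :=
    fun a b x' => Measure.isProbabilityMeasure_map (hcons _).aemeasurable
  have hbp := fun a b => isProbabilityMeasure_bind' (G.P h (x, a, b)) (hm a b) (hp a b)
  simp only [rollout]
  rw [integral_finsetSum_measure]
  · refine Finset.sum_congr rfl fun a _ => ?_
    rw [integral_finsetSum_measure]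
    · refine Finset.sum_congr rfl fun b _ => ?_
      rw [integral_smul_measure, ENNReal.toReal_ofReal
        (mul_nonneg ((μ.prob_mem h x).1 a) ((ν.prob_mem h x).1 b)), smul_eq_mul,
        hΦ.integral_bind _ (hm a b) (hp a b)]
      congr 1
      refine integral_congr_ae (Filter.Eventually.of_forall fun x' => ?_)
      exact integral_map (hcons _).aemeasurable hΦ.1.aestronglyMeasurable
    · exact fun b _ => ((hΦ.integrable _).smul_measure ENNReal.ofReal_ne_top)
  · exact fun a _ => integrable_finsetSum_measure.2 fun b _ =>
      ((hΦ.integrable _).smul_measure ENNReal.ofReal_ne_top)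

/-- The expectation of a sum of functions of the records of the next `n` steps. -/
def expectSum (φ : ℕ → X × A × B × X → ℝ) (n h : ℕ) (x : X) : ℝ :=
  ∫ ζ, ∑ i : Fin n, φ (h + i) (ζ i) ∂(rollout G μ ν n h x)

variable {φ ψ : ℕ → X × A × B × X → ℝ} (hφ : ∀ h, BddMeas (φ h)) (hψ : ∀ h, BddMeas (ψ h))

section
include hφ

theorem bddMeas_sum_records (n h : ℕ) :
    BddMeas fun ζ : Trajectory X A B n => ∑ i : Fin n, φ (h + i) (ζ i) :=
  BddMeas.sum fun i _ => (hφ _).comp (measurable_pi_apply i)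

theorem bddMeas_expectSum (n h : ℕ) : BddMeas (expectSum G μ ν φ n h) := by
  have := bddMeas_integral_rollout G μ ν (Ω := Unit) h (n := n)
    (Φ := fun _ ζ => ∑ i : Fin n, φ (h + i) (ζ i))
    ((bddMeas_sum_records hφ n h).comp measurable_snd)
  exact this.comp (φ := fun x => ((), x)) (by fun_prop)

theorem expectSum_succ (n h : ℕ) (x : X) :
    expectSum G μ ν φ (n + 1) h x = ∑ a, ∑ b, μ.prob h x a * ν.prob h x b *
      (∫ x', φ h (x, a, b, x') ∂(G.P h (x, a, b)) +
        ∫ x', expectSum G μ ν φ n (h + 1) x' ∂(G.P h (x, a, b))) := by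
  rw [expectSum, integral_rollout_succ G μ ν h x (bddMeas_sum_records hφ (n + 1) h)]
  refine Finset.sum_congr rfl fun a _ => Finset.sum_congr rfl fun b _ => ?_
  congr 1
  rw [← integral_add (((hφ h).comp (φ := fun x' => (x, a, b, x')) (by fun_prop)).integrable _)
    ((bddMeas_expectSum G μ ν hφ n (h + 1)).integrable _)]
  refine integral_congr_ae (Filter.Eventually.of_forall fun x' => ?_)
  have e : ∀ ζ : Trajectory X A B n, ∑ i : Fin (n + 1),
      φ (h + i) (Fin.cons (α := fun _ => X × A × B × X) (x, a, b, x') ζ i) =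
      φ h (x, a, b, x') + ∑ i : Fin n, φ (h + 1 + i) (ζ i) := fun ζ => by
    rw [Fin.sum_univ_succ]
    simp only [Fin.val_zero, add_zero, Fin.cons_zero, Fin.val_succ, Fin.cons_succ]
    simp only [add_assoc, add_comm 1]
  simp only [e]
  rw [integral_add (integrable_const _) ((bddMeas_sum_records hφ n (h + 1)).integrable _)]
  simp [expectSum]

include hψ in
theorem expectSum_add (n h : ℕ) (x : X) :
    expectSum G μ ν (fun k z => φ k z + ψ k z) n h x =
      expectSum G μ ν φ n h x + expectSum G μ ν ψ n h x := by
  unfold expectSum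
  rw [← integral_add ((bddMeas_sum_records hφ n h).integrable _)
    ((bddMeas_sum_records hψ n h).integrable _)]
  simp only [Finset.sum_add_distrib]

include hψ in
-- Only the conditional mean given state and actions matters, so the next state may be integrated
-- out.
theorem expectSum_congr (h : ∀ k x a b, ∫ x', φ k (x, a, b, x') ∂(G.P k (x, a, b)) =
    ∫ x', ψ k (x, a, b, x') ∂(G.P k (x, a, b))) (n k : ℕ) (x : X) :
    expectSum G μ ν φ n k x = expectSum G μ ν ψ n k x := by
  induction n generalizing k x with
  | zero => simp [expectSum]
  | succ n ih => simp only [expectSum_succ G μ ν hφ, expectSum_succ G μ ν hψ, h, ih]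

/-- Peel off the first record: the bound on the rest is uniform in the state reached, and the bound
on the first factor is uniform in the actions, so the policies play no role. -/
theorem integral_exp_sum_records_le {C : ℝ} (hC : 0 ≤ C)
    {N : ℕ} (h : ∀ k < N, ∀ x a b, ∫ x', Real.exp (φ k (x, a, b, x')) ∂(G.P k (x, a, b)) ≤ C)
    {n k : ℕ} (hk : k + n ≤ N) (x : X) :
    ∫ ζ, Real.exp (∑ i : Fin n, φ (k + i) (ζ i)) ∂(rollout G μ ν n k x) ≤ C ^ n := by
  induction n generalizing k x with
  | zero => simp
  | succ n ih =>
    rw [integral_rollout_succ G μ ν k x (bddMeas_sum_records hφ (n + 1) k).exp,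
      ← sum_mul_const (μ.prob_mem k x) (ν.prob_mem k x) (C ^ (n + 1))]
    refine sum_mul_mono (μ.prob_mem k x) (ν.prob_mem k x) fun a b => ?_
    have e : ∀ x' (ζ : Trajectory X A B n), Real.exp (∑ i : Fin (n + 1),
        φ (k + i) (Fin.cons (α := fun _ => X × A × B × X) (x, a, b, x') ζ i)) =
        Real.exp (φ k (x, a, b, x')) * Real.exp (∑ i : Fin n, φ (k + 1 + i) (ζ i)) :=
      fun x' ζ => by
      rw [← Real.exp_add, Fin.sum_univ_succ]
      simp only [Fin.val_zero, add_zero, Fin.cons_zero, Fin.val_succ, Fin.cons_succ]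
      simp only [add_assoc, add_comm 1]
    simp only [e, integral_const_mul]
    have hb : BddMeas fun x' : X => ∫ ζ, Real.exp (∑ i : Fin n, φ (k + 1 + i) (ζ i))
        ∂(rollout G μ ν n (k + 1) x') :=
      (bddMeas_integral_rollout G μ ν (Ω := Unit) (k + 1) (n := n)
        (Φ := fun _ ζ => Real.exp (∑ i : Fin n, φ (k + 1 + i) (ζ i)))
        ((bddMeas_sum_records hφ n (k + 1)).exp.comp measurable_snd)).comp
        (φ := fun x => ((), x)) (by fun_prop)
    have hb' : BddMeas fun x' : X => Real.exp (φ k (x, a, b, x')) :=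
      ((hφ k).comp (φ := fun x' => (x, a, b, x')) (by fun_prop)).exp
    calc ∫ x', Real.exp (φ k (x, a, b, x')) * ∫ ζ, Real.exp (∑ i : Fin n, φ (k + 1 + i) (ζ i))
          ∂(rollout G μ ν n (k + 1) x') ∂(G.P k (x, a, b))
        ≤ ∫ x', Real.exp (φ k (x, a, b, x')) * C ^ n ∂(G.P k (x, a, b)) :=
          integral_mono ((hb'.mul hb).integrable _) ((hb'.mul (.const _)).integrable _)
            fun x' => mul_le_mul_of_nonneg_left (ih (by omega) x') (Real.exp_pos _).le
      _ ≤ C ^ (n + 1) := by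
          rw [integral_mul_const, pow_succ, mul_comm]
          exact mul_le_mul_of_nonneg_left (h k (by omega) x a b) (pow_nonneg hC n)

end

theorem integral_episodeLaw_record (i : Fin G.H) {Φ : X × A × B × X → ℝ} (hΦ : BddMeas Φ) :
    ∫ ζ, Φ (ζ i) ∂(episodeLaw G μ ν) = stepExpect G μ ν i
      (fun x a b => ∫ x', Φ (x, a, b, x') ∂(G.P i (x, a, b))) := by
  obtain ⟨Ψ, hΨe⟩ : ∃ Ψ : X × A × B × X → ℝ, Ψ = fun z =>
      ∫ x', Φ (z.1, z.2.1, z.2.2.1, x') ∂(G.P i (z.1, z.2.1, z.2.2.1)) := ⟨_, rfl⟩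
  have hΨ : BddMeas Ψ := hΨe ▸
    BddMeas.integral_kernel (f := fun (z : X × A × B × X) x' => Φ (z.1, z.2.1, z.2.2.1, x'))
      (hΦ.comp (φ := fun p : (X × A × B × X) × X => (p.1.1, p.1.2.1, p.1.2.2.1, p.2))
        (by fun_prop))
      ((G.P i).comap (fun z : X × A × B × X => (z.1, z.2.1, z.2.2.1)) (by fun_prop))
  -- A function of the single record `i` is written as a sum over all steps with an indicator, to
  -- which `expectSum_congr` applies.
  have hsingle : ∀ (Ψ : X × A × B × X → ℝ) (ζ : Trajectory X A B G.H),
      ∑ j : Fin G.H, (if 0 + j.1 = i.1 then Ψ (ζ j) else 0) = Ψ (ζ i) := fun Ψ ζ => by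
    rw [Finset.sum_eq_single i]
    · simp
    · intro j _ hj
      rw [if_neg]
      rw [zero_add]
      exact Fin.val_ne_of_ne hj
    · simp
  have hite : ∀ {Ψ : X × A × B × X → ℝ}, BddMeas Ψ →
      ∀ k : ℕ, BddMeas fun z => if k = i.1 then Ψ z else 0 := by
    intro Ψ h k
    split_ifs
    · exact h
    · exact .const 0
  have := expectSum_congr G μ ν (hite hΦ) (hite hΨ) (fun k x a b => by
    split_ifs with hk
    · subst hk
      simp [hΨe]
    · simp) G.H 0 G.x₁
  unfold expectSum at this
  simp only [hsingle] at this
  rw [hΨe] at this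
  exact this

theorem expectSum_eq_sum_stepExpect {φ : ℕ → X → A → B → ℝ}
    (hφ : ∀ h, BddMeas fun z : X × A × B × X => φ h z.1 z.2.1 z.2.2.1) :
    expectSum G μ ν (fun h z => φ h z.1 z.2.1 z.2.2.1) G.H 0 G.x₁ =
      ∑ h : Fin G.H, stepExpect G μ ν h (φ h) := by
  unfold expectSum stepExpect episodeLaw
  rw [integral_finsetSum _ fun i _ => ((hφ _).comp (measurable_pi_apply i)).integrable _]
  simp only [zero_add]

theorem bddMeas_reward (h : ℕ) :
    BddMeas fun z : X × A × B × X => G.r h z.1 z.2.1 z.2.2.1 :=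
  .of_mem_Icc (a := 0) (b := 1) ((measurable_uncurry_actions (φ := fun x a b => G.r h x a b)
    fun a b => G.measurable_r h a b).comp (by fun_prop : Measurable
      fun z : X × A × B × X => (z.1, z.2.1, z.2.2.1))) fun z => G.r_mem h _ _ _

end Rollout


section Comparison

variable {X : Type u} {A : Type v} {B : Type w} [MeasurableSpace X]
  [Fintype A] [MeasurableSpace A] [DiscreteMeasurableSpace A]
  [Fintype B] [Nonempty B] [MeasurableSpace B] [DiscreteMeasurableSpace B]
  {G : MarkovGame X A B} (σ : TieBreak X A B) {F : FunctionClass.{u, v, w, z} X A B G.H}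

/-! ### Value decomposition -/

section Decomposition

variable {β : ℝ} (hF : BoundedBy F β) (hβ : 1 ≤ β)
include hF hβ

theorem bddMeas_excess_record (θ f g : F.Elem) (h : ℕ) :
    BddMeas fun z : X × A × B × X => excess G σ F θ f g h z.1 z.2.1 z.2.2.1 :=
  (bddMeas_excess σ hF hβ h).comp
    (φ := fun z : X × A × B × X => ((θ, f, g), z.1, z.2.1, z.2.2.1)) (by fun_prop)

/-- Reward plus residual equals `g^h` minus the mean of `V_{g,h+1}`; this is one link of a
telescoping sum. -/
theorem expectSum_reward_add_excess_succ (f g : F.Elem) (ν : MarkovPolicy X B) {n h : ℕ} (x : X) :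
    expectSum G (mainPolicy σ F f) ν (fun k z => G.r k z.1 z.2.1 z.2.2.1 +
        excess G σ F g f g k z.1 z.2.1 z.2.2.1) (n + 1) h x =
      ∑ a, ∑ b, (mainPolicy σ F f).prob h x a * ν.prob h x b *
        (F.eval g h x a b + ∫ x', (expectSum G (mainPolicy σ F f) ν
          (fun k z => G.r k z.1 z.2.1 z.2.2.1 + excess G σ F g f g k z.1 z.2.1 z.2.2.1)
            n (h + 1) x' - pairValue σ F f g (h + 1) x') ∂(G.P h (x, a, b))) := by
  have hφ : ∀ k, BddMeas fun z : X × A × B × X => G.r k z.1 z.2.1 z.2.2.1 +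
        excess G σ F g f g k z.1 z.2.1 z.2.2.1 := fun k =>
    (bddMeas_reward G k).add (bddMeas_excess_record σ hF hβ g f g k)
  rw [expectSum_succ G _ _ hφ]
  refine Finset.sum_congr rfl fun a _ => Finset.sum_congr rfl fun b _ => ?_
  rw [integral_sub ((bddMeas_expectSum G _ _ hφ n (h + 1)).integrable _)
    (((bddMeas_pairValue σ hF hβ (h + 1)).comp (φ := fun x' => (f, g, x'))
      (by fun_prop)).integrable _)]
  simp only [excess, backup_eq, integral_const, probReal_univ, one_smul]
  ring

/-- The sum telescopes up to the loss from `ν` not minimizing `g`, which has a sign at every step.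
-/
theorem pairValue_le_expectSum (f g : F.Elem) (ν : MarkovPolicy X B) {n h : ℕ}
    (hn : h + n = G.H) (x : X) :
    pairValue σ F f g h x ≤ expectSum G (mainPolicy σ F f) ν (fun k z =>
      G.r k z.1 z.2.1 z.2.2.1 + excess G σ F g f g k z.1 z.2.1 z.2.2.1) n h x := by
  have hφ : ∀ k, BddMeas fun z : X × A × B × X => G.r k z.1 z.2.1 z.2.2.1 +
        excess G σ F g f g k z.1 z.2.1 z.2.2.1 := fun k =>
    (bddMeas_reward G k).add (bddMeas_excess_record σ hF hβ g f g k)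
  induction n generalizing h x with
  | zero => simp [expectSum, pairValue_of_le σ F f g (by omega : G.H ≤ h)]
  | succ n ih =>
    refine (minAgainst_le (ν.prob_mem h x)).trans ?_
    rw [expectSum_reward_add_excess_succ σ hF hβ, payoff_eq]
    refine sum_mul_mono ((mainPolicy σ F f).prob_mem h x) (ν.prob_mem h x) fun a b => ?_
    exact le_add_of_nonneg_right (integral_nonneg fun x' =>
      sub_nonneg.2 (ih (by omega) x'))

/-- The booster's policy attains the minimum at every state, so nothing is lost in the telescoping.
-/
theorem pairValue_eq_expectSum (f g : F.Elem) {n h : ℕ} (hn : h + n = G.H) (x : X) :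
    pairValue σ F f g h x = expectSum G (mainPolicy σ F f) (boosterPolicy σ F f g) (fun k z =>
      G.r k z.1 z.2.1 z.2.2.1 + excess G σ F g f g k z.1 z.2.1 z.2.2.1) n h x := by
  induction n generalizing h x with
  | zero => simp [expectSum, pairValue_of_le σ F f g (by omega : G.H ≤ h)]
  | succ n ih =>
    rw [pairValue, minAgainst_eq σ h x, payoff_eq, expectSum_reward_add_excess_succ σ hF hβ]
    refine Finset.sum_congr rfl fun a _ => Finset.sum_congr rfl fun b _ => ?_
    simp only [← ih (show h + 1 + n = G.H by omega), sub_self, integral_zero, add_zero]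
    rfl

theorem expectSum_reward_add_excess (f g : F.Elem) (ν : MarkovPolicy X B) :
    expectSum G (mainPolicy σ F f) ν (fun k z => G.r k z.1 z.2.1 z.2.2.1 +
      excess G σ F g f g k z.1 z.2.1 z.2.2.1) G.H 0 G.x₁ =
      value G (mainPolicy σ F f) ν 0 G.x₁ + ∑ h : Fin G.H,
        stepExpect G (mainPolicy σ F f) ν h (excess G σ F g f g h) := by
  rw [expectSum_add G _ _ (bddMeas_reward G) (bddMeas_excess_record σ hF hβ g f g),
    expectSum_eq_sum_stepExpect G _ _ (bddMeas_excess_record σ hF hβ g f g)]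
  rfl

theorem pairValue_le_value_add (f g : F.Elem) (ν : MarkovPolicy X B) :
    pairValue σ F f g 0 G.x₁ ≤ value G (mainPolicy σ F f) ν 0 G.x₁ + ∑ h : Fin G.H,
        stepExpect G (mainPolicy σ F f) ν h (excess G σ F g f g h) := by
  rw [← expectSum_reward_add_excess σ hF hβ]
  exact pairValue_le_expectSum σ hF hβ f g ν (zero_add _) _

theorem pairValue_eq_value_add (f g : F.Elem) :
    pairValue σ F f g 0 G.x₁ =
      value G (mainPolicy σ F f) (boosterPolicy σ F f g) 0 G.x₁ + ∑ h : Fin G.H,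
        stepExpect G (mainPolicy σ F f) (boosterPolicy σ F f g) h (excess G σ F g f g h) := by
  rw [← expectSum_reward_add_excess σ hF hβ]
  exact pairValue_eq_expectSum σ hF hβ f g (zero_add _) _

end Decomposition

/-! ### Fixed points of the Bellman backup -/

/-- `g` is the action value of `μ_f` against its best response. -/
def IsBackupFixed (f g : F.Elem) : Prop :=
  ∀ h : Fin G.H, F.val h (g h) = backup G σ F f g h

theorem backup_congr {f f' g g' : F.Elem} {h : ℕ}
    (hf : ∀ hh : h + 1 < G.H, f ⟨h + 1, hh⟩ = f' ⟨h + 1, hh⟩)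
    (hg : ∀ hh : h + 1 < G.H, g ⟨h + 1, hh⟩ = g' ⟨h + 1, hh⟩) :
    backup G σ F f g h = backup G σ F f' g' h := by
  funext x a b
  simp only [backup_eq, pairValue_congr σ F hf hg]

/-- The backup at step `h` reads only step `h + 1`, so the equation is solved from the last step
backwards. Constant `ρ` yields the best-response value of a fixed policy; `ρ = id` yields the
equilibrium benchmark, where the policy is induced by the solution itself. -/
theorem exists_backup_eq (hC : Complete G σ F) {ρ : F.Elem → F.Elem}
    (hρ : ∀ g g' h, g h = g' h → ρ g h = ρ g' h) (g₀ : F.Elem) :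
    ∃ g : F.Elem, IsBackupFixed σ (ρ g) g := by
  classical
  have key : ∀ n : ℕ, ∃ g : F.Elem, ∀ h : Fin G.H, G.H ≤ h + n →
      F.val h (g h) = backup G σ F (ρ g) g h := by
    intro n
    induction n with
    | zero => exact ⟨g₀, fun h hh => absurd h.2 (by omega)⟩
    | succ n ih =>
      obtain ⟨g, hg⟩ := ih
      by_cases hn : n < G.H
      -- The last `n` steps are already solved; changing the entry just before them leaves their
      -- equations intact.
      · let i : Fin G.H := ⟨G.H - n - 1, by omega⟩
        obtain ⟨θ, hθ⟩ := hC (ρ g) g i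
        have hne : ∀ (k : ℕ) (hk : k < G.H), k ≠ i.1 →
            Function.update g i θ ⟨k, hk⟩ = g ⟨k, hk⟩ := fun k hk hki =>
          Function.update_of_ne (fun e => hki (congrArg Fin.val e)) _ _
        have hb : ∀ h : Fin G.H, i.1 ≤ h → backup G σ F (ρ g) g h =
            backup G σ F (ρ (Function.update g i θ)) (Function.update g i θ) h := fun h hh =>
          backup_congr σ (fun hh' => hρ _ _ _ (hne _ _ (by omega)).symm)
            (fun hh' => (hne _ _ (by omega)).symm)
        refine ⟨Function.update g i θ, fun h hh => ?_⟩
        rw [← hb h (by simp only [i]; omega)]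
        by_cases hhi : h = i
        · subst hhi
          rw [Function.update_self]
          exact hθ
        · have := hne h.1 h.2 (Fin.val_ne_of_ne hhi)
          rw [Fin.eta] at this
          rw [this]
          refine hg h ?_
          have := Fin.val_ne_of_ne hhi
          simp only [i] at this
          omega
      · exact ⟨g, fun h hh => hg h (by omega)⟩
  obtain ⟨g, hg⟩ := key G.H
  exact ⟨g, fun h => hg h (by omega)⟩

variable {σ}

theorem IsBackupFixed.eval_eq {f g : F.Elem} (hg : IsBackupFixed σ f g) {h : ℕ} (hh : h < G.H)
    (x : X) : F.eval g h x = backup G σ F f g h x := by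
  rw [F.eval_of_lt g hh]
  exact congrFun (hg ⟨h, hh⟩) x

theorem IsBackupFixed.excess_eq {f g : F.Elem} (hg : IsBackupFixed σ f g) (h : Fin G.H) :
    excess G σ F g f g h = 0 := by
  funext x a b
  simp [excess, hg.eval_eq h.2]

section

variable {β : ℝ} (hF : BoundedBy F β) (hβ : 1 ≤ β)
include hF hβ

/-- With zero residuals the value decomposition is a lower bound against every answer, attained by
the answer induced by `g`. -/
theorem IsBackupFixed.bestValue_eq {f g : F.Elem} (hg : IsBackupFixed σ f g) :
    bestValue G (mainPolicy σ F f) 0 G.x₁ = pairValue σ F f g 0 G.x₁ := by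
  have hle : ∀ ν, pairValue σ F f g 0 G.x₁ ≤ value G (mainPolicy σ F f) ν 0 G.x₁ := fun ν => by
    simpa [hg.excess_eq, stepExpect] using pairValue_le_value_add σ hF hβ f g ν
  have heq : pairValue σ F f g 0 G.x₁ =
      value G (mainPolicy σ F f) (boosterPolicy σ F f g) 0 G.x₁ := by
    simpa [hg.excess_eq, stepExpect] using pairValue_eq_value_add σ hF hβ f g
  have : Nonempty (MarkovPolicy X B) := ⟨boosterPolicy σ F f g⟩
  refine le_antisymm ?_ (le_ciInf hle)
  rw [heq]
  refine ciInf_le ⟨pairValue σ F f g 0 G.x₁, ?_⟩ _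
  rintro _ ⟨ν, rfl⟩
  exact hle ν

theorem integrable_pairValue (f g : F.Elem) (h : ℕ) (P : Measure X) [IsProbabilityMeasure P] :
    Integrable (pairValue σ F f g h) P :=
  ((bddMeas_pairValue σ hF hβ h).comp (φ := fun x' => (f, g, x')) (by fun_prop)).integrable P

theorem backup_le_add {f g f' g' : F.Elem} {h : ℕ} {ε : ℝ}
    (hv : ∀ x, pairValue σ F f g (h + 1) x ≤ pairValue σ F f' g' (h + 1) x + ε)
    (x : X) (a : A) (b : B) :
    backup G σ F f g h x a b ≤ backup G σ F f' g' h x a b + ε := by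
  have := integral_mono (integrable_pairValue hF hβ f g (h + 1) (G.P h (x, a, b)))
    ((integrable_pairValue hF hβ f' g' (h + 1) (G.P h (x, a, b))).add (integrable_const ε)) hv
  simp only [Pi.add_apply] at this
  rw [integral_add (integrable_pairValue hF hβ f' g' (h + 1) _) (integrable_const ε)] at this
  simp only [integral_const, probReal_univ, one_smul] at this
  simp only [backup_eq]
  linarith

/-- This says `V^{μ_f,†} ≤ V*`: `μ_{f'}` is the maximin choice for `f'`, so replacing it by `μ_f`
can only lower the value, and backups are monotone. -/
theorem IsBackupFixed.pairValue_le {f g f' : F.Elem} (hg : IsBackupFixed σ f g)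
    (hf' : IsBackupFixed σ f' f') {n h : ℕ} (hn : h + n = G.H) (x : X) :
    pairValue σ F f g h x ≤ pairValue σ F f' f' h x := by
  induction n generalizing h x with
  | zero => simp [pairValue_of_le σ F _ _ (by omega : G.H ≤ h)]
  | succ n ih =>
    refine le_trans ?_ (pairValue_le_self σ F f' f h x)
    refine minAgainst_mono ((mainPolicy σ F f).prob_mem h x) fun a b => ?_
    rw [hg.eval_eq (by omega), hf'.eval_eq (by omega)]
    simpa using backup_le_add (ε := 0) hF hβ (by simpa using ih (by omega)) x a b

end

/-- The value of the best response to `μ_f` by backward recursion. -/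
def responseValue (G : MarkovGame X A B) (σ : TieBreak X A B)
    (F : FunctionClass.{u, v, w, z} X A B G.H) (f : F.Elem) : ℕ → ℕ → X → ℝ
  | 0, _, _ => 0
  | n + 1, h, x => minAgainst ((mainPolicy σ F f).prob h x) fun a b =>
      G.r h x a b + ∫ x', responseValue G σ F f n (h + 1) x' ∂(G.P h (x, a, b))

theorem measurable_minAgainst (σ : TieBreak X A B) (x : X) :
    Measurable fun y : (A → ℝ) × (A → B → ℝ) => minAgainst y.1 y.2 := by
  simp only [minAgainst_eq σ 0 x, payoff]
  have := (σ.measurable_minSel 0).comp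
    ((measurable_const.prodMk measurable_id) : Measurable fun y : (A → ℝ) × (A → B → ℝ) => (x, y))
  refine Finset.measurable_fun_sum _ fun a _ => Finset.measurable_fun_sum _ fun b _ => ?_
  refine Measurable.mul ?_ ((measurable_pi_apply b).comp this)
  fun_prop

theorem measurable_responseValue (n h : ℕ) :
    Measurable fun p : F.Elem × X => responseValue G σ F p.1 n h p.2 := by
  induction n generalizing h with
  | zero => exact measurable_const
  | succ n ih =>
    have hM : Measurable fun p : F.Elem × X => fun a b =>
        G.r h p.2 a b + ∫ x', responseValue G σ F p.1 n (h + 1) x' ∂(G.P h (p.2, a, b)) := by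
      refine measurable_pi_lambda _ fun a => measurable_pi_lambda _ fun b => ?_
      refine ((G.measurable_r h a b).comp measurable_snd).add ?_
      exact (StronglyMeasurable.integral_kernel_prod_right
        (κ := (G.P h).comap (fun p : F.Elem × X => (p.2, a, b)) (by fun_prop))
        (f := fun p x' => responseValue G σ F p.1 n (h + 1) x')
        ((ih (h + 1)).comp (by fun_prop : Measurable
          fun q : (F.Elem × X) × X => (q.1.1, q.2))).stronglyMeasurable).measurable
    have hp := (measurable_mainPolicy σ F h).prodMk hM
    simp only [responseValue]
    have := (measurable_minAgainst σ G.x₁).comp hp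
    exact this

theorem IsBackupFixed.responseValue_eq {f g : F.Elem} (hg : IsBackupFixed σ f g) {n h : ℕ}
    (hn : h + n = G.H) (x : X) : responseValue G σ F f n h x = pairValue σ F f g h x := by
  induction n generalizing h x with
  | zero => simp [responseValue, pairValue_of_le σ F _ _ (by omega : G.H ≤ h)]
  | succ n ih =>
    unfold responseValue pairValue
    congr 1
    funext a b
    rw [hg.eval_eq (by omega), backup_eq]
    simp only [ih (by omega : h + 1 + n = G.H)]

theorem exists_isBackupFixed (hC : Complete G σ F) (f : F.Elem) :
    ∃ g : F.Elem, IsBackupFixed σ f g :=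
  exists_backup_eq σ hC (ρ := fun _ => f) (fun _ _ _ _ => rfl) f

theorem exists_isBackupFixed_self (hC : Complete G σ F) (f : F.Elem) :
    ∃ g : F.Elem, IsBackupFixed σ g g :=
  exists_backup_eq σ hC (ρ := id) (fun _ _ _ h => h) f

section

variable {β : ℝ} (hF : BoundedBy F β) (hβ : 1 ≤ β) (hC : Complete G σ F)
include hF hβ hC

/-- An infimum over uncountably many policies is not evidently measurable in `f`; the explicit
recursion `responseValue` is, and completeness identifies the two. -/
theorem bddMeas_bestValue :
    BddMeas fun f : F.Elem => bestValue G (mainPolicy σ F f) 0 G.x₁ := by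
  have e : ∀ f : F.Elem, bestValue G (mainPolicy σ F f) 0 G.x₁ =
      responseValue G σ F f G.H 0 G.x₁ := fun f => by
    obtain ⟨g, hg⟩ := exists_isBackupFixed hC f
    rw [hg.bestValue_eq hF hβ, hg.responseValue_eq (zero_add _)]
  refine .of_mem_Icc (a := 0) (b := β - 1) ?_ fun f => ?_
  · simp only [e]
    exact (measurable_responseValue G.H 0).comp
      (by fun_prop : Measurable fun f : F.Elem => (f, G.x₁))
  · obtain ⟨g, hg⟩ := exists_isBackupFixed hC f
    rw [hg.bestValue_eq hF hβ]
    exact pairValue_mem σ hF hβ _ _ _ _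

end

end Comparison


/-! ### Sub-Gaussian noise -/

/-- Hoeffding's lemma, the only probabilistic input on the noise of the next-state value. -/
theorem integral_exp_add_mul_noise_le {X : Type*} [MeasurableSpace X] (P : Measure X)
    [IsProbabilityMeasure P] {v : X → ℝ} {β : ℝ} (hm : Measurable v)
    (hv : ∀ x, v x ∈ Set.Icc 0 β) (c s : ℝ) :
    ∫ x, Real.exp (c + s * (∫ y, v y ∂P - v x)) ∂P ≤ Real.exp (c + s ^ 2 * β ^ 2 / 8) := by
  have h := (hasSubgaussianMGF_of_mem_Icc (μ := P) hm.aemeasurable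
    (Filter.Eventually.of_forall hv)).mgf_le (-s)
  have e : ∀ x, Real.exp (c + s * (∫ y, v y ∂P - v x)) =
      Real.exp c * Real.exp (-s * (v x - ∫ y, v y ∂P)) := fun x => by
    rw [← Real.exp_add]
    ring_nf
  simp only [e, integral_const_mul]
  rw [Real.exp_add]
  refine mul_le_mul_of_nonneg_left (h.trans (le_of_eq ?_)) (Real.exp_pos _).le
  simp only [sub_zero]
  push_cast
  rw [Real.norm_eq_abs]
  congr 1
  rw [div_pow, sq_abs]
  ring

/-! ### Excess squared loss and its conditional exponential moments. -/

section Loss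

variable {X : Type u} {A : Type v} {B : Type w} [MeasurableSpace X]
  [Fintype A] [MeasurableSpace A] [DiscreteMeasurableSpace A]
  [Fintype B] [Nonempty B] [MeasurableSpace B] [DiscreteMeasurableSpace B]
  (G : MarkovGame X A B) (σ : TieBreak X A B) (F : FunctionClass.{u, v, w, z} X A B G.H)

/-- The squared loss of `θ^h` on one record in excess of that of the Bellman backup
`T_h^{μ_f} g`. -/
def lossDiff (θ f g : F.Elem) (h : ℕ) (z : X × A × B × X) : ℝ :=
  excess G σ F θ f g h z.1 z.2.1 z.2.2.1 ^ 2 + 2 * excess G σ F θ f g h z.1 z.2.1 z.2.2.1 *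
    (∫ x', pairValue σ F f g (h + 1) x' ∂(G.P h (z.1, z.2.1, z.2.2.1)) -
      pairValue σ F f g (h + 1) z.2.2.2)

/-- The last square does not involve `θ`, so it cancels between the posterior's numerator and its
normalizer. -/
theorem sq_loss_eq (θ f g : F.Elem) (h : Fin G.H) (z : X × A × B × X) :
    (F.val h (θ h) z.1 z.2.1 z.2.2.1 - G.r h z.1 z.2.1 z.2.2.1 -
        pairValue σ F f g (h + 1) z.2.2.2) ^ 2 =
      lossDiff G σ F θ f g h z + (∫ x', pairValue σ F f g (h + 1) x'
        ∂(G.P h (z.1, z.2.1, z.2.2.1)) - pairValue σ F f g (h + 1) z.2.2.2) ^ 2 := by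
  simp only [lossDiff, excess, F.eval_fin, backup_eq]
  ring

theorem excess_congr {θ θ' f f' g g' : F.Elem} {h : ℕ} (hθ : ∀ hh : h < G.H, θ ⟨h, hh⟩ = θ' ⟨h, hh⟩)
    (hf : ∀ hh : h + 1 < G.H, f ⟨h + 1, hh⟩ = f' ⟨h + 1, hh⟩)
    (hg : ∀ hh : h + 1 < G.H, g ⟨h + 1, hh⟩ = g' ⟨h + 1, hh⟩) :
    excess G σ F θ f g h = excess G σ F θ' f' g' h := by
  funext x a b
  rw [excess, excess, F.eval_congr hθ, backup_congr σ hf hg]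

theorem lossDiff_congr {θ θ' f f' g g' : F.Elem} {h : ℕ}
    (hθ : ∀ hh : h < G.H, θ ⟨h, hh⟩ = θ' ⟨h, hh⟩)
    (hf : ∀ hh : h + 1 < G.H, f ⟨h + 1, hh⟩ = f' ⟨h + 1, hh⟩)
    (hg : ∀ hh : h + 1 < G.H, g ⟨h + 1, hh⟩ = g' ⟨h + 1, hh⟩) :
    lossDiff G σ F θ f g h = lossDiff G σ F θ' f' g' h := by
  funext z
  simp only [lossDiff, excess_congr G σ F hθ hf hg, pairValue_congr σ F hf hg]

variable {G F} {β : ℝ} (hF : BoundedBy F β) (hβ : 1 ≤ β)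
include hF hβ

theorem bddMeas_lossDiff (h : ℕ) : BddMeas fun p : (F.Elem × F.Elem × F.Elem) × (X × A × B × X) =>
    lossDiff G σ F p.1.1 p.1.2.1 p.1.2.2 h p.2 := by
  have h1 := (bddMeas_excess σ hF hβ h).comp
    (φ := fun p : (F.Elem × F.Elem × F.Elem) × (X × A × B × X) =>
      (p.1, p.2.1, p.2.2.1, p.2.2.2.1)) (by fun_prop)
  have h2 := (bddMeas_pairValue σ hF hβ (h + 1)).comp
    (φ := fun p : (F.Elem × F.Elem × F.Elem) × (X × A × B × X) =>
      (p.1.2.1, p.1.2.2, p.2.2.2.2)) (by fun_prop)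
  have h3 := BddMeas.integral_kernel
    (f := fun (p : (F.Elem × F.Elem × F.Elem) × (X × A × B × X)) x' =>
      pairValue σ F p.1.2.1 p.1.2.2 (h + 1) x')
    ((bddMeas_pairValue σ hF hβ (h + 1)).comp
      (φ := fun p : ((F.Elem × F.Elem × F.Elem) × (X × A × B × X)) × X =>
        (p.1.1.2.1, p.1.1.2.2, p.2)) (by fun_prop))
    ((G.P h).comap (fun p : (F.Elem × F.Elem × F.Elem) × (X × A × B × X) =>
      (p.2.1, p.2.2.1, p.2.2.2.1)) (by fun_prop))
  exact (h1.pow 2).add ((h1.const_mul 2).mul (h3.sub h2))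

theorem integral_exp_noise_le (f g : F.Elem) (h : ℕ) (x : X) (a : A) (b : B) (c s : ℝ) :
    ∫ x', Real.exp (c + s * (∫ y, pairValue σ F f g (h + 1) y ∂(G.P h (x, a, b)) -
      pairValue σ F f g (h + 1) x')) ∂(G.P h (x, a, b)) ≤ Real.exp (c + s ^ 2 * β ^ 2 / 8) := by
  refine integral_exp_add_mul_noise_le _ ((bddMeas_pairValue σ hF hβ (h + 1)).comp
    (φ := fun x' => (f, g, x')) (by fun_prop)).1 (fun x' => ?_) c s
  have := pairValue_mem σ hF hβ f g (h + 1) x'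
  exact ⟨this.1, by linarith [this.2]⟩

/-- The scale is `6 η`. With `p`, `q` the two excesses, Hoeffding leaves `3/2 (p² - q²) + 9/8 (p -
q)² = 6 p² - 3/8 (3p + q)²` over `β²`, so only the small excess `p` of `g` counts, whatever `θ` is.
-/
theorem integral_exp_lossDiff_sub_le (θ f g : F.Elem) (h : ℕ) (x : X) (a : A) (b : B) {δ : ℝ}
    (hδ : |excess G σ F g f g h x a b| ≤ 2 * δ) :
    ∫ x', Real.exp (3 / (2 * β ^ 2) * (lossDiff G σ F g f g h (x, a, b, x') -
      lossDiff G σ F θ f g h (x, a, b, x'))) ∂(G.P h (x, a, b)) ≤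
      Real.exp (24 * δ ^ 2 / β ^ 2) := by
  have hβ0 : 0 < β := by linarith
  set p := excess G σ F g f g h x a b with hp
  set q := excess G σ F θ f g h x a b with hq
  have e : ∀ x', 3 / (2 * β ^ 2) * (lossDiff G σ F g f g h (x, a, b, x') -
      lossDiff G σ F θ f g h (x, a, b, x')) = 3 / (2 * β ^ 2) * (p ^ 2 - q ^ 2) +
      3 / β ^ 2 * (p - q) * (∫ y, pairValue σ F f g (h + 1) y ∂(G.P h (x, a, b)) -
      pairValue σ F f g (h + 1) x') := fun x' => by
    simp only [lossDiff, ← hp, ← hq]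
    field_simp
    ring
  simp only [e]
  refine (integral_exp_noise_le σ hF hβ f g h x a b _ _).trans (Real.exp_le_exp.2 ?_)
  have h1 : 3 / (2 * β ^ 2) * (p ^ 2 - q ^ 2) + (3 / β ^ 2 * (p - q)) ^ 2 * β ^ 2 / 8 =
      (3 / 2 * (p ^ 2 - q ^ 2) + 9 / 8 * (p - q) ^ 2) / β ^ 2 := by
    field_simp
    ring
  rw [h1]
  refine div_le_div_of_nonneg_right ?_ (by positivity)
  have h2 : p ^ 2 ≤ (2 * δ) ^ 2 := sq_le_sq' (by linarith [(abs_le.1 hδ).1]) (abs_le.1 hδ).2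
  nlinarith [sq_nonneg (3 * p + q)]

/-- The scale is `24 η`; the squared excess contributes `6` and Hoeffding `12²/8 = 18`. -/
theorem integral_exp_lossDiff_le (θ f g : F.Elem) (h : ℕ) (x : X) (a : A) (b : B) {δ : ℝ}
    (hδ : |excess G σ F θ f g h x a b| ≤ δ) :
    ∫ x', Real.exp (6 / β ^ 2 * lossDiff G σ F θ f g h (x, a, b, x')) ∂(G.P h (x, a, b)) ≤
      Real.exp (24 * δ ^ 2 / β ^ 2) := by
  have hβ0 : 0 < β := by linarith
  set q := excess G σ F θ f g h x a b with hq
  have e : ∀ x', 6 / β ^ 2 * lossDiff G σ F θ f g h (x, a, b, x') = 6 / β ^ 2 * q ^ 2 +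
      12 / β ^ 2 * q * (∫ y, pairValue σ F f g (h + 1) y ∂(G.P h (x, a, b)) -
      pairValue σ F f g (h + 1) x') := fun x' => by
    simp only [lossDiff, ← hq]
    ring
  simp only [e]
  refine (integral_exp_noise_le σ hF hβ f g h x a b _ _).trans (Real.exp_le_exp.2 ?_)
  have h1 : 6 / β ^ 2 * q ^ 2 + (12 / β ^ 2 * q) ^ 2 * β ^ 2 / 8 = 24 * q ^ 2 / β ^ 2 := by
    field_simp
    ring
  rw [h1]
  refine div_le_div_of_nonneg_right ?_ (by positivity)
  have h2 : q ^ 2 ≤ δ ^ 2 := sq_le_sq' (by linarith [(abs_le.1 hδ).1]) (abs_le.1 hδ).2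
  linarith

/-- Hoeffding leaves `exp (-3y/2)` with `y = q²/(4β²) ≤ 1/4`, where `(1 - y)(1 + 3y/2) ≥ 1`. The
bound is stated linearly in `q²` so that it can be averaged over the state distribution. -/
theorem integral_exp_neg_lossDiff_le (θ f g : F.Elem) (h : ℕ) (x : X) (a : A) (b : B) :
    ∫ x', Real.exp (-(3 / (2 * β ^ 2)) * lossDiff G σ F θ f g h (x, a, b, x'))
      ∂(G.P h (x, a, b)) ≤ 1 - excess G σ F θ f g h x a b ^ 2 / (4 * β ^ 2) := by
  have hβ0 : 0 < β := by linarith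
  have hqβ := abs_excess_le σ hF hβ θ f g h x a b
  set q := excess G σ F θ f g h x a b with hq
  have e : ∀ x', -(3 / (2 * β ^ 2)) * lossDiff G σ F θ f g h (x, a, b, x') =
      -(3 / (2 * β ^ 2)) * q ^ 2 +
      -(3 / β ^ 2) * q * (∫ y, pairValue σ F f g (h + 1) y ∂(G.P h (x, a, b)) -
      pairValue σ F f g (h + 1) x') := fun x' => by
    simp only [lossDiff, ← hq]
    field_simp
    ring
  simp only [e]
  refine (integral_exp_noise_le σ hF hβ f g h x a b _ _).trans ?_
  set y := q ^ 2 / (4 * β ^ 2) with hy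
  have h1 : -(3 / (2 * β ^ 2)) * q ^ 2 + (-(3 / β ^ 2) * q) ^ 2 * β ^ 2 / 8 = -(3 / 2 * y) := by
    rw [hy]
    field_simp
    ring
  rw [h1]
  have hy0 : 0 ≤ y := by positivity
  have hy1 : y ≤ 1 / 4 := by
    rw [hy, div_le_iff₀ (by positivity)]
    have : q ^ 2 ≤ β ^ 2 := sq_le_sq' (by linarith [(abs_le.1 hqβ).1]) (abs_le.1 hqβ).2
    linarith
  have h2 := Real.add_one_le_exp (3 / 2 * y)
  rw [Real.exp_neg, inv_le_comm₀ (Real.exp_pos _) (by linarith)]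
  refine le_trans ?_ h2
  rw [inv_le_iff_one_le_mul₀ (by linarith)]
  nlinarith

/-! ### Exponential moments of one episode -/

theorem bddMeas_lossDiff_record (θ f g : F.Elem) (h : ℕ) :
    BddMeas (lossDiff G σ F θ f g h) :=
  (bddMeas_lossDiff σ hF hβ h).comp (φ := fun z => ((θ, f, g), z)) (by fun_prop)

theorem episode_exp_lossDiff_sub_le (μ : MarkovPolicy X A) (ν : MarkovPolicy X B)
    (θ f g : F.Elem) {δ : ℝ} (hδ : ∀ h < G.H, ∀ x a b, |excess G σ F g f g h x a b| ≤ 2 * δ) :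
    ∫ ζ, Real.exp (∑ h : Fin G.H, 3 / (2 * β ^ 2) * (lossDiff G σ F g f g h (ζ h) -
      lossDiff G σ F θ f g h (ζ h))) ∂(episodeLaw G μ ν) ≤
      Real.exp (24 * δ ^ 2 / β ^ 2) ^ G.H := by
  have := integral_exp_sum_records_le G μ ν
    (φ := fun h z => 3 / (2 * β ^ 2) * (lossDiff G σ F g f g h z - lossDiff G σ F θ f g h z))
    (fun h => ((bddMeas_lossDiff_record σ hF hβ g f g h).sub
      (bddMeas_lossDiff_record σ hF hβ θ f g h)).const_mul _) (Real.exp_pos _).le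
    (fun h hh x a b => integral_exp_lossDiff_sub_le σ hF hβ θ f g h x a b (hδ h hh x a b))
    (k := 0) (n := G.H) (by omega) G.x₁
  rw [episodeLaw]
  simpa only [zero_add] using this

theorem episode_exp_lossDiff_le (μ : MarkovPolicy X A) (ν : MarkovPolicy X B)
    (θ f g : F.Elem) {δ : ℝ} (hδ : ∀ h < G.H, ∀ x a b, |excess G σ F θ f g h x a b| ≤ δ) :
    ∫ ζ, Real.exp (∑ h : Fin G.H, 6 / β ^ 2 * lossDiff G σ F θ f g h (ζ h))
      ∂(episodeLaw G μ ν) ≤ Real.exp (24 * δ ^ 2 / β ^ 2) ^ G.H := by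
  have := integral_exp_sum_records_le G μ ν
    (φ := fun h z => 6 / β ^ 2 * lossDiff G σ F θ f g h z)
    (fun h => (bddMeas_lossDiff_record σ hF hβ θ f g h).const_mul _) (Real.exp_pos _).le
    (fun h hh x a b => integral_exp_lossDiff_le σ hF hβ θ f g h x a b (hδ h hh x a b))
    (k := 0) (n := G.H) (by omega) G.x₁
  rw [episodeLaw]
  simpa only [zero_add] using this

theorem bddMeas_stepFun {Φ : X → A → B → ℝ}
    (hΦ : BddMeas fun z : X × A × B => Φ z.1 z.2.1 z.2.2) (h : Fin G.H) :
    BddMeas fun ζ : Trajectory X A B G.H => Φ (ζ h).1 (ζ h).2.1 (ζ h).2.2.1 :=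
  hΦ.comp (φ := fun ζ : Trajectory X A B G.H => ((ζ h).1, (ζ h).2.1, (ζ h).2.2.1)) (by
    have : Measurable fun ζ : Trajectory X A B G.H => ζ h := measurable_pi_apply h
    fun_prop)

theorem bddMeas_excess_state (θ f g : F.Elem) (h : ℕ) :
    BddMeas fun z : X × A × B => excess G σ F θ f g h z.1 z.2.1 z.2.2 :=
  (bddMeas_excess σ hF hβ h).comp (φ := fun z => ((θ, f, g), z)) (by fun_prop)

/-- Averaging the linear bound and then using `1 - x ≤ exp (-x)` produces the expected squared
excess of the episode, the form in which decoupling needs it, instead of the observed one. -/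
theorem episode_exp_neg_lossDiff_le (μ : MarkovPolicy X A) (ν : MarkovPolicy X B)
    (θ f g : F.Elem) (h : Fin G.H) :
    ∫ ζ, Real.exp (-(3 / (2 * β ^ 2)) * lossDiff G σ F θ f g h (ζ h)) ∂(episodeLaw G μ ν) ≤
      Real.exp (-(stepExpect G μ ν h (fun x a b => excess G σ F θ f g h x a b ^ 2) /
        (4 * β ^ 2))) := by
  have hΦ : BddMeas fun z : X × A × B × X =>
      Real.exp (-(3 / (2 * β ^ 2)) * lossDiff G σ F θ f g h z) :=
    ((bddMeas_lossDiff_record σ hF hβ θ f g h).const_mul _).exp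
  rw [integral_episodeLaw_record G μ ν h hΦ]
  have hi : BddMeas fun z : X × A × B => ∫ x', Real.exp (-(3 / (2 * β ^ 2)) *
      lossDiff G σ F θ f g h (z.1, z.2.1, z.2.2, x')) ∂(G.P h z) :=
    BddMeas.integral_kernel (f := fun (z : X × A × B) x' => Real.exp (-(3 / (2 * β ^ 2)) *
      lossDiff G σ F θ f g h (z.1, z.2.1, z.2.2, x')))
      (hΦ.comp (φ := fun p : (X × A × B) × X => (p.1.1, p.1.2.1, p.1.2.2, p.2)) (by fun_prop))
      (G.P h)
  have hE := bddMeas_excess_state σ hF hβ θ f g h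
  have hE2 : BddMeas fun z : X × A × B => 1 - excess G σ F θ f g h z.1 z.2.1 z.2.2 ^ 2 /
      (4 * β ^ 2) := by
    simpa only [div_eq_mul_inv] using (BddMeas.const 1).sub ((hE.pow 2).mul (.const _))
  have h1 : stepExpect G μ ν h (fun x a b => ∫ x', Real.exp (-(3 / (2 * β ^ 2)) *
        lossDiff G σ F θ f g h (x, a, b, x')) ∂(G.P h (x, a, b))) ≤
      stepExpect G μ ν h (fun x a b => 1 - excess G σ F θ f g h x a b ^ 2 / (4 * β ^ 2)) :=
    integral_mono
      ((bddMeas_stepFun hF hβ (Φ := fun x a b => ∫ x', Real.exp (-(3 / (2 * β ^ 2)) *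
        lossDiff G σ F θ f g h (x, a, b, x')) ∂(G.P h (x, a, b))) hi h).integrable _)
      ((bddMeas_stepFun hF hβ (Φ := fun x a b => 1 - excess G σ F θ f g h x a b ^ 2 /
        (4 * β ^ 2)) hE2 h).integrable _)
      fun ζ => integral_exp_neg_lossDiff_le σ hF hβ θ f g h _ _ _
  refine h1.trans ?_
  have h2 : stepExpect G μ ν h (fun x a b => 1 - excess G σ F θ f g h x a b ^ 2 / (4 * β ^ 2)) =
      1 - stepExpect G μ ν h (fun x a b => excess G σ F θ f g h x a b ^ 2) / (4 * β ^ 2) := by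
    unfold stepExpect
    rw [integral_sub (integrable_const 1), integral_div]
    · simp
    · exact ((bddMeas_stepFun hF hβ (Φ := fun x a b => excess G σ F θ f g h x a b ^ 2)
        (hE.pow 2) h).integrable _).div_const _
  rw [h2]
  have := Real.add_one_le_exp
    (-(stepExpect G μ ν h (fun x a b => excess G σ F θ f g h x a b ^ 2) / (4 * β ^ 2)))
  linarith

end Loss

/-! ### Neighbourhoods of Bellman backups and their prior mass -/

section Mass

variable {X : Type u} {A : Type v} {B : Type w} [MeasurableSpace X]
  [Fintype A] [MeasurableSpace A] [DiscreteMeasurableSpace A]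
  [Fintype B] [Nonempty B] [MeasurableSpace B] [DiscreteMeasurableSpace B]
  {G : MarkovGame X A B} (σ : TieBreak X A B) {F : FunctionClass.{u, v, w, z} X A B G.H}

/-- The elements of the class which are uniformly `ε`-close to `T^{μ_f} g` at all steps. -/
def nearBackup (f g : F.Elem) (ε : ℝ) : Set F.Elem :=
  {θ | ∀ (h : Fin G.H) (x : X) (a : A) (b : B),
    |F.val h (θ h) x a b - backup G σ F f g h x a b| ≤ ε}

instance : IsProbabilityMeasure F.prodPrior := by
  unfold FunctionClass.prodPrior
  infer_instance

theorem ereal_sum_coe {ι : Type*} (s : Finset ι) (r : ι → ℝ) :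
    ∑ i ∈ s, (r i : EReal) = ((∑ i ∈ s, r i : ℝ) : EReal) := by
  classical
  induction s using Finset.induction_on with
  | empty => simp
  | insert i s hi ih => rw [Finset.sum_insert hi, Finset.sum_insert hi, ih, EReal.coe_add]

/-- The neighbourhood is a box, so its product prior is the product of the step masses; finiteness
of `κ` makes each of them positive and its logarithm real. -/
theorem exp_neg_kappa_le {ε : ℝ} (hκ : kappa G σ F ε ≠ ⊤) (f g : F.Elem) :
    ENNReal.ofReal (Real.exp (-(kappa G σ F ε).toReal)) ≤ F.prodPrior (nearBackup σ f g ε) := by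
  set s : ∀ h : Fin G.H, Set (F.Θ h) := fun h =>
    {θ | ∀ x a b, |F.val h θ x a b - backup G σ F f g h x a b| ≤ ε} with hs
  have hle : ∑ h : Fin G.H, -ENNReal.log (F.prior h (s h)) ≤ kappa G σ F ε :=
    le_iSup_of_le (f := fun f : F.Elem => ⨆ g : F.Elem, ∑ h : Fin G.H,
      -ENNReal.log (F.prior h
        {θ | ∀ x a b, |F.val h θ x a b - bellman G F (mainPolicy σ F f) g h x a b| ≤ ε})) f
      (le_iSup (fun g : F.Elem => ∑ h : Fin G.H, -ENNReal.log (F.prior h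
        {θ | ∀ x a b, |F.val h θ x a b - bellman G F (mainPolicy σ F f) g h x a b| ≤ ε})) g)
  have hnn : ∀ h, 0 ≤ -ENNReal.log (F.prior h (s h)) := fun h => by
    rw [EReal.neg_nonneg]
    exact ENNReal.log_le_zero_iff.2 prob_le_one
  have hp0 : ∀ h, F.prior h (s h) ≠ 0 := fun h h0 => by
    have h1 := (Finset.single_le_sum (fun i _ => hnn i) (Finset.mem_univ h)).trans hle
    rw [h0, ENNReal.log_zero, EReal.neg_bot, top_le_iff] at h1
    exact hκ h1
  have hpos : ∀ h, 0 < (F.prior h (s h)).toReal := fun h =>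
    ENNReal.toReal_pos (hp0 h) (measure_ne_top _ _)
  have hlog : ∀ h, -ENNReal.log (F.prior h (s h)) =
      ((-Real.log (F.prior h (s h)).toReal : ℝ) : EReal) := fun h => by
    rw [ENNReal.log_pos_real (hp0 h) (measure_ne_top _ _), EReal.coe_neg]
  simp only [hlog] at hle
  rw [ereal_sum_coe] at hle
  have hbot : kappa G σ F ε ≠ ⊥ := fun h => by
    rw [h, le_bot_iff] at hle
    exact EReal.coe_ne_bot _ hle
  rw [← EReal.coe_toReal hκ hbot, EReal.coe_le_coe_iff] at hle
  have hset : nearBackup σ f g ε = Set.univ.pi s := by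
    ext θ
    simp [nearBackup, hs]
  rw [hset, FunctionClass.prodPrior, Measure.pi_pi,
    ← ENNReal.ofReal_toReal (ENNReal.prod_ne_top fun h _ => measure_ne_top (F.prior h) (s h))]
  refine ENNReal.ofReal_le_ofReal ?_
  rw [ENNReal.toReal_prod, ← Real.exp_log (Finset.prod_pos fun h _ => hpos h),
    Real.log_prod fun h _ => (hpos h).ne']
  refine Real.exp_le_exp.2 ?_
  rw [Finset.sum_neg_distrib] at hle
  linarith

theorem abs_eval_sub_le {f₀ g₀ g : F.Elem} {ε : ℝ} (hε : 0 ≤ ε) (hfix : IsBackupFixed σ f₀ g₀)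
    (hg : g ∈ nearBackup σ f₀ g₀ ε) (h : ℕ) (x : X) (a : A) (b : B) :
    |F.eval g h x a b - F.eval g₀ h x a b| ≤ ε := by
  by_cases hh : h < G.H
  · rw [hfix.eval_eq hh, F.eval_of_lt g hh]
    exact hg ⟨h, hh⟩ x a b
  · rw [F.eval_of_le g (not_lt.1 hh), F.eval_of_le g₀ (not_lt.1 hh)]
    simpa using hε

theorem abs_pairValue_sub_le {f₀ g₀ g : F.Elem} {ε : ℝ} (hε : 0 ≤ ε)
    (hfix : IsBackupFixed σ f₀ g₀) (hg : g ∈ nearBackup σ f₀ g₀ ε) (h : ℕ) (x : X) :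
    |pairValue σ F f₀ g h x - pairValue σ F f₀ g₀ h x| ≤ ε := by
  have hd := abs_eval_sub_le σ hε hfix hg h x
  have h1 := minAgainst_le_add (M := F.eval g h x) (N := F.eval g₀ h x) (c := ε) ((mainPolicy σ F f₀).prob_mem h x)
    fun a b => by linarith [(abs_le.1 (hd a b)).2]
  have h2 := minAgainst_le_add (M := F.eval g₀ h x) (N := F.eval g h x) (c := ε) ((mainPolicy σ F f₀).prob_mem h x)
    fun a b => by linarith [(abs_le.1 (hd a b)).1]
  unfold pairValue
  exact abs_le.2 ⟨by linarith, by linarith⟩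

/-- Here the policy moves together with `f`; each direction follows by testing the max-min value
with the maximizer of the other function. -/
theorem abs_pairValue_self_sub_le {f₀ f : F.Elem} {ε : ℝ} (hε : 0 ≤ ε)
    (hfix : IsBackupFixed σ f₀ f₀) (hf : f ∈ nearBackup σ f₀ f₀ ε) (h : ℕ) (x : X) :
    |pairValue σ F f f h x - pairValue σ F f₀ f₀ h x| ≤ ε := by
  have hd := abs_eval_sub_le σ hε hfix hf h x
  have h1 := minAgainst_le_add (M := F.eval f h x) (N := F.eval f₀ h x) (c := ε) ((mainPolicy σ F f).prob_mem h x)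
    fun a b => by linarith [(abs_le.1 (hd a b)).2]
  have h2 := minAgainst_le_add (M := F.eval f₀ h x) (N := F.eval f h x) (c := ε) ((mainPolicy σ F f₀).prob_mem h x)
    fun a b => by linarith [(abs_le.1 (hd a b)).1]
  have h3 := pairValue_le_self σ F f₀ f h x
  have h4 := pairValue_le_self σ F f f₀ h x
  unfold pairValue at *
  exact abs_le.2 ⟨by linarith, by linarith⟩

/-- One `ε` comes from `g^h` itself, the other from the value at step `h + 1` inside its backup. -/
theorem abs_excess_le_of_near {β : ℝ} (hF : BoundedBy F β) (hβ : 1 ≤ β) {f₀ g₀ f g : F.Elem}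
    {ε : ℝ} (hε : 0 ≤ ε) (hfix : IsBackupFixed σ f₀ g₀) (hg : g ∈ nearBackup σ f₀ g₀ ε)
    (hv : ∀ h x, |pairValue σ F f g h x - pairValue σ F f₀ g₀ h x| ≤ ε) {h : ℕ} (hh : h < G.H)
    (x : X) (a : A) (b : B) : |excess G σ F g f g h x a b| ≤ 2 * ε := by
  have h1 := abs_le.1 (abs_eval_sub_le σ hε hfix hg h x a b)
  have h2 := backup_le_add hF hβ (fun y => show pairValue σ F f g (h + 1) y ≤
    pairValue σ F f₀ g₀ (h + 1) y + ε by linarith [(abs_le.1 (hv (h + 1) y)).2]) x a b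
  have h3 := backup_le_add hF hβ (fun y => show pairValue σ F f₀ g₀ (h + 1) y ≤
    pairValue σ F f g (h + 1) y + ε by linarith [(abs_le.1 (hv (h + 1) y)).1]) x a b
  rw [hfix.eval_eq hh] at h1
  rw [excess, abs_le]
  constructor <;> linarith [h1.1, h1.2]

theorem abs_excess_le_of_mem_nearBackup {f g θ : F.Elem} {ε : ℝ} (hθ : θ ∈ nearBackup σ f g ε)
    {h : ℕ} (hh : h < G.H) (x : X) (a : A) (b : B) : |excess G σ F θ f g h x a b| ≤ ε := by
  rw [excess, F.eval_of_lt θ hh]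
  exact hθ ⟨h, hh⟩ x a b

end Mass


/-! ### Measurable dependence of composed and pushed-forward laws on a parameter. -/

section General

variable {α β γ : Type*} [MeasurableSpace α] [MeasurableSpace β] [MeasurableSpace γ]

theorem measurable_bind_of_uncurry {K : α → Measure β} (hK : Measurable K)
    (hKp : ∀ a, IsProbabilityMeasure (K a)) {L : α → β → Measure γ}
    (hL : Measurable fun p : α × β => L p.1 p.2) : Measurable fun a => (K a).bind (L a) := by
  let κ : Kernel α β := ⟨K, hK⟩
  have : IsMarkovKernel κ := ⟨hKp⟩
  refine Measure.measurable_of_measurable_coe _ fun s hs => ?_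
  have e : ∀ a, ((K a).bind (L a)) s = ∫⁻ b, L a b s ∂(κ a) := fun a =>
    Measure.bind_apply hs (hL.comp measurable_prodMk_left).aemeasurable
  simp only [e]
  exact Measurable.lintegral_kernel_prod_right (f := fun a b => L a b s)
    ((Measure.measurable_coe hs).comp hL)

theorem measurable_map_of_uncurry {K : α → Measure β} (hK : Measurable K)
    (hKp : ∀ a, IsProbabilityMeasure (K a)) {U : α → β → γ}
    (hU : Measurable fun p : α × β => U p.1 p.2) : Measurable fun a => (K a).map (U a) := by
  let κ : Kernel α β := ⟨K, hK⟩
  have : IsMarkovKernel κ := ⟨hKp⟩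
  refine Measure.measurable_of_measurable_coe _ fun s hs => ?_
  have e : ∀ a, ((K a).map (U a)) s = κ a (Prod.mk a ⁻¹' {p : α × β | U p.1 p.2 ∈ s}) := fun a =>
    Measure.map_apply (hU.comp measurable_prodMk_left) hs
  simp only [e]
  exact Kernel.measurable_kernel_prodMk_left (hU hs)

end General

section Learning

variable {X : Type u} {A : Type v} {B : Type w} [MeasurableSpace X]
  [Fintype A] [MeasurableSpace A] [DiscreteMeasurableSpace A]
  [Fintype B] [Nonempty B] [MeasurableSpace B] [DiscreteMeasurableSpace B]
  (G : MarkovGame X A B) (σ : TieBreak X A B) (F : FunctionClass.{u, v, w, z} X A B G.H)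

/-! ### The episode law as a function of the drawn pair -/

/-- The law of an episode played with `(μ_f, ν_{f,g})`. -/
abbrev pairLaw (f g : F.Elem) : Measure (Trajectory X A B G.H) :=
  episodeLaw G (mainPolicy σ F f) (boosterPolicy σ F f g)

theorem measurable_pairLaw : Measurable fun q : F.Elem × F.Elem => pairLaw G σ F q.1 q.2 := by
  have := (measurable_rollout_and_prob G (Λ := F.Elem × F.Elem)
    (μ := fun q => mainPolicy σ F q.1) (ν := fun q => boosterPolicy σ F q.1 q.2)
    (fun h a => (measurable_pi_apply a).comp ((measurable_mainPolicy σ F h).comp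
      (by fun_prop : Measurable fun p : (F.Elem × F.Elem) × X => (p.1.1, p.2))))
    (fun h b => (measurable_pi_apply b).comp ((measurable_boosterPolicy σ F h).comp
      (by fun_prop : Measurable fun p : (F.Elem × F.Elem) × X => (p.1.1, p.1.2, p.2))))
    G.H 0).1
  exact this.comp (by fun_prop : Measurable fun q : F.Elem × F.Elem => (q, G.x₁))

/-- `pairLaw` as a kernel. -/
def pairKernel : Kernel (F.Elem × F.Elem) (Trajectory X A B G.H) :=
  ⟨fun q => pairLaw G σ F q.1 q.2, measurable_pairLaw G σ F⟩

instance : IsMarkovKernel (pairKernel G σ F) :=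
  ⟨fun q => inferInstanceAs (IsProbabilityMeasure (pairLaw G σ F q.1 q.2))⟩

variable {F} in
theorem BddMeas.integral_pairLaw {Ω : Type*} [MeasurableSpace Ω]
    {Φ : Ω → Trajectory X A B G.H → ℝ}
    (hΦ : BddMeas fun p : Ω × Trajectory X A B G.H => Φ p.1 p.2) {f g : Ω → F.Elem}
    (hf : Measurable f) (hg : Measurable g) :
    BddMeas fun ω => ∫ ζ, Φ ω ζ ∂(pairLaw G σ F (f ω) (g ω)) :=
  hΦ.integral_kernel ((pairKernel G σ F).comap (fun ω => (f ω, g ω)) (hf.prodMk hg))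

/-- The expected squared excess of `θ^h` over `T_h^{μ_f} g` when `(μ_{f'}, ν_{f',g'})` is
played. -/
def sqExcess (f' g' : F.Elem) (h : Fin G.H) (θ f g : F.Elem) : ℝ :=
  stepExpect G (mainPolicy σ F f') (boosterPolicy σ F f' g') h
    (fun x a b => excess G σ F θ f g h x a b ^ 2)

variable {t : ℕ}

/-- The excess loss at step `h`, cumulated over the data. -/
def stepLoss (S : History G t) (h : Fin G.H) (θ f g : F.Elem) : ℝ :=
  ∑ s, lossDiff G σ F θ f g h (S s h)

/-- The excess loss, cumulated over the steps and the data. -/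
def cumLoss (S : History G t) (θ f g : F.Elem) : ℝ := ∑ h, stepLoss G σ F S h θ f g

/-- The logarithm of the normalizing factors of the posteriors. -/
def logNorm (η : ℝ) (S : History G t) (f g : F.Elem) : ℝ :=
  Real.log (∫ θ, Real.exp (-η * cumLoss G σ F S θ f g) ∂F.prodPrior)

/-- The exponent of the posteriors. -/
def postExp (η c : ℝ) (S : History G t) (f g : F.Elem) : ℝ :=
  c * pairValue σ F f g 0 G.x₁ - η * cumLoss G σ F S g f g - logNorm G σ F η S f g

section Posterior

variable {G F} {β : ℝ} (hF : BoundedBy F β) (hβ : 1 ≤ β)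
include hF hβ

theorem bddMeas_sqExcess (h : Fin G.H) : BddMeas
    fun p : (F.Elem × F.Elem) × (F.Elem × F.Elem × F.Elem) =>
      sqExcess G σ F p.1.1 p.1.2 h p.2.1 p.2.2.1 p.2.2.2 := by
  refine BddMeas.integral_pairLaw G σ
    (Φ := fun (p : (F.Elem × F.Elem) × (F.Elem × F.Elem × F.Elem)) ζ =>
      excess G σ F p.2.1 p.2.2.1 p.2.2.2 h (ζ h).1 (ζ h).2.1 (ζ h).2.2.1 ^ 2)
    (f := fun p => p.1.1) (g := fun p => p.1.2) ?_ (by fun_prop) (by fun_prop)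
  refine ((bddMeas_excess σ hF hβ h).comp (φ := fun p : ((F.Elem × F.Elem) ×
    (F.Elem × F.Elem × F.Elem)) × Trajectory X A B G.H =>
      (p.1.2, (p.2 h).1, (p.2 h).2.1, (p.2 h).2.2.1)) ?_).pow 2
  have : Measurable fun ζ : Trajectory X A B G.H => ζ h := measurable_pi_apply h
  have h2 : Measurable fun p : ((F.Elem × F.Elem) ×
    (F.Elem × F.Elem × F.Elem)) × Trajectory X A B G.H => p.2 h := this.comp measurable_snd
  fun_prop

theorem bddMeas_stepLoss (h : Fin G.H) : BddMeas
    fun p : History G t × (F.Elem × F.Elem × F.Elem) =>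
      stepLoss G σ F p.1 h p.2.1 p.2.2.1 p.2.2.2 := by
  refine BddMeas.sum fun s _ => (bddMeas_lossDiff σ hF hβ h).comp
    (φ := fun p : History G t × (F.Elem × F.Elem × F.Elem) => (p.2, p.1 s h)) ?_
  have : Measurable fun S : History G t => S s h :=
    (measurable_pi_apply h).comp (measurable_pi_apply s)
  exact measurable_snd.prodMk (this.comp measurable_fst)

theorem bddMeas_cumLoss : BddMeas fun p : History G t × (F.Elem × F.Elem × F.Elem) =>
    cumLoss G σ F p.1 p.2.1 p.2.2.1 p.2.2.2 :=
  BddMeas.sum fun h _ => bddMeas_stepLoss σ hF hβ h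

theorem bddMeas_logNorm (η : ℝ) : BddMeas fun p : History G t × (F.Elem × F.Elem) =>
    logNorm G σ F η p.1 p.2.1 p.2.2 :=
  BddMeas.log_integral_exp
    (f := fun (p : History G t × (F.Elem × F.Elem)) θ => -η * cumLoss G σ F p.1 θ p.2.1 p.2.2)
    (((bddMeas_cumLoss σ hF hβ).comp
      (φ := fun p : (History G t × (F.Elem × F.Elem)) × F.Elem => (p.1.1, p.2, p.1.2))
      (by fun_prop)).const_mul _) _

theorem bddMeas_startValue : BddMeas fun q : F.Elem × F.Elem => pairValue σ F q.1 q.2 0 G.x₁ :=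
  (bddMeas_pairValue σ hF hβ 0).comp (φ := fun q : F.Elem × F.Elem => (q.1, q.2, G.x₁))
    (by fun_prop)

theorem bddMeas_postExp (η c : ℝ) : BddMeas fun p : History G t × (F.Elem × F.Elem) =>
    postExp G σ F η c p.1 p.2.1 p.2.2 :=
  (((bddMeas_startValue σ hF hβ).comp measurable_snd).const_mul c).sub
    (((bddMeas_cumLoss σ hF hβ).comp (φ := fun p : History G t × (F.Elem × F.Elem) =>
      (p.1, p.2.2, p.2)) (by fun_prop)).const_mul η) |>.sub (bddMeas_logNorm σ hF hβ η)

/-- Replacing losses by excess losses shifts both the exponent and the log-normalizer by the same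
`θ`-free noise terms `b h`. -/
theorem posterior_exponent_eq (η : ℝ) (S : History G t) (f g : F.Elem)
    {V : ℕ → X → (A → B → ℝ) → ℝ} (hV : ∀ h x, V h x (F.eval g h x) = pairValue σ F f g h x) :
    ∑ h, (-η * loss G F V S h (g h) g -
        Real.log (∫ θ, Real.exp (-η * loss G F V S h θ g) ∂(F.prior h))) =
      -η * cumLoss G σ F S g f g - logNorm G σ F η S f g := by
  obtain ⟨b, hb⟩ : ∃ b : Fin G.H → ℝ, ∀ (θ : F.Elem) h, loss G F V S h (θ h) g =
      stepLoss G σ F S h θ f g + b h := by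
    refine ⟨fun h => ∑ s, (∫ x', pairValue σ F f g (h + 1) x'
        ∂(G.P h ((S s h).1, (S s h).2.1, (S s h).2.2.1)) -
      pairValue σ F f g (h + 1) (S s h).2.2.2) ^ 2, fun θ h => ?_⟩
    rw [loss, stepLoss, ← Finset.sum_add_distrib]
    refine Finset.sum_congr rfl fun s _ => ?_
    rw [hV, sq_loss_eq]
  -- With `f` and `g` held fixed, the integrand at step `h` depends on `θ` only through `θ^h`, so
  -- the product of normalizers is one integral over the product prior.
  have hprod : ∏ h, ∫ θ, Real.exp (-η * loss G F V S h θ g) ∂(F.prior h) =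
      Real.exp (-η * ∑ h, b h) * ∫ θ, Real.exp (-η * cumLoss G σ F S θ f g) ∂F.prodPrior := by
    rw [← integral_fintype_prod_eq_prod (μ := F.prior)
      (f := fun h θ => Real.exp (-η * loss G F V S h θ g)), ← integral_const_mul]
    refine integral_congr_ae (Filter.Eventually.of_forall fun θ => ?_)
    simp only [← Real.exp_sum, ← Real.exp_add, hb]
    rw [cumLoss, ← Finset.mul_sum, Finset.sum_add_distrib]
    ring_nf
  have hpos : 0 < ∫ θ, Real.exp (-η * cumLoss G σ F S θ f g) ∂F.prodPrior :=
    integral_exp_pos' (((bddMeas_cumLoss σ hF hβ).comp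
      (φ := fun θ => (S, θ, f, g)) (by fun_prop)).const_mul (-η)) _
  have hne : ∏ h, ∫ θ, Real.exp (-η * loss G F V S h θ g) ∂(F.prior h) ≠ 0 := by
    rw [hprod]
    positivity
  rw [Finset.sum_sub_distrib, ← Real.log_prod fun h _ =>
    (Finset.prod_ne_zero_iff.1 hne) h (Finset.mem_univ h), hprod,
    Real.log_mul (Real.exp_pos _).ne' hpos.ne', Real.log_exp, logNorm, cumLoss, ← Finset.mul_sum]
  simp only [hb, Finset.sum_add_distrib]
  ring

theorem mainPosterior_eq (η lam : ℝ) (S : History G t) :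
    mainPosterior G F η lam S = F.prodPrior.tilted fun f => postExp G σ F η lam S f f := by
  unfold mainPosterior posterior
  congr 1
  funext f
  rw [posterior_exponent_eq σ hF hβ η S f f fun h x => pairValue_eq_maxMin σ F f h x, postExp,
    ← pairValue_eq_maxMin σ F f 0 G.x₁]
  ring

theorem boosterPosterior_eq (η lam : ℝ) (S : History G t) (f : F.Elem) :
    boosterPosterior G F η lam (mainPolicy σ F f) S =
      F.prodPrior.tilted (postExp G σ F η (-lam) S f) := by
  unfold boosterPosterior posterior
  congr 1
  funext g
  rw [posterior_exponent_eq σ hF hβ η S f g fun h x => rfl, postExp, pairValue]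
  ring

end Posterior

/-! ### One episode of the algorithm -/

section Step

variable (η lam : ℝ) {α γ : Type*} [MeasurableSpace α] [MeasurableSpace γ]

/-- Draw `f` and `g` from the posteriors for the data `S a`, play an episode, and record
`U a f g ζ`. -/
def playStep (S : α → History G t) (U : α → F.Elem → F.Elem → Trajectory X A B G.H → γ) (a : α) :
    Measure γ :=
  (mainPosterior G F η lam (S a)).bind fun f =>
    (boosterPosterior G F η lam (mainPolicy σ F f) (S a)).bind fun g =>
      (pairLaw G σ F f g).map (U a f g)

variable {G F η lam} {β : ℝ} (hF : BoundedBy F β) (hβ : 1 ≤ β) {S : α → History G t}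
  (hS : Measurable S) {U : α → F.Elem → F.Elem → Trajectory X A B G.H → γ}
  (hU : Measurable fun p : α × F.Elem × F.Elem × Trajectory X A B G.H =>
    U p.1 p.2.1 p.2.2.1 p.2.2.2)
include σ hF hβ

theorem bddMeas_mainExp : BddMeas fun p : History G t × F.Elem =>
    postExp G σ F η lam p.1 p.2 p.2 :=
  (bddMeas_postExp σ hF hβ η lam).comp (φ := fun p : History G t × F.Elem => (p.1, p.2, p.2))
    (by fun_prop)

theorem isProb_main (S : History G t) : IsProbabilityMeasure (mainPosterior G F η lam S) := by
  rw [mainPosterior_eq σ hF hβ]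
  exact BddMeas.isProbabilityMeasure_tilted
    ((bddMeas_mainExp σ hF hβ).comp (φ := fun f => (S, f)) (by fun_prop)) _

theorem isProb_booster (S : History G t) (f : F.Elem) :
    IsProbabilityMeasure (boosterPosterior G F η lam (mainPolicy σ F f) S) := by
  rw [boosterPosterior_eq σ hF hβ]
  exact BddMeas.isProbabilityMeasure_tilted
    ((bddMeas_postExp σ hF hβ η (-lam)).comp (φ := fun g => (S, f, g)) (by fun_prop)) _

include hS

theorem measurable_main : Measurable fun a => mainPosterior G F η lam (S a) := by
  simp only [mainPosterior_eq σ hF hβ]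
  have h1 := BddMeas.measurable_tilted (u := fun (S : History G t) f => postExp G σ F η lam S f f)
    (bddMeas_mainExp σ hF hβ) F.prodPrior
  have h2 := h1.comp hS
  exact h2

theorem measurable_booster : Measurable fun p : α × F.Elem =>
    boosterPosterior G F η lam (mainPolicy σ F p.2) (S p.1) := by
  simp only [boosterPosterior_eq σ hF hβ]
  have h1 := BddMeas.measurable_tilted
    (u := fun (q : History G t × F.Elem) g => postExp G σ F η (-lam) q.1 q.2 g)
    ((bddMeas_postExp σ hF hβ η (-lam)).comp
      (φ := fun p : (History G t × F.Elem) × F.Elem => (p.1.1, p.1.2, p.2)) (by fun_prop))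
    F.prodPrior
  have h2 := h1.comp ((hS.comp measurable_fst).prodMk measurable_snd)
  exact h2

include hU

theorem measurable_playStep_last : Measurable fun p : (α × F.Elem) × F.Elem =>
    (pairLaw G σ F p.1.2 p.2).map (U p.1.1 p.1.2 p.2) := by
  refine measurable_map_of_uncurry (K := fun p : (α × F.Elem) × F.Elem => pairLaw G σ F p.1.2 p.2)
    ?_ (fun p => inferInstance) ?_
  · exact (measurable_pairLaw G σ F).comp
      (by fun_prop : Measurable fun p : (α × F.Elem) × F.Elem => (p.1.2, p.2))
  · exact hU.comp (by fun_prop : Measurable fun p : ((α × F.Elem) × F.Elem) ×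
      Trajectory X A B G.H => (p.1.1.1, p.1.1.2, p.1.2, p.2))

theorem isProb_playStep_last (a : α) (f g : F.Elem) :
    IsProbabilityMeasure ((pairLaw G σ F f g).map (U a f g)) :=
  Measure.isProbabilityMeasure_map (hU.comp
    (by fun_prop : Measurable fun ζ : Trajectory X A B G.H => (a, f, g, ζ))).aemeasurable

theorem measurable_playStep_booster : Measurable fun p : α × F.Elem =>
    (boosterPosterior G F η lam (mainPolicy σ F p.2) (S p.1)).bind fun g =>
      (pairLaw G σ F p.2 g).map (U p.1 p.2 g) :=
  measurable_bind_of_uncurry (measurable_booster σ hF hβ hS)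
    (fun p => isProb_booster σ hF hβ _ _) (measurable_playStep_last σ hF hβ hS hU)

theorem measurable_playStep : Measurable (playStep G σ F η lam S U) :=
  measurable_bind_of_uncurry (measurable_main σ hF hβ hS) (fun a => isProb_main σ hF hβ _)
    (measurable_playStep_booster σ hF hβ hS hU)

theorem measurable_playStep_booster_section (a : α) : Measurable fun f : F.Elem =>
    (boosterPosterior G F η lam (mainPolicy σ F f) (S a)).bind fun g =>
      (pairLaw G σ F f g).map (U a f g) := by
  have h := (measurable_playStep_booster σ hF hβ hS hU (η := η) (lam := lam)).comp
    (by fun_prop : Measurable fun f : F.Elem => (a, f))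
  exact h

theorem measurable_playStep_last_section (a : α) (f : F.Elem) : Measurable fun g : F.Elem =>
    (pairLaw G σ F f g).map (U a f g) := by
  have h := (measurable_playStep_last σ hF hβ hS hU).comp
    (by fun_prop : Measurable fun g : F.Elem => ((a, f), g))
  exact h

theorem isProb_playStep_booster (a : α) (f : F.Elem) : IsProbabilityMeasure
    ((boosterPosterior G F η lam (mainPolicy σ F f) (S a)).bind fun g =>
      (pairLaw G σ F f g).map (U a f g)) := by
  have := isProb_booster σ hF hβ (η := η) (lam := lam) (S a) f
  exact isProbabilityMeasure_bind' _ (measurable_playStep_last_section σ hF hβ hS hU a f)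
    (fun g => isProb_playStep_last σ hF hβ hS hU a f g)

theorem isProb_playStep (a : α) : IsProbabilityMeasure (playStep G σ F η lam S U a) := by
  have := isProb_main σ hF hβ (η := η) (lam := lam) (S a)
  exact isProbabilityMeasure_bind' _ (measurable_playStep_booster_section σ hF hβ hS hU a)
    (fun f => isProb_playStep_booster σ hF hβ hS hU a f)

theorem integral_playStep {Φ : γ → ℝ} (hΦ : BddMeas Φ) (a : α) :
    ∫ y, Φ y ∂(playStep G σ F η lam S U a) =
      ∫ f, ∫ g, ∫ ζ, Φ (U a f g ζ) ∂(pairLaw G σ F f g)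
        ∂(F.prodPrior.tilted (postExp G σ F η (-lam) (S a) f))
        ∂(F.prodPrior.tilted fun f => postExp G σ F η lam (S a) f f) := by
  have := isProb_main σ hF hβ (η := η) (lam := lam) (S a)
  rw [playStep, hΦ.integral_bind _ (measurable_playStep_booster_section σ hF hβ hS hU a)
    (fun f => isProb_playStep_booster σ hF hβ hS hU a f), mainPosterior_eq σ hF hβ]
  refine integral_congr_ae (Filter.Eventually.of_forall fun f => ?_)
  have := isProb_booster σ hF hβ (η := η) (lam := lam) (S a) f
  simp only
  rw [hΦ.integral_bind _ (measurable_playStep_last_section σ hF hβ hS hU a f)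
    (fun g => isProb_playStep_last σ hF hβ hS hU a f g), boosterPosterior_eq σ hF hβ]
  refine integral_congr_ae (Filter.Eventually.of_forall fun g => ?_)
  exact integral_map (hU.comp (by fun_prop : Measurable
    fun ζ : Trajectory X A B G.H => (a, f, g, ζ))).aemeasurable hΦ.1.aestronglyMeasurable

end Step

end Learning


section Learning

variable {X : Type u} {A : Type v} {B : Type w} [MeasurableSpace X]
  [Fintype A] [MeasurableSpace A] [DiscreteMeasurableSpace A]
  [Fintype B] [Nonempty B] [MeasurableSpace B] [DiscreteMeasurableSpace B]
  (G : MarkovGame X A B) (σ : TieBreak X A B) (F : FunctionClass.{u, v, w, z} X A B G.H)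

/-! ### The law of a run of the algorithm -/

/-- The pair drawn in an episode, and the trajectory of the episode. -/
abbrev Record : Type (max u v w z) := (F.Elem × F.Elem) × Trajectory X A B G.H

variable {G F} in
/-- The data of the first `t` episodes of a run. -/
def pastData (t : ℕ) (e : ℕ → Record G F) : History G t := fun s => (e s).2

/-- The law of the run in which the algorithm determines the first `t` records, the others being
those of `e₀`. -/
def runLaw (η lam : ℝ) (e₀ : ℕ → Record G F) : ℕ → Measure (ℕ → Record G F)
  | 0 => Measure.dirac e₀
  | t + 1 => (runLaw η lam e₀ t).bind
      (playStep G σ F η lam (pastData t) fun e f g ζ => Function.update e t ((f, g), ζ))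

variable {G F}

theorem measurable_pastData (t : ℕ) : Measurable (pastData (G := G) (F := F) t) :=
  measurable_pi_lambda _ fun s => measurable_snd.comp (measurable_pi_apply (s : ℕ))

theorem measurable_update_record (t : ℕ) :
    Measurable fun p : (ℕ → Record G F) × F.Elem × F.Elem × Trajectory X A B G.H =>
      Function.update p.1 t ((p.2.1, p.2.2.1), p.2.2.2) := by
  refine measurable_pi_lambda _ fun s => ?_
  by_cases h : s = t
  · subst h
    simp only [Function.update_self]
    fun_prop
  · simp only [Function.update_of_ne h]
    exact (measurable_pi_apply s).comp measurable_fst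

theorem measurable_snoc (t : ℕ) :
    Measurable fun p : History G t × F.Elem × F.Elem × Trajectory X A B G.H =>
      (Fin.snoc (α := fun _ => Trajectory X A B G.H) p.1 p.2.2.2 : History G (t + 1)) := by
  refine measurable_pi_lambda _ fun s => ?_
  refine Fin.lastCases ?_ (fun s => ?_) s
  · simp only [Fin.snoc_last]
    fun_prop
  · simp only [Fin.snoc_castSucc]
    exact (measurable_pi_apply s).comp measurable_fst

theorem pastData_update (t : ℕ) (e : ℕ → Record G F) (r : Record G F) :
    pastData (t + 1) (Function.update e t r) =
      Fin.snoc (α := fun _ => Trajectory X A B G.H) (pastData t e) r.2 := by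
  funext s
  refine Fin.lastCases ?_ (fun s => ?_) s
  · simp [pastData]
  · simp [pastData, Function.update_of_ne s.2.ne]

variable {η lam β : ℝ} (hF : BoundedBy F β) (hβ : 1 ≤ β) (e₀ : ℕ → Record G F)
include hF hβ

theorem isProb_runLaw (t : ℕ) : IsProbabilityMeasure (runLaw G σ F η lam e₀ t) := by
  induction t with
  | zero => exact Measure.dirac.isProbabilityMeasure
  | succ t ih =>
    exact isProbabilityMeasure_bind' _
      (measurable_playStep σ hF hβ (measurable_pastData t) (measurable_update_record t))
      (isProb_playStep σ hF hβ (measurable_pastData t) (measurable_update_record t))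

theorem integral_runLaw_succ {Ψ : (ℕ → Record G F) → ℝ} (hΨ : BddMeas Ψ) (t : ℕ) :
    ∫ e, Ψ e ∂(runLaw G σ F η lam e₀ (t + 1)) =
      ∫ e, ∫ f, ∫ g, ∫ ζ, Ψ (Function.update e t ((f, g), ζ)) ∂(pairLaw G σ F f g)
        ∂(F.prodPrior.tilted (postExp G σ F η (-lam) (pastData t e) f))
        ∂(F.prodPrior.tilted fun f => postExp G σ F η lam (pastData t e) f f)
        ∂(runLaw G σ F η lam e₀ t) := by
  have := isProb_runLaw σ hF hβ (η := η) (lam := lam) e₀ t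
  rw [runLaw, hΨ.integral_bind _
    (measurable_playStep σ hF hβ (measurable_pastData t) (measurable_update_record t))
    (isProb_playStep σ hF hβ (measurable_pastData t) (measurable_update_record t))]
  exact integral_congr_ae (Filter.Eventually.of_forall fun e =>
    integral_playStep σ hF hβ (measurable_pastData t) (measurable_update_record t) hΨ e)

theorem isProb_mainTilted {t : ℕ} (S : History G t) :
    IsProbabilityMeasure (F.prodPrior.tilted fun f => postExp G σ F η lam S f f) :=
  mainPosterior_eq σ hF hβ η lam S ▸ isProb_main σ hF hβ S

theorem isProb_boosterTilted {t : ℕ} (S : History G t) (f : F.Elem) :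
    IsProbabilityMeasure (F.prodPrior.tilted (postExp G σ F η lam S f)) :=
  BddMeas.isProbabilityMeasure_tilted
    ((bddMeas_postExp σ hF hβ η lam).comp (φ := fun g => (S, f, g)) (by fun_prop)) _

theorem integral_runLaw_of_le {Ψ : (ℕ → Record G F) → ℝ} (hΨ : BddMeas Ψ) {t T : ℕ}
    (hloc : ∀ e s r, t ≤ s → Ψ (Function.update e s r) = Ψ e) (hT : t ≤ T) :
    ∫ e, Ψ e ∂(runLaw G σ F η lam e₀ T) = ∫ e, Ψ e ∂(runLaw G σ F η lam e₀ t) := by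
  induction T, hT using Nat.le_induction with
  | base => rfl
  | succ T hT ih =>
    rw [integral_runLaw_succ σ hF hβ e₀ hΨ, ← ih]
    refine integral_congr_ae (Filter.Eventually.of_forall fun e => ?_)
    have h1 := isProb_mainTilted σ hF hβ (η := η) (lam := lam) (pastData T e)
    have h2 := isProb_boosterTilted σ hF hβ (η := η) (lam := -lam) (pastData T e)
    simp only [hloc _ _ _ hT, integral_const, probReal_univ, one_smul]

theorem isProb_historyLaw (t : ℕ) : IsProbabilityMeasure (historyLaw G σ F η lam t) := by
  induction t with
  | zero => exact Measure.dirac.isProbabilityMeasure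
  | succ t ih =>
    exact isProbabilityMeasure_bind' _
      (measurable_playStep σ hF hβ measurable_id (measurable_snoc t))
      (isProb_playStep σ hF hβ measurable_id (measurable_snoc t))

/-- The run also remembers the drawn pairs, on which decoupling is applied. The posteriors see only
trajectories, so forgetting the pairs recovers the law of the data. -/
theorem integral_historyLaw (t : ℕ) {Φ : History G t → ℝ} (hΦ : BddMeas Φ) :
    ∫ S, Φ S ∂(historyLaw G σ F η lam t) =
      ∫ e, Φ (pastData t e) ∂(runLaw G σ F η lam e₀ t) := by
  induction t with
  | zero =>
    rw [historyLaw, runLaw, integral_dirac' _ _ hΦ.1.stronglyMeasurable,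
      integral_dirac' (fun e => Φ (pastData 0 e)) _
        (hΦ.comp (measurable_pastData 0)).1.stronglyMeasurable]
    exact congrArg Φ (Subsingleton.elim _ _)
  | succ t ih =>
    have hM := measurable_playStep σ hF hβ (η := η) (lam := lam) (F := F)
      (S := fun S : History G t => S) (U := fun S _ _ ζ =>
        Fin.snoc (α := fun _ => Trajectory X A B G.H) S ζ) measurable_id (measurable_snoc t)
    have hP := isProb_playStep σ hF hβ (η := η) (lam := lam) (F := F)
      (S := fun S : History G t => S) (U := fun S _ _ ζ =>
        Fin.snoc (α := fun _ => Trajectory X A B G.H) S ζ) measurable_id (measurable_snoc t)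
    have := isProb_historyLaw σ hF hβ (η := η) (lam := lam) t
    let κ : Kernel (History G t) (History G (t + 1)) := ⟨_, hM⟩
    have : IsMarkovKernel κ := ⟨hP⟩
    have hb : BddMeas fun S : History G t => ∫ y, Φ y ∂(κ S) :=
      BddMeas.integral_kernel (f := fun _ y => Φ y) (hΦ.comp measurable_snd) κ
    have e1 : ∫ S, Φ S ∂(historyLaw G σ F η lam (t + 1)) =
        ∫ S, ∫ y, Φ y ∂(κ S) ∂(historyLaw G σ F η lam t) :=
      hΦ.integral_bind _ hM hP
    rw [e1, ih hb, integral_runLaw_succ σ hF hβ e₀ (hΦ.comp (measurable_pastData _))]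
    refine integral_congr_ae (Filter.Eventually.of_forall fun e => ?_)
    simp only [pastData_update]
    exact integral_playStep σ hF hβ (S := fun S : History G t => S) (U := fun S _ _ ζ =>
      Fin.snoc (α := fun _ => Trajectory X A B G.H) S ζ) measurable_id (measurable_snoc t) hΦ _

/-- Given the past, the next factor has mean at most `M` whichever pair is drawn, so the adaptive
choice of policies costs nothing. -/
theorem integral_exp_sum_runLaw_le {Y : Record G F → ℝ} (hY : BddMeas Y) {M : ℝ}
    (h : ∀ f g, ∫ ζ, Real.exp (Y ((f, g), ζ)) ∂(pairLaw G σ F f g) ≤ M) (t : ℕ) :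
    ∫ e, Real.exp (∑ s ∈ Finset.range t, Y (e s)) ∂(runLaw G σ F η lam e₀ t) ≤ M ^ t := by
  have hsum (t : ℕ) : BddMeas fun e : ℕ → Record G F => ∑ s ∈ Finset.range t, Y (e s) :=
    BddMeas.sum fun s _ => hY.comp (measurable_pi_apply s)
  have hM : 0 ≤ M := by
    refine (integral_nonneg fun ζ => ?_).trans (h (e₀ 0).1.1 (e₀ 0).1.2)
    exact (Real.exp_pos _).le
  induction t with
  | zero => simp [runLaw]
  | succ t ih =>
    have := isProb_runLaw σ hF hβ (η := η) (lam := lam) e₀ t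
    rw [integral_runLaw_succ σ hF hβ e₀ (hsum _).exp, pow_succ']
    refine le_trans ?_ (mul_le_mul_of_nonneg_left ih hM)
    rw [← integral_const_mul]
    refine integral_mono_of_nonneg (Filter.Eventually.of_forall fun e => ?_)
      (((hsum t).exp.const_mul M).integrable _) (Filter.Eventually.of_forall fun e => ?_)
    · exact integral_nonneg fun f => integral_nonneg fun g => integral_nonneg fun ζ =>
        (Real.exp_pos _).le
    have h1 := isProb_mainTilted σ hF hβ (η := η) (lam := lam) (pastData t e)
    have h2 := isProb_boosterTilted σ hF hβ (η := η) (lam := -lam) (pastData t e)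
    have key (f g : F.Elem) : ∫ ζ, Real.exp (∑ s ∈ Finset.range (t + 1),
        Y (Function.update e t ((f, g), ζ) s)) ∂(pairLaw G σ F f g) ≤
        M * Real.exp (∑ s ∈ Finset.range t, Y (e s)) := by
      have e1 (ζ : Trajectory X A B G.H) : Real.exp (∑ s ∈ Finset.range (t + 1),
          Y (Function.update e t ((f, g), ζ) s)) =
          Real.exp (∑ s ∈ Finset.range t, Y (e s)) * Real.exp (Y ((f, g), ζ)) := by
        rw [← Real.exp_add, Finset.sum_range_succ, Function.update_self]
        congr 2
        refine Finset.sum_congr rfl fun s hs => ?_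
        rw [Function.update_of_ne (Finset.mem_range.1 hs).ne]
      simp only [e1]
      rw [integral_const_mul, mul_comm]
      exact mul_le_mul_of_nonneg_right (h f g) (Real.exp_pos _).le
    refine (integral_mono_of_nonneg (Filter.Eventually.of_forall fun f => integral_nonneg fun g =>
      integral_nonneg fun ζ => (Real.exp_pos _).le) (integrable_const
        (M * Real.exp (∑ s ∈ Finset.range t, Y (e s)))) (Filter.Eventually.of_forall fun f => ?_)).trans
      (by simp)
    exact (integral_mono_of_nonneg (Filter.Eventually.of_forall fun g => integral_nonneg fun ζ =>
      (Real.exp_pos _).le) (integrable_const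
        (M * Real.exp (∑ s ∈ Finset.range t, Y (e s)))) (Filter.Eventually.of_forall fun g =>
          key f g)).trans (by simp)

end Learning


/-! ### Jensen for powers of partition functions and for pairs of draws. -/

section General

variable {Ω Θ : Type*} [MeasurableSpace Ω] [MeasurableSpace Θ]

theorem pow_integral_exp_le {f : Θ → ℝ} (hf : BddMeas f) (μ : Measure Θ) [IsProbabilityMeasure μ]
    (n : ℕ) : (∫ θ, Real.exp (f θ) ∂μ) ^ n ≤ ∫ θ, Real.exp (n * f θ) ∂μ := by
  have h := (convexOn_pow n).map_integral_le (μ := μ) (f := fun θ => Real.exp (f θ))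
    (continuous_pow n).continuousOn isClosed_Ici
    (Filter.Eventually.of_forall fun θ => Set.mem_Ici.2 (Real.exp_pos _).le)
    (hf.exp.integrable μ) ((hf.exp.pow n).integrable μ)
  refine h.trans (le_of_eq (integral_congr_ae (Filter.Eventually.of_forall fun θ => ?_)))
  exact (Real.exp_nat_mul _ _).symm

theorem integral_log_integral_exp_pair_le {X : Ω → Θ → Θ → ℝ}
    (hX : BddMeas fun p : Ω × Θ × Θ => X p.1 p.2.1 p.2.2)
    (P : Measure Ω) [IsProbabilityMeasure P] (μ : Measure Θ) [IsProbabilityMeasure μ] {M : ℝ}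
    (h : ∀ f g, ∫ ω, Real.exp (X ω f g) ∂P ≤ M) :
    ∫ ω, Real.log (∫ f, ∫ g, Real.exp (X ω f g) ∂μ ∂μ) ∂P ≤ Real.log M := by
  have e (ω : Ω) : ∫ f, ∫ g, Real.exp (X ω f g) ∂μ ∂μ =
      ∫ q, Real.exp (X ω q.1 q.2) ∂(μ.prod μ) :=
    (integral_prod (fun q : Θ × Θ => Real.exp (X ω q.1 q.2))
      ((BddMeas.curry (f := fun ω (q : Θ × Θ) => X ω q.1 q.2) hX ω).exp.integrable _)).symm
  simp only [e]
  exact integral_log_integral_exp_le (X := fun ω (q : Θ × Θ) => X ω q.1 q.2) hX P _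
    fun q => h q.1 q.2

end General

section Learning

variable {X : Type u} {A : Type v} {B : Type w} [MeasurableSpace X]
  [Fintype A] [MeasurableSpace A] [DiscreteMeasurableSpace A]
  [Fintype B] [Nonempty B] [MeasurableSpace B] [DiscreteMeasurableSpace B]
  {G : MarkovGame X A B} (σ : TieBreak X A B) {F : FunctionClass.{u, v, w, z} X A B G.H}

/-! ### Exponential moments of the losses along a run -/

theorem stepLoss_pastData (t : ℕ) (e : ℕ → Record G F) (h : Fin G.H) (θ f g : F.Elem) :
    stepLoss G σ F (pastData t e) h θ f g =
      ∑ s ∈ Finset.range t, lossDiff G σ F θ f g h ((e s).2 h) :=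
  (Finset.sum_range fun s => lossDiff G σ F θ f g h ((e s).2 h)).symm

theorem cumLoss_pastData (t : ℕ) (e : ℕ → Record G F) (θ f g : F.Elem) :
    cumLoss G σ F (pastData t e) θ f g =
      ∑ s ∈ Finset.range t, ∑ h : Fin G.H, lossDiff G σ F θ f g h ((e s).2 h) := by
  rw [cumLoss, Finset.sum_comm]
  exact Finset.sum_congr rfl fun h _ => stepLoss_pastData σ t e h θ f g

/-- The squared excess at step `h`, cumulated over the first `t` episodes of a run. -/
def cumSqExcess (t : ℕ) (e : ℕ → Record G F) (h : Fin G.H) (θ f g : F.Elem) : ℝ :=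
  ∑ s ∈ Finset.range t, sqExcess G σ F (e s).1.1 (e s).1.2 h θ f g

variable {η lam β ε : ℝ} (hF : BoundedBy F β) (hβ : 1 ≤ β) (e₀ : ℕ → Record G F) {t : ℕ}
include hF hβ

theorem bddMeas_run_cumLoss : BddMeas fun p : (ℕ → Record G F) × (F.Elem × F.Elem × F.Elem) =>
    cumLoss G σ F (pastData t p.1) p.2.1 p.2.2.1 p.2.2.2 :=
  (bddMeas_cumLoss σ hF hβ).comp (φ := fun p : (ℕ → Record G F) × (F.Elem × F.Elem × F.Elem) =>
    (pastData t p.1, p.2)) (((measurable_pastData t).comp measurable_fst).prodMk measurable_snd)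

theorem bddMeas_run_stepLoss (h : Fin G.H) :
    BddMeas fun p : (ℕ → Record G F) × (F.Elem × F.Elem × F.Elem) =>
      stepLoss G σ F (pastData t p.1) h p.2.1 p.2.2.1 p.2.2.2 :=
  (bddMeas_stepLoss σ hF hβ h).comp
    (φ := fun p : (ℕ → Record G F) × (F.Elem × F.Elem × F.Elem) => (pastData t p.1, p.2))
    (((measurable_pastData t).comp measurable_fst).prodMk measurable_snd)

theorem bddMeas_run_logNorm (η : ℝ) : BddMeas fun p : (ℕ → Record G F) × (F.Elem × F.Elem) =>
    logNorm G σ F η (pastData t p.1) p.2.1 p.2.2 :=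
  (bddMeas_logNorm σ hF hβ η).comp (φ := fun p : (ℕ → Record G F) × (F.Elem × F.Elem) =>
    (pastData t p.1, p.2)) (((measurable_pastData t).comp measurable_fst).prodMk measurable_snd)

theorem bddMeas_run_postExp (η c : ℝ) : BddMeas fun p : (ℕ → Record G F) × (F.Elem × F.Elem) =>
    postExp G σ F η c (pastData t p.1) p.2.1 p.2.2 :=
  (bddMeas_postExp σ hF hβ η c).comp (φ := fun p : (ℕ → Record G F) × (F.Elem × F.Elem) =>
    (pastData t p.1, p.2)) (((measurable_pastData t).comp measurable_fst).prodMk measurable_snd)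

theorem bddMeas_cumSqExcess (h : Fin G.H) :
    BddMeas fun p : (ℕ → Record G F) × (F.Elem × F.Elem × F.Elem) =>
      cumSqExcess σ t p.1 h p.2.1 p.2.2.1 p.2.2.2 := by
  refine BddMeas.sum fun s _ => (bddMeas_sqExcess σ hF hβ h).comp
    (φ := fun p : (ℕ → Record G F) × (F.Elem × F.Elem × F.Elem) => ((p.1 s).1, p.2)) ?_
  exact (measurable_fst.comp ((measurable_pi_apply s).comp measurable_fst)).prodMk measurable_snd

theorem bddMeas_record_lossDiff (θ f g : F.Elem) (h : Fin G.H) :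
    BddMeas fun r : Record G F => lossDiff G σ F θ f g h (r.2 h) :=
  (bddMeas_lossDiff_record σ hF hβ θ f g h).comp (φ := fun r : Record G F => r.2 h)
    ((measurable_pi_apply h).comp measurable_snd)

theorem integral_exp_cumLoss_sub_le (θ f g : F.Elem) {δ : ℝ}
    (hδ : ∀ h < G.H, ∀ x a b, |excess G σ F g f g h x a b| ≤ 2 * δ) :
    ∫ e, Real.exp (3 / (2 * β ^ 2) * (cumLoss G σ F (pastData t e) g f g -
      cumLoss G σ F (pastData t e) θ f g)) ∂(runLaw G σ F η lam e₀ t) ≤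
      (Real.exp (24 * δ ^ 2 / β ^ 2) ^ G.H) ^ t := by
  have h := integral_exp_sum_runLaw_le σ hF hβ (η := η) (lam := lam) e₀
    (Y := fun r => ∑ h : Fin G.H, 3 / (2 * β ^ 2) *
      (lossDiff G σ F g f g h (r.2 h) - lossDiff G σ F θ f g h (r.2 h)))
    (BddMeas.sum fun h _ => ((bddMeas_record_lossDiff σ hF hβ g f g h).sub
      (bddMeas_record_lossDiff σ hF hβ θ f g h)).const_mul _)
    (fun f' g' => episode_exp_lossDiff_sub_le σ hF hβ _ _ θ f g hδ) t
  refine le_trans (le_of_eq ?_) h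
  simp only [cumLoss_pastData, ← Finset.mul_sum, Finset.sum_sub_distrib]

theorem integral_exp_cumLoss_le (θ f g : F.Elem) {δ : ℝ}
    (hδ : ∀ h < G.H, ∀ x a b, |excess G σ F θ f g h x a b| ≤ δ) :
    ∫ e, Real.exp (6 / β ^ 2 * cumLoss G σ F (pastData t e) θ f g)
      ∂(runLaw G σ F η lam e₀ t) ≤ (Real.exp (24 * δ ^ 2 / β ^ 2) ^ G.H) ^ t := by
  have h := integral_exp_sum_runLaw_le σ hF hβ (η := η) (lam := lam) e₀
    (Y := fun r => ∑ h : Fin G.H, 6 / β ^ 2 * lossDiff G σ F θ f g h (r.2 h))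
    (BddMeas.sum fun h _ => (bddMeas_record_lossDiff σ hF hβ θ f g h).const_mul _)
    (fun f' g' => episode_exp_lossDiff_le σ hF hβ _ _ θ f g hδ) t
  refine le_trans (le_of_eq ?_) h
  simp only [cumLoss_pastData, ← Finset.mul_sum]

/-- For fixed functions the compensated loss is an exponential supermartingale over the episodes:
the decay of each factor is offset by the expected squared excess of the pair just drawn. -/
theorem integral_exp_stepLoss_le (θ f g : F.Elem) (h : Fin G.H) :
    ∫ e, Real.exp (-(3 / (2 * β ^ 2)) * stepLoss G σ F (pastData t e) h θ f g +
      cumSqExcess σ t e h θ f g / (4 * β ^ 2)) ∂(runLaw G σ F η lam e₀ t) ≤ 1 := by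
  have h := integral_exp_sum_runLaw_le σ hF hβ (η := η) (lam := lam) e₀
    (Y := fun r => -(3 / (2 * β ^ 2)) * lossDiff G σ F θ f g h (r.2 h) +
      (4 * β ^ 2)⁻¹ * sqExcess G σ F r.1.1 r.1.2 h θ f g)
    (((bddMeas_record_lossDiff σ hF hβ θ f g h).const_mul _).add
      (((bddMeas_sqExcess σ hF hβ h).comp (φ := fun r : Record G F => (r.1, (θ, f, g)))
        (by fun_prop)).const_mul _)) (M := 1) (fun f' g' => ?_) t
  · rw [one_pow] at h
    refine le_trans (le_of_eq ?_) h
    simp only [stepLoss_pastData, cumSqExcess, Finset.sum_add_distrib, ← Finset.mul_sum,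
      inv_mul_eq_div, Finset.sum_div]
  · simp only [Real.exp_add]
    rw [integral_mul_const]
    refine (mul_le_mul_of_nonneg_right
      (episode_exp_neg_lossDiff_le σ hF hβ _ _ θ f g h) (Real.exp_pos _).le).trans ?_
    rw [← Real.exp_add, ← Real.exp_zero, Real.exp_le_exp, sqExcess]
    apply le_of_eq
    ring

/-! ### The free energies of the posteriors -/

variable (hη : η = 1 / (4 * β ^ 2))
include hη

/-- The normalizer cannot be small: functions near the backup have prior mass at least `exp (-κ)`
and almost no excess loss. The power `24` fits since `24 η = 6/β²`. -/
theorem integral_exp_neg_logNorm_le (hκ : kappa G σ F ε ≠ ⊤) (f g : F.Elem) :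
    ∫ e, Real.exp (24 * -logNorm G σ F η (pastData t e) f g) ∂(runLaw G σ F η lam e₀ t) ≤
      Real.exp (24 * (kappa G σ F ε).toReal) * (Real.exp (24 * ε ^ 2 / β ^ 2) ^ G.H) ^ t := by
  have := isProb_runLaw σ hF hβ (η := η) (lam := lam) e₀ t
  refine integral_exp_neg_log_le
    (y := fun e θ => -η * cumLoss G σ F (pastData t e) θ f g)
    (((bddMeas_run_cumLoss σ hF hβ).comp (φ := fun p : (ℕ → Record G F) × F.Elem =>
      (p.1, (p.2, f, g))) (by fun_prop)).const_mul _) _ _ (by norm_num)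
    (exp_neg_kappa_le σ hκ f g) fun θ hθ => ?_
  refine le_trans (le_of_eq ?_) (integral_exp_cumLoss_le σ hF hβ (η := η) (lam := lam) e₀ θ f g
    fun h hh => abs_excess_le_of_mem_nearBackup σ hθ hh)
  refine integral_congr_ae (Filter.Eventually.of_forall fun e => congrArg Real.exp ?_)
  simp only [hη]
  ring

/-- In the inverse sixth power of the posterior weight the normalizer stands in the numerator, so
Jensen for `x ^ 6` moves it inside the prior integral. What remains is the loss of `g` against that
of an arbitrary `θ`, at scale `6 η = 3/(2β²)`. -/
theorem integral_exp_neg_postExp_le (c : ℝ) (f g : F.Elem) {δ : ℝ}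
    (hδ : ∀ h < G.H, ∀ x a b, |excess G σ F g f g h x a b| ≤ 2 * δ) :
    ∫ e, Real.exp (-6 * postExp G σ F η c (pastData t e) f g) ∂(runLaw G σ F η lam e₀ t) ≤
      Real.exp (-6 * (c * pairValue σ F f g 0 G.x₁)) *
        (Real.exp (24 * δ ^ 2 / β ^ 2) ^ G.H) ^ t := by
  have := isProb_runLaw σ hF hβ (η := η) (lam := lam) e₀ t
  have hcum : BddMeas fun p : (ℕ → Record G F) × F.Elem =>
      cumLoss G σ F (pastData t p.1) p.2 f g :=
    (bddMeas_run_cumLoss σ hF hβ).comp (φ := fun p : (ℕ → Record G F) × F.Elem =>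
      (p.1, (p.2, f, g))) (by fun_prop)
  have hdiff : BddMeas fun p : (ℕ → Record G F) × F.Elem => 3 / (2 * β ^ 2) *
      (cumLoss G σ F (pastData t p.1) g f g - cumLoss G σ F (pastData t p.1) p.2 f g) :=
    (((hcum.comp (φ := fun p : (ℕ → Record G F) × F.Elem => (p.1, g)) (by fun_prop)).sub
      hcum).const_mul _)
  have hpw (e : ℕ → Record G F) : Real.exp (-6 * postExp G σ F η c (pastData t e) f g) ≤
      Real.exp (-6 * (c * pairValue σ F f g 0 G.x₁)) * ∫ θ, Real.exp (3 / (2 * β ^ 2) *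
        (cumLoss G σ F (pastData t e) g f g - cumLoss G σ F (pastData t e) θ f g))
          ∂F.prodPrior := by
    have hy : BddMeas fun θ => -η * cumLoss G σ F (pastData t e) θ f g :=
      (BddMeas.curry (f := fun e θ => cumLoss G σ F (pastData t e) θ f g) hcum e).const_mul _
    have hp := pow_integral_exp_le hy F.prodPrior 6
    have hpos := integral_exp_pos' hy F.prodPrior
    have e1 : Real.exp (-6 * postExp G σ F η c (pastData t e) f g) =
        Real.exp (-6 * (c * pairValue σ F f g 0 G.x₁)) *
          (Real.exp (6 * η * cumLoss G σ F (pastData t e) g f g) *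
            (∫ θ, Real.exp (-η * cumLoss G σ F (pastData t e) θ f g) ∂F.prodPrior) ^ 6) := by
      conv_rhs => rw [← Real.exp_log hpos, ← Real.exp_nat_mul, ← Real.exp_add, ← Real.exp_add]
      rw [postExp, logNorm]
      push_cast
      ring_nf
    rw [e1]
    refine mul_le_mul_of_nonneg_left ?_ (Real.exp_pos _).le
    refine (mul_le_mul_of_nonneg_left hp (Real.exp_pos _).le).trans (le_of_eq ?_)
    rw [← integral_const_mul]
    refine integral_congr_ae (Filter.Eventually.of_forall fun θ => ?_)
    simp only [← Real.exp_add, hη]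
    push_cast
    ring_nf
  have hin : BddMeas fun e => ∫ θ, Real.exp (3 / (2 * β ^ 2) *
      (cumLoss G σ F (pastData t e) g f g - cumLoss G σ F (pastData t e) θ f g)) ∂F.prodPrior :=
    BddMeas.integral (f := fun (e : ℕ → Record G F) θ => Real.exp (3 / (2 * β ^ 2) *
      (cumLoss G σ F (pastData t e) g f g - cumLoss G σ F (pastData t e) θ f g)))
      hdiff.exp F.prodPrior
  have hp : BddMeas fun e : ℕ → Record G F => postExp G σ F η c (pastData t e) f g :=
    (bddMeas_run_postExp σ hF hβ η c).comp
      (φ := fun e : ℕ → Record G F => (e, (f, g))) (by fun_prop)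
  refine (integral_mono ((hp.const_mul _).exp.integrable _) ((hin.const_mul _).integrable _)
    hpw).trans ?_
  rw [integral_const_mul]
  refine mul_le_mul_of_nonneg_left ?_ (Real.exp_pos _).le
  rw [integral_integral_swap (f := fun (e : ℕ → Record G F) θ => Real.exp (3 / (2 * β ^ 2) *
      (cumLoss G σ F (pastData t e) g f g - cumLoss G σ F (pastData t e) θ f g)))
    (hdiff.exp.integrable _)]
  refine (integral_mono_of_nonneg (Filter.Eventually.of_forall fun θ => integral_nonneg fun e =>
    (Real.exp_pos _).le) (integrable_const ((Real.exp (24 * δ ^ 2 / β ^ 2) ^ G.H) ^ t))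
    (Filter.Eventually.of_forall fun θ =>
      integral_exp_cumLoss_sub_le σ hF hβ (η := η) (lam := lam) e₀ θ f g hδ)).trans (by simp)

end Learning


theorem log_moment_bound (t H : ℕ) (x a : ℝ) :
    Real.log (Real.exp a * (Real.exp x ^ H) ^ t) = a + t * (H * x) := by
  rw [← Real.exp_nat_mul, ← Real.exp_nat_mul, ← Real.exp_add, Real.log_exp]

section Learning

variable {X : Type u} {A : Type v} {B : Type w} [MeasurableSpace X]
  [Fintype A] [MeasurableSpace A] [DiscreteMeasurableSpace A]
  [Fintype B] [Nonempty B] [MeasurableSpace B] [DiscreteMeasurableSpace B]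
  {G : MarkovGame X A B} (σ : TieBreak X A B) {F : FunctionClass.{u, v, w, z} X A B G.H}

/-! ### Means over one round -/

/-- The mean over the first `t` episodes and the main agent's next draw. -/
def mainMean (η lam : ℝ) (e₀ : ℕ → Record G F) (t : ℕ) (Y : (ℕ → Record G F) → F.Elem → ℝ) : ℝ :=
  ∫ e, ∫ f, Y e f ∂(F.prodPrior.tilted fun f => postExp G σ F η lam (pastData t e) f f)
    ∂(runLaw G σ F η lam e₀ t)

/-- The mean over the first `t` episodes and the next draws of both agents. -/
def pairMean (η lam : ℝ) (e₀ : ℕ → Record G F) (t : ℕ)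
    (Y : (ℕ → Record G F) → F.Elem → F.Elem → ℝ) : ℝ :=
  ∫ e, ∫ f, ∫ g, Y e f g ∂(F.prodPrior.tilted (postExp G σ F η (-lam) (pastData t e) f))
    ∂(F.prodPrior.tilted fun f => postExp G σ F η lam (pastData t e) f f)
    ∂(runLaw G σ F η lam e₀ t)

/-- The mean relative entropy of the main agent's posterior with respect to the prior. -/
def mainKL (η lam : ℝ) (e₀ : ℕ → Record G F) (t : ℕ) : ℝ :=
  ∫ e, tiltKL F.prodPrior (fun f => postExp G σ F η lam (pastData t e) f f)
    ∂(runLaw G σ F η lam e₀ t)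

/-- The mean relative entropy of the booster agent's posterior with respect to the prior. -/
def boosterKL (η lam : ℝ) (e₀ : ℕ → Record G F) (t : ℕ) : ℝ :=
  mainMean σ η lam e₀ t fun e f =>
    tiltKL F.prodPrior (postExp G σ F η (-lam) (pastData t e) f)

theorem mainMean_const_mul (η lam : ℝ) (e₀ : ℕ → Record G F) (t : ℕ) (c : ℝ)
    (Y : (ℕ → Record G F) → F.Elem → ℝ) :
    mainMean σ η lam e₀ t (fun e f => c * Y e f) = c * mainMean σ η lam e₀ t Y := by
  simp only [mainMean, integral_const_mul]

theorem pairMean_const_mul (η lam : ℝ) (e₀ : ℕ → Record G F) (t : ℕ) (c : ℝ)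
    (Y : (ℕ → Record G F) → F.Elem → F.Elem → ℝ) :
    pairMean σ η lam e₀ t (fun e f g => c * Y e f g) = c * pairMean σ η lam e₀ t Y := by
  simp only [pairMean, integral_const_mul]

variable {η lam β ε : ℝ} (hF : BoundedBy F β) (hβ : 1 ≤ β) (e₀ : ℕ → Record G F) {t : ℕ}
include hF hβ

theorem bddMeas_mainRunExp : BddMeas fun p : (ℕ → Record G F) × F.Elem =>
    postExp G σ F η lam (pastData t p.1) p.2 p.2 :=
  (bddMeas_run_postExp σ hF hβ η lam).comp
    (φ := fun p : (ℕ → Record G F) × F.Elem => (p.1, (p.2, p.2))) (by fun_prop)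

theorem mainMean_add {Y Z : (ℕ → Record G F) → F.Elem → ℝ}
    (hY : BddMeas fun p : (ℕ → Record G F) × F.Elem => Y p.1 p.2)
    (hZ : BddMeas fun p : (ℕ → Record G F) × F.Elem => Z p.1 p.2) :
    mainMean σ η lam e₀ t (fun e f => Y e f + Z e f) =
      mainMean σ η lam e₀ t Y + mainMean σ η lam e₀ t Z := by
  have := isProb_runLaw σ hF hβ (η := η) (lam := lam) e₀ t
  exact integral_integral_tilted_add (bddMeas_mainRunExp σ hF hβ) hY hZ _ _

theorem pairMean_add {Y Z : (ℕ → Record G F) → F.Elem → F.Elem → ℝ}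
    (hY : BddMeas fun p : (ℕ → Record G F) × (F.Elem × F.Elem) => Y p.1 p.2.1 p.2.2)
    (hZ : BddMeas fun p : (ℕ → Record G F) × (F.Elem × F.Elem) => Z p.1 p.2.1 p.2.2) :
    pairMean σ η lam e₀ t (fun e f g => Y e f g + Z e f g) =
      pairMean σ η lam e₀ t Y + pairMean σ η lam e₀ t Z := by
  have := isProb_runLaw σ hF hβ (η := η) (lam := lam) e₀ t
  exact integral_pair_tilted_add (bddMeas_mainRunExp σ hF hβ)
    (bddMeas_run_postExp σ hF hβ η (-lam)) hY hZ _ _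

theorem boosterKL_nonneg : 0 ≤ boosterKL σ η lam e₀ t := by
  refine integral_nonneg fun e => integral_nonneg fun f => ?_
  exact tiltKL_nonneg (BddMeas.comp (bddMeas_run_postExp σ hF hβ η (-lam))
    (φ := fun g => (e, (f, g))) (by fun_prop)) _

theorem bddMeas_mainFree : BddMeas fun e : ℕ → Record G F =>
    Real.log (∫ f, Real.exp (postExp G σ F η lam (pastData t e) f f) ∂F.prodPrior) :=
  BddMeas.log_integral_exp
    (f := fun (e : ℕ → Record G F) f => postExp G σ F η lam (pastData t e) f f)
    (bddMeas_mainRunExp σ hF hβ) _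

theorem bddMeas_boosterFree : BddMeas fun p : (ℕ → Record G F) × F.Elem =>
    Real.log (∫ g, Real.exp (postExp G σ F η (-lam) (pastData t p.1) p.2 g) ∂F.prodPrior) :=
  BddMeas.log_integral_exp_pair
    (X := fun (e : ℕ → Record G F) f g => postExp G σ F η (-lam) (pastData t e) f g)
    (bddMeas_run_postExp σ hF hβ η (-lam)) _

theorem mainKL_eq : mainKL σ η lam e₀ t =
    mainMean σ η lam e₀ t (fun e f => postExp G σ F η lam (pastData t e) f f) +
      ∫ e, -Real.log (∫ f, Real.exp (postExp G σ F η lam (pastData t e) f f) ∂F.prodPrior)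
        ∂(runLaw G σ F η lam e₀ t) := by
  have := isProb_runLaw σ hF hβ (η := η) (lam := lam) e₀ t
  have hA := bddMeas_mainRunExp σ hF hβ (η := η) (lam := lam) (t := t)
  rw [mainMean, ← integral_add ((BddMeas.integral_tilted
    (u := fun (e : ℕ → Record G F) f => postExp G σ F η lam (pastData t e) f f)
    (X := fun (e : ℕ → Record G F) f => postExp G σ F η lam (pastData t e) f f)
    hA hA _).integrable _) ((bddMeas_mainFree σ hF hβ).neg.integrable _)]
  rfl

theorem boosterKL_eq : boosterKL σ η lam e₀ t =
    pairMean σ η lam e₀ t (fun e f g => postExp G σ F η (-lam) (pastData t e) f g) +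
      mainMean σ η lam e₀ t fun e f =>
        -Real.log (∫ g, Real.exp (postExp G σ F η (-lam) (pastData t e) f g) ∂F.prodPrior) := by
  have hB := bddMeas_run_postExp σ hF hβ η (-lam) (t := t)
  exact mainMean_add σ hF hβ e₀ (Y := fun e f => ∫ g, postExp G σ F η (-lam) (pastData t e) f g
      ∂(F.prodPrior.tilted (postExp G σ F η (-lam) (pastData t e) f)))
    (BddMeas.integral_tilted_pair
      (u := fun (e : ℕ → Record G F) f g => postExp G σ F η (-lam) (pastData t e) f g)
      (X := fun (e : ℕ → Record G F) f g => postExp G σ F η (-lam) (pastData t e) f g) hB hB _)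
    (bddMeas_boosterFree σ hF hβ).neg

theorem bddMeas_run_startValue : BddMeas fun p : (ℕ → Record G F) × (F.Elem × F.Elem) =>
    pairValue σ F p.2.1 p.2.2 0 G.x₁ :=
  (bddMeas_startValue σ hF hβ).comp measurable_snd

theorem bddMeas_tripleLoss (a b : ℝ) (h : Fin G.H) :
    BddMeas fun p : (ℕ → Record G F) × (F.Elem × F.Elem × F.Elem) =>
      a * stepLoss G σ F (pastData t p.1) h p.2.1 p.2.2.1 p.2.2.2 +
        b * cumSqExcess σ t p.1 h p.2.1 p.2.2.1 p.2.2.2 :=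
  ((bddMeas_run_stepLoss σ hF hβ h).const_mul a).add
    ((bddMeas_cumSqExcess σ hF hβ h).const_mul b)

/-! ### The entropy inequalities for one round -/

variable (hη : η = 1 / (4 * β ^ 2))
include hη

/-- Since `6 η = 3/(2β²)` and `6/(24β²) = 1/(4β²)`, each step has exponential moment at most `1` at
scale `6`; with the two parities this costs `2/6` of the entropy. -/
theorem mainMean_loss_le :
    mainMean σ η lam e₀ t (fun e f => ∑ h, (-η * stepLoss G σ F (pastData t e) h f f f +
      (24 * β ^ 2)⁻¹ * cumSqExcess σ t e h f f f)) ≤ 1 / 3 * mainKL σ η lam e₀ t := by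
  have := isProb_runLaw σ hF hβ (η := η) (lam := lam) e₀ t
  have h := integral_tilted_sum_le (μ := F.prior) (P := runLaw G σ F η lam e₀ t)
    (u := fun e f => postExp G σ F η lam (pastData t e) f f)
    (X := fun e h f => -η * stepLoss G σ F (pastData t e) h f f f +
      (24 * β ^ 2)⁻¹ * cumSqExcess σ t e h f f f) (bddMeas_mainRunExp σ hF hβ)
    (fun h => (bddMeas_tripleLoss σ hF hβ (-η) (24 * β ^ 2)⁻¹ h).comp
      (φ := fun p : (ℕ → Record G F) × F.Elem => (p.1, (p.2, p.2, p.2))) (by fun_prop))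
    (fun e h f f' hff => ?_) (k := 6) (by norm_num) (fun h f => ?_)
  · refine h.trans (le_of_eq ?_)
    rw [mainKL]
    norm_num
    rfl
  · have h1 : ∀ hh : h.1 < G.H, f ⟨h, hh⟩ = f' ⟨h, hh⟩ := fun hh => hff _ (by simp [nextPair])
    have h2 : ∀ hh : h.1 + 1 < G.H, f ⟨h + 1, hh⟩ = f' ⟨h + 1, hh⟩ := fun hh =>
      hff _ (by simp [nextPair])
    simp only [stepLoss, cumSqExcess, sqExcess, lossDiff_congr G σ F h1 h2 h2,
      excess_congr G σ F h1 h2 h2]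
  · refine le_trans (le_of_eq ?_)
      (integral_exp_stepLoss_le σ hF hβ (η := η) (lam := lam) e₀ (t := t) f f f h)
    refine integral_congr_ae (Filter.Eventually.of_forall fun e => congrArg Real.exp ?_)
    simp only [hη]
    field_simp
    ring

theorem pairMean_loss_le :
    pairMean σ η lam e₀ t (fun e f g => ∑ h, (-η * stepLoss G σ F (pastData t e) h g f g +
      (24 * β ^ 2)⁻¹ * cumSqExcess σ t e h g f g)) ≤
      1 / 3 * (mainKL σ η lam e₀ t + boosterKL σ η lam e₀ t) := by
  have := isProb_runLaw σ hF hβ (η := η) (lam := lam) e₀ t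
  have h := integral_pair_tilted_sum_le (μ := F.prior) (P := runLaw G σ F η lam e₀ t)
    (uA := fun e f => postExp G σ F η lam (pastData t e) f f)
    (uB := fun e f g => postExp G σ F η (-lam) (pastData t e) f g)
    (X := fun e h f g => -η * stepLoss G σ F (pastData t e) h g f g +
      (24 * β ^ 2)⁻¹ * cumSqExcess σ t e h g f g) (bddMeas_mainRunExp σ hF hβ)
    (bddMeas_run_postExp σ hF hβ η (-lam))
    (fun h => (bddMeas_tripleLoss σ hF hβ (-η) (24 * β ^ 2)⁻¹ h).comp
      (φ := fun p : (ℕ → Record G F) × (F.Elem × F.Elem) => (p.1, (p.2.2, p.2.1, p.2.2)))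
      (by fun_prop))
    (fun e h f g g' hgg => ?_) (fun e h g f f' hff => ?_) (k := 6) (by norm_num)
    (fun h f g => ?_)
  · refine h.trans (le_of_eq ?_)
    rw [mainKL, boosterKL, mainMean]
    norm_num
    rfl
  · have h1 : ∀ hh : h.1 < G.H, g ⟨h, hh⟩ = g' ⟨h, hh⟩ := fun hh => hgg _ (by simp [nextPair])
    have h2 : ∀ hh : h.1 + 1 < G.H, g ⟨h + 1, hh⟩ = g' ⟨h + 1, hh⟩ := fun hh =>
      hgg _ (by simp [nextPair])
    simp only [stepLoss, cumSqExcess, sqExcess, lossDiff_congr G σ F h1 (fun _ => rfl) h2,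
      excess_congr G σ F h1 (fun _ => rfl) h2]
  · have h2 : ∀ hh : h.1 + 1 < G.H, f ⟨h + 1, hh⟩ = f' ⟨h + 1, hh⟩ := fun hh =>
      hff _ (by simp [nextPair])
    simp only [stepLoss, cumSqExcess, sqExcess,
      lossDiff_congr G σ F (fun _ => rfl) h2 (fun _ => rfl),
      excess_congr G σ F (fun _ => rfl) h2 (fun _ => rfl)]
  · refine le_trans (le_of_eq ?_)
      (integral_exp_stepLoss_le σ hF hβ (η := η) (lam := lam) e₀ (t := t) g f g h)
    refine integral_congr_ae (Filter.Eventually.of_forall fun e => congrArg Real.exp ?_)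
    simp only [hη]
    field_simp
    ring

variable (hκ : kappa G σ F ε ≠ ⊤)
include hκ

theorem mainMean_neg_logNorm_le :
    mainMean σ η lam e₀ t (fun e f => -logNorm G σ F η (pastData t e) f f) ≤
      1 / 24 * (mainKL σ η lam e₀ t + (24 * (kappa G σ F ε).toReal +
        t * (G.H * (24 * ε ^ 2 / β ^ 2)))) := by
  have := isProb_runLaw σ hF hβ (η := η) (lam := lam) e₀ t
  have hN : BddMeas fun p : (ℕ → Record G F) × F.Elem =>
      -logNorm G σ F η (pastData t p.1) p.2 p.2 :=
    ((bddMeas_run_logNorm σ hF hβ η).comp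
      (φ := fun p : (ℕ → Record G F) × F.Elem => (p.1, (p.2, p.2))) (by fun_prop)).neg
  have h := integral_integral_tilted_le
    (u := fun (e : ℕ → Record G F) f => postExp G σ F η lam (pastData t e) f f)
    (X := fun (e : ℕ → Record G F) f => -logNorm G σ F η (pastData t e) f f)
    (bddMeas_mainRunExp σ hF hβ) hN (runLaw G σ F η lam e₀ t) F.prodPrior (k := 24) (by norm_num)
  have h2 := integral_log_integral_exp_le
    (X := fun (e : ℕ → Record G F) f => 24 * -logNorm G σ F η (pastData t e) f f)
    (hN.const_mul 24) (runLaw G σ F η lam e₀ t) F.prodPrior fun f =>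
      integral_exp_neg_logNorm_le σ hF hβ e₀ hη hκ f f
  rw [log_moment_bound] at h2
  rw [mainMean, mainKL]
  linarith

theorem pairMean_neg_logNorm_le :
    pairMean σ η lam e₀ t (fun e f g => -logNorm G σ F η (pastData t e) f g) ≤
      1 / 24 * (mainKL σ η lam e₀ t + boosterKL σ η lam e₀ t +
        (24 * (kappa G σ F ε).toReal + t * (G.H * (24 * ε ^ 2 / β ^ 2)))) := by
  have := isProb_runLaw σ hF hβ (η := η) (lam := lam) e₀ t
  have hN : BddMeas fun p : (ℕ → Record G F) × (F.Elem × F.Elem) =>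
      -logNorm G σ F η (pastData t p.1) p.2.1 p.2.2 := (bddMeas_run_logNorm σ hF hβ η).neg
  have h := integral_pair_tilted_le
    (uA := fun (e : ℕ → Record G F) f => postExp G σ F η lam (pastData t e) f f)
    (uB := fun (e : ℕ → Record G F) f g => postExp G σ F η (-lam) (pastData t e) f g)
    (X := fun (e : ℕ → Record G F) f g => -logNorm G σ F η (pastData t e) f g)
    (bddMeas_mainRunExp σ hF hβ) (bddMeas_run_postExp σ hF hβ η (-lam)) hN
    (runLaw G σ F η lam e₀ t) F.prodPrior (k := 24) (by norm_num)
  have h2 := integral_log_integral_exp_pair_le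
    (X := fun (e : ℕ → Record G F) f g => 24 * -logNorm G σ F η (pastData t e) f g)
    (hN.const_mul 24) (runLaw G σ F η lam e₀ t) F.prodPrior fun f g =>
      integral_exp_neg_logNorm_le σ hF hβ e₀ hη hκ f g
  rw [log_moment_bound] at h2
  rw [pairMean, mainKL, boosterKL, mainMean]
  linarith

variable (hlam : 0 ≤ lam) (hε : 0 ≤ ε)
include hlam hε

/-- Only the data are averaged here, no posterior draw, so no entropy appears: the partition
function is at least what the neighbourhood of `f₀` contributes. -/
theorem integral_mainFree_le {f₀ : F.Elem} (hf₀ : IsBackupFixed σ f₀ f₀) :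
    ∫ e, -Real.log (∫ f, Real.exp (postExp G σ F η lam (pastData t e) f f) ∂F.prodPrior)
        ∂(runLaw G σ F η lam e₀ t) ≤
      (kappa G σ F ε).toReal - lam * (pairValue σ F f₀ f₀ 0 G.x₁ - ε) +
        t * (G.H * (24 * ε ^ 2 / β ^ 2)) / 6 := by
  have := isProb_runLaw σ hF hβ (η := η) (lam := lam) e₀ t
  have h1 := integral_exp_neg_log_le
    (y := fun (e : ℕ → Record G F) f => postExp G σ F η lam (pastData t e) f f)
    (bddMeas_mainRunExp σ hF hβ) (runLaw G σ F η lam e₀ t) F.prodPrior (k := 6)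
    (M := Real.exp (-6 * (lam * (pairValue σ F f₀ f₀ 0 G.x₁ - ε))) *
      (Real.exp (24 * ε ^ 2 / β ^ 2) ^ G.H) ^ t) (by norm_num)
    (exp_neg_kappa_le σ hκ f₀ f₀) fun f hf => by
      have hv := abs_pairValue_self_sub_le σ hε hf₀ hf
      refine (integral_exp_neg_postExp_le σ hF hβ e₀ hη lam f f fun h hh =>
        abs_excess_le_of_near σ hF hβ hε hf₀ hf hv hh).trans ?_
      refine mul_le_mul_of_nonneg_right (Real.exp_le_exp.2 ?_) (by positivity)
      have := mul_le_mul_of_nonneg_left (abs_le.1 (hv 0 G.x₁)).1 hlam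
      linarith
  have h2 := (integral_le_log ((bddMeas_mainFree σ hF hβ (η := η) (lam := lam) (t := t)).neg.const_mul
    6) (runLaw G σ F η lam e₀ t)).trans (Real.log_le_log (integral_exp_pos'
      ((bddMeas_mainFree σ hF hβ).neg.const_mul 6) _) h1)
  rw [← mul_assoc, ← Real.exp_add, log_moment_bound, integral_const_mul] at h2
  linarith

/-- The draw `f` depends on the data, so Gibbs at scale `6` charges `1/6` of the main entropy. The
term `λ V^{μ_f,†}` is subtracted first to make the moment bound uniform in `f`. -/
theorem mainMean_boosterFree_le (hC : Complete G σ F) :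
    mainMean σ η lam e₀ t (fun e f =>
        -Real.log (∫ g, Real.exp (postExp G σ F η (-lam) (pastData t e) f g) ∂F.prodPrior)) ≤
      lam * mainMean σ η lam e₀ t (fun _ f => bestValue G (mainPolicy σ F f) 0 G.x₁) +
      (kappa G σ F ε).toReal + lam * ε + t * (G.H * (24 * ε ^ 2 / β ^ 2)) / 6 +
        1 / 6 * mainKL σ η lam e₀ t := by
  have := isProb_runLaw σ hF hβ (η := η) (lam := lam) e₀ t
  have hfree := bddMeas_boosterFree σ hF hβ (η := η) (lam := lam) (t := t)
  have hbest : BddMeas fun p : (ℕ → Record G F) × F.Elem =>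
      bestValue G (mainPolicy σ F p.2) 0 G.x₁ := (bddMeas_bestValue hF hβ hC).comp measurable_snd
  have hY := hfree.neg.add (hbest.const_mul (-lam))
  have hmom (f : F.Elem) : ∫ e, Real.exp (6 * (-Real.log (∫ g, Real.exp
      (postExp G σ F η (-lam) (pastData t e) f g) ∂F.prodPrior) +
        -lam * bestValue G (mainPolicy σ F f) 0 G.x₁)) ∂(runLaw G σ F η lam e₀ t) ≤
      Real.exp (6 * ((kappa G σ F ε).toReal + lam * ε)) *
        (Real.exp (24 * ε ^ 2 / β ^ 2) ^ G.H) ^ t := by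
    obtain ⟨g₀, hg₀⟩ := exists_isBackupFixed hC f
    have h1 := integral_exp_neg_log_le
      (y := fun (e : ℕ → Record G F) g => postExp G σ F η (-lam) (pastData t e) f g)
      ((bddMeas_run_postExp σ hF hβ η (-lam)).comp
        (φ := fun p : (ℕ → Record G F) × F.Elem => (p.1, (f, p.2))) (by fun_prop))
      (runLaw G σ F η lam e₀ t) F.prodPrior (k := 6)
      (M := Real.exp (6 * (lam * (pairValue σ F f g₀ 0 G.x₁ + ε))) *
        (Real.exp (24 * ε ^ 2 / β ^ 2) ^ G.H) ^ t) (by norm_num)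
      (exp_neg_kappa_le σ hκ f g₀) fun g hg => by
        have hv := abs_pairValue_sub_le σ hε hg₀ hg
        refine (integral_exp_neg_postExp_le σ hF hβ e₀ hη (-lam) f g fun h hh =>
          abs_excess_le_of_near σ hF hβ hε hg₀ hg hv hh).trans ?_
        refine mul_le_mul_of_nonneg_right (Real.exp_le_exp.2 ?_) (by positivity)
        have := mul_le_mul_of_nonneg_left (abs_le.1 (hv 0 G.x₁)).2 hlam
        linarith
    rw [← hg₀.bestValue_eq hF hβ] at h1
    simp only [mul_add, Real.exp_add]
    rw [integral_mul_const]
    refine (mul_le_mul_of_nonneg_right h1 (Real.exp_pos _).le).trans (le_of_eq ?_)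
    rw [← Real.exp_add, mul_right_comm, ← mul_assoc, ← Real.exp_add, ← Real.exp_add]
    congr 2
    ring
  have h := integral_integral_tilted_le
    (u := fun (e : ℕ → Record G F) f => postExp G σ F η lam (pastData t e) f f)
    (X := fun (e : ℕ → Record G F) f => -Real.log (∫ g, Real.exp
      (postExp G σ F η (-lam) (pastData t e) f g) ∂F.prodPrior) +
        -lam * bestValue G (mainPolicy σ F f) 0 G.x₁)
    (bddMeas_mainRunExp σ hF hβ) hY (runLaw G σ F η lam e₀ t) F.prodPrior (k := 6) (by norm_num)
  have h2 := integral_log_integral_exp_le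
    (X := fun (e : ℕ → Record G F) f => 6 * (-Real.log (∫ g, Real.exp
      (postExp G σ F η (-lam) (pastData t e) f g) ∂F.prodPrior) +
        -lam * bestValue G (mainPolicy σ F f) 0 G.x₁))
    (hY.const_mul 6) (runLaw G σ F η lam e₀ t) F.prodPrior hmom
  rw [log_moment_bound] at h2
  have h3 := mainMean_add σ hF hβ (η := η) (lam := lam) e₀ (t := t)
    (Y := fun e f => -Real.log (∫ g, Real.exp
      (postExp G σ F η (-lam) (pastData t e) f g) ∂F.prodPrior))
    (Z := fun _ f => -lam * bestValue G (mainPolicy σ F f) 0 G.x₁) hfree.neg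
    (hbest.const_mul (-lam))
  rw [mainMean_const_mul σ η lam e₀ t (-lam) fun _ f => bestValue G (mainPolicy σ F f) 0 G.x₁]
    at h3
  have h4 : mainMean σ η lam e₀ t (fun e f => -Real.log (∫ g, Real.exp
      (postExp G σ F η (-lam) (pastData t e) f g) ∂F.prodPrior) +
        -lam * bestValue G (mainPolicy σ F f) 0 G.x₁) ≤ 6⁻¹ * (mainKL σ η lam e₀ t + _) :=
    h.trans (mul_le_mul_of_nonneg_left (add_le_add_right h2 _) (by norm_num))
  linarith

/-- The exponent is split into value, log-normalizer and compensated loss. The entropy keeps the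
weight `1 - 1/3 - 1/24 = 15/24`, and the discretization errors add up to `1/24 + 1/6 = 5/24`. -/
theorem main_round {f₀ : F.Elem} (hf₀ : IsBackupFixed σ f₀ f₀) :
    15 / 24 * mainKL σ η lam e₀ t + (24 * β ^ 2)⁻¹ *
        mainMean σ η lam e₀ t (fun e f => ∑ h, cumSqExcess σ t e h f f f) ≤
      lam * (mainMean σ η lam e₀ t (fun _ f => pairValue σ F f f 0 G.x₁) -
        pairValue σ F f₀ f₀ 0 G.x₁) + 2 * (kappa G σ F ε).toReal + lam * ε +
        5 / 24 * (t * (G.H * (24 * ε ^ 2 / β ^ 2))) := by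
  have h1 := mainMean_loss_le σ hF hβ (lam := lam) e₀ (t := t) hη
  have h2 := mainMean_neg_logNorm_le σ hF hβ (lam := lam) e₀ (t := t) hη hκ
  have h3 := integral_mainFree_le σ hF hβ e₀ (t := t) hη hκ hlam hε hf₀
  have h4 := mainKL_eq σ hF hβ (η := η) (lam := lam) e₀ (t := t)
  have hpost := bddMeas_mainRunExp σ hF hβ (η := η) (lam := lam) (t := t)
  have hR : BddMeas fun p : (ℕ → Record G F) × F.Elem =>
      ∑ h, cumSqExcess σ t p.1 h p.2 p.2 p.2 := BddMeas.sum fun h _ =>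
    (bddMeas_cumSqExcess σ hF hβ h).comp
      (φ := fun p : (ℕ → Record G F) × F.Elem => (p.1, (p.2, p.2, p.2))) (by fun_prop)
  have hL : BddMeas fun p : (ℕ → Record G F) × F.Elem =>
      ∑ h, (-η * stepLoss G σ F (pastData t p.1) h p.2 p.2 p.2 +
        (24 * β ^ 2)⁻¹ * cumSqExcess σ t p.1 h p.2 p.2 p.2) := BddMeas.sum fun h _ =>
    (bddMeas_tripleLoss σ hF hβ (-η) (24 * β ^ 2)⁻¹ h).comp
      (φ := fun p : (ℕ → Record G F) × F.Elem => (p.1, (p.2, p.2, p.2))) (by fun_prop)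
  have hN : BddMeas fun p : (ℕ → Record G F) × F.Elem =>
      -logNorm G σ F η (pastData t p.1) p.2 p.2 :=
    ((bddMeas_run_logNorm σ hF hβ η).comp
      (φ := fun p : (ℕ → Record G F) × F.Elem => (p.1, (p.2, p.2))) (by fun_prop)).neg
  have hV : BddMeas fun p : (ℕ → Record G F) × F.Elem => pairValue σ F p.2 p.2 0 G.x₁ :=
    (bddMeas_run_startValue σ hF hβ).comp
      (φ := fun p : (ℕ → Record G F) × F.Elem => (p.1, (p.2, p.2))) (by fun_prop)
  have a1 := mainMean_add σ hF hβ (η := η) (lam := lam) e₀ (t := t)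
    (Y := fun e f => postExp G σ F η lam (pastData t e) f f)
    (Z := fun e f => (24 * β ^ 2)⁻¹ * ∑ h, cumSqExcess σ t e h f f f) hpost (hR.const_mul _)
  have a2 := mainMean_add σ hF hβ (η := η) (lam := lam) e₀ (t := t)
    (Y := fun e f => lam * pairValue σ F f f 0 G.x₁)
    (Z := fun e f => -logNorm G σ F η (pastData t e) f f) (hV.const_mul lam) hN
  have a3 := mainMean_add σ hF hβ (η := η) (lam := lam) e₀ (t := t)
    (Y := fun e f => lam * pairValue σ F f f 0 G.x₁ + -logNorm G σ F η (pastData t e) f f)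
    (Z := fun e f => ∑ h, (-η * stepLoss G σ F (pastData t e) h f f f +
        (24 * β ^ 2)⁻¹ * cumSqExcess σ t e h f f f)) ((hV.const_mul lam).add hN) hL
  rw [mainMean_const_mul σ η lam e₀ t _ fun e f => ∑ h, cumSqExcess σ t e h f f f] at a1
  rw [mainMean_const_mul σ η lam e₀ t _ fun e f => pairValue σ F f f 0 G.x₁] at a2
  have a4 : mainMean σ η lam e₀ t (fun e f => postExp G σ F η lam (pastData t e) f f +
      (24 * β ^ 2)⁻¹ * ∑ h, cumSqExcess σ t e h f f f) =
    mainMean σ η lam e₀ t (fun e f => lam * pairValue σ F f f 0 G.x₁ +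
      -logNorm G σ F η (pastData t e) f f + ∑ h, (-η * stepLoss G σ F (pastData t e) h f f f +
        (24 * β ^ 2)⁻¹ * cumSqExcess σ t e h f f f)) := by
    congr 1
    funext e f
    rw [postExp, cumLoss, Finset.sum_add_distrib, ← Finset.mul_sum, ← Finset.mul_sum]
    ring
  linarith

/-- The main entropy enters with `1/3 + 1/24 + 1/6 = 13/24`. The booster's own entropy has weight
`15/24` on the left and is dropped. That `13/24` is below the `15/24` of `main_round` is what lets
the regret be absorbed at the end. -/
theorem booster_round (hC : Complete G σ F) :
    lam * (pairMean σ η lam e₀ t (fun _ f g => pairValue σ F f g 0 G.x₁) -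
        mainMean σ η lam e₀ t fun _ f => bestValue G (mainPolicy σ F f) 0 G.x₁) +
      (24 * β ^ 2)⁻¹ *
        pairMean σ η lam e₀ t (fun e f g => ∑ h, cumSqExcess σ t e h g f g) ≤
      13 / 24 * mainKL σ η lam e₀ t + 2 * (kappa G σ F ε).toReal + lam * ε +
        5 / 24 * (t * (G.H * (24 * ε ^ 2 / β ^ 2))) := by
  have h1 := pairMean_loss_le σ hF hβ (lam := lam) e₀ (t := t) hη
  have h2 := pairMean_neg_logNorm_le σ hF hβ (lam := lam) e₀ (t := t) hη hκ
  have h3 := mainMean_boosterFree_le σ hF hβ e₀ (t := t) hη hκ hlam hε hC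
  have h4 := boosterKL_eq σ hF hβ (η := η) (lam := lam) e₀ (t := t)
  have h5 := boosterKL_nonneg σ hF hβ (η := η) (lam := lam) e₀ (t := t)
  have hpost := bddMeas_run_postExp σ hF hβ η (-lam) (t := t)
  have hR : BddMeas fun p : (ℕ → Record G F) × (F.Elem × F.Elem) =>
      ∑ h, cumSqExcess σ t p.1 h p.2.2 p.2.1 p.2.2 := BddMeas.sum fun h _ =>
    (bddMeas_cumSqExcess σ hF hβ h).comp
      (φ := fun p : (ℕ → Record G F) × (F.Elem × F.Elem) => (p.1, (p.2.2, p.2.1, p.2.2)))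
      (by fun_prop)
  have hL : BddMeas fun p : (ℕ → Record G F) × (F.Elem × F.Elem) =>
      ∑ h, (-η * stepLoss G σ F (pastData t p.1) h p.2.2 p.2.1 p.2.2 +
        (24 * β ^ 2)⁻¹ * cumSqExcess σ t p.1 h p.2.2 p.2.1 p.2.2) := BddMeas.sum fun h _ =>
    (bddMeas_tripleLoss σ hF hβ (-η) (24 * β ^ 2)⁻¹ h).comp
      (φ := fun p : (ℕ → Record G F) × (F.Elem × F.Elem) => (p.1, (p.2.2, p.2.1, p.2.2)))
      (by fun_prop)
  have hN : BddMeas fun p : (ℕ → Record G F) × (F.Elem × F.Elem) =>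
      -logNorm G σ F η (pastData t p.1) p.2.1 p.2.2 := (bddMeas_run_logNorm σ hF hβ η).neg
  have hV := bddMeas_run_startValue (G := G) σ hF hβ
  have a1 := pairMean_add σ hF hβ (η := η) (lam := lam) e₀ (t := t)
    (Y := fun e f g => postExp G σ F η (-lam) (pastData t e) f g)
    (Z := fun e f g => (24 * β ^ 2)⁻¹ * ∑ h, cumSqExcess σ t e h g f g) hpost (hR.const_mul _)
  have a2 := pairMean_add σ hF hβ (η := η) (lam := lam) e₀ (t := t)
    (Y := fun e f g => -lam * pairValue σ F f g 0 G.x₁)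
    (Z := fun e f g => -logNorm G σ F η (pastData t e) f g) (hV.const_mul (-lam)) hN
  have a3 := pairMean_add σ hF hβ (η := η) (lam := lam) e₀ (t := t)
    (Y := fun e f g => -lam * pairValue σ F f g 0 G.x₁ + -logNorm G σ F η (pastData t e) f g)
    (Z := fun e f g => ∑ h, (-η * stepLoss G σ F (pastData t e) h g f g +
        (24 * β ^ 2)⁻¹ * cumSqExcess σ t e h g f g)) ((hV.const_mul (-lam)).add hN) hL
  rw [pairMean_const_mul σ η lam e₀ t _ fun e f g => ∑ h, cumSqExcess σ t e h g f g] at a1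
  rw [pairMean_const_mul σ η lam e₀ t _ fun e f g => pairValue σ F f g 0 G.x₁] at a2
  have a4 : pairMean σ η lam e₀ t (fun e f g => postExp G σ F η (-lam) (pastData t e) f g +
      (24 * β ^ 2)⁻¹ * ∑ h, cumSqExcess σ t e h g f g) =
    pairMean σ η lam e₀ t (fun e f g => -lam * pairValue σ F f g 0 G.x₁ +
      -logNorm G σ F η (pastData t e) f g + ∑ h, (-η * stepLoss G σ F (pastData t e) h g f g +
        (24 * β ^ 2)⁻¹ * cumSqExcess σ t e h g f g)) := by
    congr 1
    funext e f g
    rw [postExp, cumLoss, Finset.sum_add_distrib, ← Finset.mul_sum, ← Finset.mul_sum]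
    ring
  linarith

end Learning


section Learning

variable {X : Type u} {A : Type v} {B : Type w} [MeasurableSpace X]
  [Fintype A] [MeasurableSpace A] [DiscreteMeasurableSpace A]
  [Fintype B] [Nonempty B] [MeasurableSpace B] [DiscreteMeasurableSpace B]
  {G : MarkovGame X A B} (σ : TieBreak X A B) {F : FunctionClass.{u, v, w, z} X A B G.H}

/-! ### Means over a round as means over the whole run -/

theorem cumSqExcess_update {t s : ℕ} (hs : t ≤ s) (e : ℕ → Record G F) (r : Record G F)
    (h : Fin G.H) (θ f g : F.Elem) :
    cumSqExcess σ t (Function.update e s r) h θ f g = cumSqExcess σ t e h θ f g := by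
  refine Finset.sum_congr rfl fun i hi => ?_
  rw [Function.update_of_ne ((Finset.mem_range.1 hi).trans_le hs).ne]

/-- The expected sum of the residuals of `w` for `μ_f` when `(μ_f, ν_{f,g})` is played. -/
def sumResidual (f g w : F.Elem) : ℝ :=
  ∑ h : Fin G.H, stepExpect G (mainPolicy σ F f) (boosterPolicy σ F f g) h
    (excess G σ F w f w h)

/-- An infimum of naturals below the real `d` is witnessed by a natural at most `⌊d⌋`; otherwise it
would be at least `⌊d⌋ + 1`. -/
theorem exists_decouplingIneq {T : ℕ} {m d : ℝ} (hd : 0 ≤ d)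
    (h : (decoupling G σ F T m : ENNReal) ≤ ENNReal.ofReal d) :
    ∃ K : ℕ, (K : ℝ) ≤ d ∧ ∀ f g : ℕ → F.Elem,
      DecouplingIneq G σ F T m K f g g ∧ DecouplingIneq G σ F T m K f g f := by
  by_contra! hK
  have h1 : ((⌊d⌋₊ + 1 : ℕ) : ℕ∞) ≤ decoupling G σ F T m := by
    refine le_iInf₂ fun K hKm => Nat.cast_le.2 ?_
    by_contra! hlt
    obtain ⟨f, g, hfg⟩ := hK K ((Nat.cast_le.2 (Nat.lt_succ_iff.1 hlt)).trans (Nat.floor_le hd))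
    exact hfg (hKm f g).1 (hKm f g).2
  have h2 : ((⌊d⌋₊ + 1 : ℕ) : ENNReal) ≤ ENNReal.ofReal d :=
    le_trans (by exact_mod_cast ENat.toENNReal_le.2 h1) h
  rw [← ENNReal.ofReal_natCast, ENNReal.ofReal_le_ofReal_iff hd] at h2
  push_cast at h2
  exact absurd (Nat.lt_floor_add_one d) (not_lt.2 h2)

theorem abs_sum_sumResidual_le {T : ℕ} {m K : ℝ} {f g w : ℕ → F.Elem}
    (h : DecouplingIneq G σ F T m K f g w) (e : ℕ → Record G F) (hf : ∀ t, (e t).1.1 = f t)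
    (hg : ∀ t, (e t).1.2 = g t) :
    |∑ t ∈ Finset.range T, sumResidual σ (f t) (g t) (w t)| ≤
      m * (∑ t ∈ Finset.range T, ∑ h, cumSqExcess σ t e h (w t) (f t) (w t)) + K / (4 * m) := by
  unfold DecouplingIneq at h
  simp only [sumResidual, cumSqExcess, sqExcess, hf, hg]
  rw [Finset.sum_comm, Finset.sum_comm (s := Finset.range T)]
  exact h

variable {η lam β : ℝ} (hF : BoundedBy F β) (hβ : 1 ≤ β) (e₀ : ℕ → Record G F) {t T : ℕ}
include hF hβ

theorem bddMeas_sumResidual : BddMeas fun q : (F.Elem × F.Elem) × F.Elem =>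
    sumResidual σ q.1.1 q.1.2 q.2 := by
  refine BddMeas.sum fun h _ => BddMeas.integral_pairLaw G σ
    (Φ := fun (q : (F.Elem × F.Elem) × F.Elem) ζ =>
      excess G σ F q.2 q.1.1 q.2 h (ζ h).1 (ζ h).2.1 (ζ h).2.2.1)
    (f := fun q => q.1.1) (g := fun q => q.1.2) ?_ (by fun_prop) (by fun_prop)
  refine (bddMeas_excess σ hF hβ h).comp (φ := fun p : ((F.Elem × F.Elem) × F.Elem) ×
    Trajectory X A B G.H =>
      ((p.1.2, p.1.1.1, p.1.2), (p.2 h).1, (p.2 h).2.1, (p.2 h).2.2.1)) ?_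
  have h1 : Measurable fun ζ : Trajectory X A B G.H => ζ h := measurable_pi_apply h
  have h2 : Measurable fun p : ((F.Elem × F.Elem) × F.Elem) × Trajectory X A B G.H => p.2 h :=
    h1.comp measurable_snd
  fun_prop

theorem bddMeas_pairRegret (hC : Complete G σ F) : BddMeas fun q : F.Elem × F.Elem =>
    value G (mainPolicy σ F q.1) (boosterPolicy σ F q.1 q.2) 0 G.x₁ -
      bestValue G (mainPolicy σ F q.1) 0 G.x₁ := by
  have h := ((bddMeas_startValue σ hF hβ).sub ((bddMeas_sumResidual σ hF hβ).comp
    (φ := fun q : F.Elem × F.Elem => (q, q.2)) (by fun_prop))).sub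
    ((bddMeas_bestValue hF hβ hC).comp (φ := fun q : F.Elem × F.Elem => q.1) measurable_fst)
  have e : (fun q : F.Elem × F.Elem =>
      value G (mainPolicy σ F q.1) (boosterPolicy σ F q.1 q.2) 0 G.x₁ -
        bestValue G (mainPolicy σ F q.1) 0 G.x₁) = fun q : F.Elem × F.Elem =>
      pairValue σ F q.1 q.2 0 G.x₁ - sumResidual σ q.1 q.2 q.2 -
        bestValue G (mainPolicy σ F q.1) 0 G.x₁ := by
    funext q
    rw [pairValue_eq_value_add σ hF hβ, sumResidual, add_sub_cancel_right]
  rw [e]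
  exact h

theorem mainMean_eq_pairMean (Y : (ℕ → Record G F) → F.Elem → ℝ) :
    mainMean σ η lam e₀ t Y = pairMean σ η lam e₀ t fun e f _ => Y e f := by
  rw [mainMean, pairMean]
  refine integral_congr_ae (Filter.Eventually.of_forall fun e => ?_)
  refine integral_congr_ae (Filter.Eventually.of_forall fun f => ?_)
  have := isProb_boosterTilted σ hF hβ (η := η) (lam := -lam) (pastData t e) f
  simp

theorem bddMeas_draw {Y : (ℕ → Record G F) → F.Elem → F.Elem → ℝ}
    (hY : BddMeas fun p : (ℕ → Record G F) × (F.Elem × F.Elem) => Y p.1 p.2.1 p.2.2) :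
    BddMeas fun e => Y e (e t).1.1 (e t).1.2 :=
  hY.comp (φ := fun e : ℕ → Record G F => (e, (e t).1))
    (measurable_id.prodMk (measurable_fst.comp (measurable_pi_apply t)))

/-- The next draws of round `t` are the pair stored in record `t`. All rounds thus live under one
law, and the decoupling inequality can be applied run by run before integrating. -/
theorem pairMean_eq_integral {Y : (ℕ → Record G F) → F.Elem → F.Elem → ℝ}
    (hY : BddMeas fun p : (ℕ → Record G F) × (F.Elem × F.Elem) => Y p.1 p.2.1 p.2.2)
    (hloc : ∀ e s r f g, t ≤ s → Y (Function.update e s r) f g = Y e f g) (ht : t < T) :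
    pairMean σ η lam e₀ t Y = ∫ e, Y e (e t).1.1 (e t).1.2 ∂(runLaw G σ F η lam e₀ T) := by
  have hΨ := bddMeas_draw hF hβ (t := t) hY
  rw [integral_runLaw_of_le σ hF hβ e₀ (Ψ := fun e => Y e (e t).1.1 (e t).1.2) hΨ
    (fun e s r hs => ?_) ht, integral_runLaw_succ σ hF hβ e₀ hΨ]
  · simp [hloc _ _ _ _ _ le_rfl, pairMean]
  · rw [hloc _ _ _ _ _ (Nat.le_of_succ_le hs), Function.update_of_ne (by omega)]

theorem boosterRegret_eq (hC : Complete G σ F) :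
    boosterRegret G σ F η lam T = ∑ t ∈ Finset.range T, ∫ e,
      (value G (mainPolicy σ F (e t).1.1) (boosterPolicy σ F (e t).1.1 (e t).1.2) 0 G.x₁ -
        bestValue G (mainPolicy σ F (e t).1.1) 0 G.x₁) ∂(runLaw G σ F η lam e₀ T) := by
  refine Finset.sum_congr rfl fun t ht => ?_
  have hreg := bddMeas_pairRegret σ hF hβ hC
  rw [← pairMean_eq_integral σ hF hβ e₀ (Y := fun _ f g =>
    value G (mainPolicy σ F f) (boosterPolicy σ F f g) 0 G.x₁ -
      bestValue G (mainPolicy σ F f) 0 G.x₁) (hreg.comp measurable_snd)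
      (fun _ _ _ _ _ _ => rfl) (Finset.mem_range.1 ht)]
  simp only [mainPosterior_eq σ hF hβ, boosterPosterior_eq σ hF hβ]
  exact integral_historyLaw σ hF hβ e₀ t (BddMeas.integral_tilted
    (u := fun (S : History G t) f => postExp G σ F η lam S f f)
    (bddMeas_mainExp σ hF hβ) (BddMeas.integral_tilted_pair
      (u := fun (S : History G t) f g => postExp G σ F η (-lam) S f g)
      (X := fun (_ : History G t) f g =>
        value G (mainPolicy σ F f) (boosterPolicy σ F f g) 0 G.x₁ -
          bestValue G (mainPolicy σ F f) 0 G.x₁)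
      (bddMeas_postExp σ hF hβ η (-lam)) (hreg.comp measurable_snd) F.prodPrior) F.prodPrior)

/-! ### The decoupling argument -/

/-- On each run the played value is `V_g^{μ_f}` minus the residuals of `g`, exactly; decoupling pays
for those residuals with past squared ones. -/
theorem regret_le_of_decoupling (hC : Complete G σ F) {m K d : ℝ} (hm : 0 < m) (hK : K ≤ d)
    (hdec : ∀ f g : ℕ → F.Elem, DecouplingIneq G σ F T m K f g g) :
    boosterRegret G σ F η lam T ≤ ∑ t ∈ Finset.range T,
      (pairMean σ η lam e₀ t (fun _ f g => pairValue σ F f g 0 G.x₁) -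
        mainMean σ η lam e₀ t (fun _ f => bestValue G (mainPolicy σ F f) 0 G.x₁) +
        m * pairMean σ η lam e₀ t (fun e f g => ∑ h, cumSqExcess σ t e h g f g)) +
      d / (4 * m) := by
  have := isProb_runLaw σ hF hβ (η := η) (lam := lam) e₀ T
  have hV := bddMeas_run_startValue (G := G) σ hF hβ
  have hbest : BddMeas fun p : (ℕ → Record G F) × (F.Elem × F.Elem) =>
      bestValue G (mainPolicy σ F p.2.1) 0 G.x₁ :=
    (bddMeas_bestValue hF hβ hC).comp (measurable_fst.comp measurable_snd)
  have hR (t : ℕ) : BddMeas fun p : (ℕ → Record G F) × (F.Elem × F.Elem) =>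
      ∑ h, cumSqExcess σ t p.1 h p.2.2 p.2.1 p.2.2 := BddMeas.sum fun h _ =>
    (bddMeas_cumSqExcess σ hF hβ h).comp
      (φ := fun p : (ℕ → Record G F) × (F.Elem × F.Elem) => (p.1, (p.2.2, p.2.1, p.2.2)))
      (by fun_prop)
  have hreg : BddMeas fun p : (ℕ → Record G F) × (F.Elem × F.Elem) =>
      value G (mainPolicy σ F p.2.1) (boosterPolicy σ F p.2.1 p.2.2) 0 G.x₁ -
        bestValue G (mainPolicy σ F p.2.1) 0 G.x₁ :=
    (bddMeas_pairRegret σ hF hβ hC).comp measurable_snd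
  have hV' (t : ℕ) := bddMeas_draw hF hβ (t := t)
    (Y := fun _ f g => pairValue σ F f g 0 G.x₁) hV
  have hbest' (t : ℕ) := bddMeas_draw hF hβ (t := t)
    (Y := fun _ f _ => bestValue G (mainPolicy σ F f) 0 G.x₁) hbest
  have hR' (t : ℕ) := bddMeas_draw hF hβ (t := t)
    (Y := fun e f g => ∑ h, cumSqExcess σ t e h g f g) (hR t)
  have hreg' (t : ℕ) := bddMeas_draw hF hβ (t := t)
    (Y := fun _ f g => value G (mainPolicy σ F f) (boosterPolicy σ F f g) 0 G.x₁ -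
      bestValue G (mainPolicy σ F f) 0 G.x₁) hreg
  have e1 (t : ℕ) (ht : t ∈ Finset.range T) :
      pairMean σ η lam e₀ t (fun _ f g => pairValue σ F f g 0 G.x₁) -
        mainMean σ η lam e₀ t (fun _ f => bestValue G (mainPolicy σ F f) 0 G.x₁) +
        m * pairMean σ η lam e₀ t (fun e f g => ∑ h, cumSqExcess σ t e h g f g) =
      ∫ e, (pairValue σ F (e t).1.1 (e t).1.2 0 G.x₁ -
        bestValue G (mainPolicy σ F (e t).1.1) 0 G.x₁ +
        m * ∑ h, cumSqExcess σ t e h (e t).1.2 (e t).1.1 (e t).1.2)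
          ∂(runLaw G σ F η lam e₀ T) := by
    rw [integral_add (((hV' t).sub (hbest' t)).integrable _)
      (((hR' t).const_mul m).integrable _), integral_sub ((hV' t).integrable _)
      ((hbest' t).integrable _), integral_const_mul, mainMean_eq_pairMean σ hF hβ,
      pairMean_eq_integral σ hF hβ e₀ hV (fun _ _ _ _ _ _ => rfl) (Finset.mem_range.1 ht),
      pairMean_eq_integral σ hF hβ e₀ (Y := fun _ f _ => bestValue G (mainPolicy σ F f) 0 G.x₁)
        hbest (fun _ _ _ _ _ _ => rfl) (Finset.mem_range.1 ht),
      pairMean_eq_integral σ hF hβ e₀ (hR t) (fun e s r f g hs => ?_) (Finset.mem_range.1 ht)]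
    simp only [cumSqExcess_update σ hs]
  rw [boosterRegret_eq σ hF hβ e₀ hC, Finset.sum_congr rfl e1,
    ← integral_finsetSum _ fun t _ => (hreg' t).integrable _,
    ← integral_finsetSum _ fun t _ =>
      (((hV' t).sub (hbest' t)).add ((hR' t).const_mul m)).integrable _]
  have hsum : BddMeas fun e : ℕ → Record G F => ∑ t ∈ Finset.range T,
      (pairValue σ F (e t).1.1 (e t).1.2 0 G.x₁ -
        bestValue G (mainPolicy σ F (e t).1.1) 0 G.x₁ +
        m * ∑ h, cumSqExcess σ t e h (e t).1.2 (e t).1.1 (e t).1.2) :=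
    BddMeas.sum fun t _ => ((hV' t).sub (hbest' t)).add ((hR' t).const_mul m)
  have hmono := integral_mono (μ := runLaw G σ F η lam e₀ T)
    ((BddMeas.sum fun t (_ : t ∈ Finset.range T) => hreg' t).integrable _)
    ((hsum.add (BddMeas.const (d / (4 * m)))).integrable _) fun e => ?_
  · rw [integral_add (hsum.integrable _) (integrable_const _)] at hmono
    simpa using hmono
  · have h1 := abs_sum_sumResidual_le σ
      (hdec (fun t => (e t).1.1) fun t => (e t).1.2) e (fun _ => rfl) fun _ => rfl
    have h2 := (abs_le.1 h1).1
    have h3 : K / (4 * m) ≤ d / (4 * m) := div_le_div_of_nonneg_right hK (by positivity)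
    have h4 (t : ℕ) : value G (mainPolicy σ F (e t).1.1)
        (boosterPolicy σ F (e t).1.1 (e t).1.2) 0 G.x₁ =
          pairValue σ F (e t).1.1 (e t).1.2 0 G.x₁ -
            sumResidual σ (e t).1.1 (e t).1.2 (e t).1.2 := by
      rw [pairValue_eq_value_add σ hF hβ, sumResidual, add_sub_cancel_right]
    simp only [h4, Finset.sum_add_distrib, Finset.sum_sub_distrib, ← Finset.mul_sum]
    linarith

/-- The booster's answer need not minimize `f`, so `V_f` is only bounded by the played value plus
the residuals of `f`; this direction suffices, since `V^{μ_f,†} ≤ V*`. -/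
theorem optimism_le_of_decoupling (hC : Complete G σ F) {m K d : ℝ} (hm : 0 < m) (hK : K ≤ d)
    (hdec : ∀ f g : ℕ → F.Elem, DecouplingIneq G σ F T m K f g f) {f₀ : F.Elem}
    (hf₀ : IsBackupFixed σ f₀ f₀) :
    ∑ t ∈ Finset.range T, (mainMean σ η lam e₀ t (fun _ f => pairValue σ F f f 0 G.x₁) -
        pairValue σ F f₀ f₀ 0 G.x₁ -
        m * mainMean σ η lam e₀ t (fun e f => ∑ h, cumSqExcess σ t e h f f f)) ≤
      boosterRegret G σ F η lam T + d / (4 * m) := by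
  have := isProb_runLaw σ hF hβ (η := η) (lam := lam) e₀ T
  have hV : BddMeas fun p : (ℕ → Record G F) × (F.Elem × F.Elem) =>
      pairValue σ F p.2.1 p.2.1 0 G.x₁ :=
    (bddMeas_startValue σ hF hβ).comp
      (φ := fun p : (ℕ → Record G F) × (F.Elem × F.Elem) => (p.2.1, p.2.1)) (by fun_prop)
  have hR (t : ℕ) : BddMeas fun p : (ℕ → Record G F) × (F.Elem × F.Elem) =>
      ∑ h, cumSqExcess σ t p.1 h p.2.1 p.2.1 p.2.1 := BddMeas.sum fun h _ =>
    (bddMeas_cumSqExcess σ hF hβ h).comp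
      (φ := fun p : (ℕ → Record G F) × (F.Elem × F.Elem) => (p.1, (p.2.1, p.2.1, p.2.1)))
      (by fun_prop)
  have hreg : BddMeas fun p : (ℕ → Record G F) × (F.Elem × F.Elem) =>
      value G (mainPolicy σ F p.2.1) (boosterPolicy σ F p.2.1 p.2.2) 0 G.x₁ -
        bestValue G (mainPolicy σ F p.2.1) 0 G.x₁ :=
    (bddMeas_pairRegret σ hF hβ hC).comp measurable_snd
  have hV' (t : ℕ) := bddMeas_draw hF hβ (t := t)
    (Y := fun _ f _ => pairValue σ F f f 0 G.x₁) hV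
  have hR' (t : ℕ) := bddMeas_draw hF hβ (t := t)
    (Y := fun e f _ => ∑ h, cumSqExcess σ t e h f f f) (hR t)
  have hreg' (t : ℕ) := bddMeas_draw hF hβ (t := t)
    (Y := fun _ f g => value G (mainPolicy σ F f) (boosterPolicy σ F f g) 0 G.x₁ -
      bestValue G (mainPolicy σ F f) 0 G.x₁) hreg
  have hc : BddMeas fun _ : ℕ → Record G F => pairValue σ F f₀ f₀ 0 G.x₁ := BddMeas.const _
  have e1 (t : ℕ) (ht : t ∈ Finset.range T) :
      mainMean σ η lam e₀ t (fun _ f => pairValue σ F f f 0 G.x₁) -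
        pairValue σ F f₀ f₀ 0 G.x₁ -
        m * mainMean σ η lam e₀ t (fun e f => ∑ h, cumSqExcess σ t e h f f f) =
      ∫ e, (pairValue σ F (e t).1.1 (e t).1.1 0 G.x₁ - pairValue σ F f₀ f₀ 0 G.x₁ -
        m * ∑ h, cumSqExcess σ t e h (e t).1.1 (e t).1.1 (e t).1.1)
          ∂(runLaw G σ F η lam e₀ T) := by
    rw [integral_sub (((hV' t).sub hc).integrable _)
      (((hR' t).const_mul m).integrable _), integral_sub ((hV' t).integrable _)
      (hc.integrable _), integral_const_mul, mainMean_eq_pairMean σ hF hβ,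
      mainMean_eq_pairMean σ hF hβ,
      pairMean_eq_integral σ hF hβ e₀ (Y := fun _ f _ => pairValue σ F f f 0 G.x₁)
        hV (fun _ _ _ _ _ _ => rfl) (Finset.mem_range.1 ht),
      pairMean_eq_integral σ hF hβ e₀ (Y := fun e f _ => ∑ h, cumSqExcess σ t e h f f f) (hR t)
        (fun e s r f g hs => ?_) (Finset.mem_range.1 ht)]
    · simp
    · simp only [cumSqExcess_update σ hs]
  rw [boosterRegret_eq σ hF hβ e₀ hC, Finset.sum_congr rfl e1,
    ← integral_finsetSum _ fun t _ => (hreg' t).integrable _,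
    ← integral_finsetSum _ fun t _ =>
      (((hV' t).sub hc).sub ((hR' t).const_mul m)).integrable _]
  have hsum : BddMeas fun e : ℕ → Record G F => ∑ t ∈ Finset.range T,
      (value G (mainPolicy σ F (e t).1.1) (boosterPolicy σ F (e t).1.1 (e t).1.2) 0 G.x₁ -
        bestValue G (mainPolicy σ F (e t).1.1) 0 G.x₁) := BddMeas.sum fun t _ => hreg' t
  have hmono := integral_mono (μ := runLaw G σ F η lam e₀ T)
    ((BddMeas.sum fun t (_ : t ∈ Finset.range T) =>
      ((hV' t).sub hc).sub ((hR' t).const_mul m)).integrable _)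
    ((hsum.add (BddMeas.const (d / (4 * m)))).integrable _) fun e => ?_
  · rw [integral_add (hsum.integrable _) (integrable_const _)] at hmono
    simpa using hmono
  · have h1 := abs_sum_sumResidual_le σ
      (hdec (fun t => (e t).1.1) fun t => (e t).1.2) e (fun _ => rfl) fun _ => rfl
    have h2 := (abs_le.1 h1).2
    have h3 : K / (4 * m) ≤ d / (4 * m) := div_le_div_of_nonneg_right hK (by positivity)
    have h4 : ∑ t ∈ Finset.range T, (pairValue σ F (e t).1.1 (e t).1.1 0 G.x₁ -
        pairValue σ F f₀ f₀ 0 G.x₁) ≤ ∑ t ∈ Finset.range T,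
        (value G (mainPolicy σ F (e t).1.1) (boosterPolicy σ F (e t).1.1 (e t).1.2) 0 G.x₁ -
          bestValue G (mainPolicy σ F (e t).1.1) 0 G.x₁ +
            sumResidual σ (e t).1.1 (e t).1.2 (e t).1.1) := by
      refine Finset.sum_le_sum fun t _ => ?_
      have h5 := pairValue_le_value_add σ hF hβ (e t).1.1 (e t).1.1
        (boosterPolicy σ F (e t).1.1 (e t).1.2)
      obtain ⟨g₀, hg₀⟩ := exists_isBackupFixed hC (e t).1.1
      have h6 := hg₀.pairValue_le hF hβ hf₀ (Nat.zero_add G.H) G.x₁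
      rw [← hg₀.bestValue_eq hF hβ] at h6
      rw [sumResidual]
      linarith
    simp only [Finset.sum_add_distrib, Finset.sum_sub_distrib, ← Finset.mul_sum] at h4 ⊢
    linarith

/-! ### Combining the two agents and tuning `λ`. -/

include e₀

theorem lam_mul_boosterRegret_le (hC : Complete G σ F) {ε d : ℝ} (hη : η = 1 / (4 * β ^ 2))
    (hκ : kappa G σ F ε ≠ ⊤) (hlam : 1 ≤ lam * β ^ 2) (hε : 0 ≤ ε) (hd : 0 ≤ d)
    (hdec : ∀ m : ℝ, 0 < m → m ≤ 1 →
      (decoupling G σ F T m : ENNReal) ≤ ENNReal.ofReal d) :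
    lam * boosterRegret G σ F η lam T ≤ 14 * (T * (2 * (kappa G σ F ε).toReal + lam * ε +
      5 / 24 * (T * (G.H * (24 * ε ^ 2 / β ^ 2)))) + 6 * (lam ^ 2 * β ^ 2 * d)) := by
  have hβ0 : 0 < β := by linarith
  have hlam0 : 0 < lam := pos_of_mul_pos_left (by linarith) (sq_nonneg β)
  set c : ℝ := (24 * β ^ 2)⁻¹ with hc
  have hc0 : 0 < c := by positivity
  -- With `m = c/λ` the squared residuals produced by decoupling carry, after multiplication by `λ`,
  -- exactly the weight `c` they have in the round inequalities; `m ≤ 1` follows from `λ β² ≥ 1`.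
  obtain ⟨K, hK, hKdec⟩ := exists_decouplingIneq σ hd (hdec (c / lam) (by positivity) (by
    rw [hc, div_le_one hlam0, inv_le_comm₀ (by positivity) hlam0]
    rw [inv_le_iff_one_le_mul₀ hlam0]
    linarith))
  obtain ⟨f₀, hf₀⟩ := exists_isBackupFixed_self (σ := σ) hC (e₀ 0).1.1
  have h1 := regret_le_of_decoupling σ hF hβ (η := η) (lam := lam) e₀ hC
    (m := c / lam) (by positivity) hK fun f g => (hKdec f g).1
  have h2 := optimism_le_of_decoupling σ hF hβ (η := η) (lam := lam) e₀ hC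
    (m := c / lam) (by positivity) hK (fun f g => (hKdec f g).2) hf₀
  have hQ : lam * (d / (4 * (c / lam))) = 6 * (lam ^ 2 * β ^ 2 * d) := by
    rw [hc]
    field_simp
    ring
  have hD (t : ℕ) (ht : t ∈ Finset.range T) : (t : ℝ) * (G.H * (24 * ε ^ 2 / β ^ 2)) ≤
      T * (G.H * (24 * ε ^ 2 / β ^ 2)) :=
    mul_le_mul_of_nonneg_right (Nat.cast_le.2 (Finset.mem_range.1 ht).le) (by positivity)
  have hb := Finset.sum_le_sum fun t ht =>
    (booster_round σ hF hβ e₀ hη hκ hlam0.le hε hC (t := t)).trans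
      (add_le_add_right (mul_le_mul_of_nonneg_left (hD t ht) (by norm_num : (0 : ℝ) ≤ 5 / 24)) _)
  have ha := Finset.sum_le_sum fun t ht =>
    (main_round σ hF hβ e₀ hη hκ hlam0.le hε hf₀ (t := t)).trans
      (add_le_add_right (mul_le_mul_of_nonneg_left (hD t ht) (by norm_num : (0 : ℝ) ≤ 5 / 24)) _)
  have h1' := mul_le_mul_of_nonneg_left h1 hlam0.le
  have h2' := mul_le_mul_of_nonneg_left h2 hlam0.le
  have hcl (x : ℝ) : lam * (c / lam * x) = c * x := by field_simp
  rw [mul_add, hQ, Finset.mul_sum] at h1'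
  rw [mul_add, hQ, Finset.mul_sum] at h2'
  simp only [mul_add, mul_sub, hcl, Finset.sum_add_distrib, Finset.sum_sub_distrib,
    ← Finset.mul_sum, Finset.sum_const, Finset.card_range, nsmul_eq_mul] at h1' h2' ha hb ⊢
  -- Add the booster's inequalities to `13/15` times the main agent's, which eliminates the entropy.
  -- Of `λ Reg` the share `2/15` survives, against `28/15` of the errors; hence the factor `14`.
  linarith

theorem boosterRegret_le (hC : Complete G σ F) {d : ℝ} (hη : η = 1 / (4 * β ^ 2))
    (hκ : kappa G σ F (β / (T : ℝ) ^ 2) ≠ ⊤) (hd : 1 ≤ d)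
    (hdec : ∀ m : ℝ, 0 < m → m ≤ 1 →
      (decoupling G σ F T m : ENNReal) ≤ ENNReal.ofReal d)
    (hlam : lam = √(T * (kappa G σ F (β / (T : ℝ) ^ 2)).toReal / (β ^ 2 * d)))
    (hlamβ : 1 ≤ lam * β ^ 2) (hT : β * √(G.H : ℝ) ≤ T) :
    boosterRegret G σ F η lam T ≤
      112 * (β * √(d * (kappa G σ F (β / (T : ℝ) ^ 2)).toReal * T) + d) := by
  have hβ0 : 0 < β := by linarith
  have hd0 : 0 < d := by linarith
  have hlam0 : 0 < lam := pos_of_mul_pos_left (by linarith) (sq_nonneg β)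
  have hmain := lam_mul_boosterRegret_le σ hF hβ e₀ (T := T) hC hη hκ hlamβ (by positivity)
    hd0.le hdec
  set κ := (kappa G σ F (β / (T : ℝ) ^ 2)).toReal with hκdef
  have hq : 0 < T * κ / (β ^ 2 * d) := Real.sqrt_pos.1 (hlam ▸ hlam0)
  have hTκ : 0 < T * κ := by
    have := mul_pos hq (by positivity : 0 < β ^ 2 * d)
    rwa [div_mul_cancel₀ _ (by positivity)] at this
  have hT0 : (0 : ℝ) < T := by
    rcases (Nat.cast_nonneg T : (0 : ℝ) ≤ T).eq_or_lt with h | h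
    · rw [← h, zero_mul] at hTκ
      exact absurd hTκ (lt_irrefl _)
    · exact h
  have hκ0 : 0 < κ := pos_of_mul_pos_right hTκ hT0.le
  -- For `H = 0` the sum defining `κ` is empty and `κ = 0`, contradicting `λ > 0`. Hence `√H ≥ 1`,
  -- and `β ≤ T`.
  have hH : 1 ≤ G.H := by
    by_contra! h0
    have h1 : G.H = 0 := by omega
    have : IsEmpty (Fin G.H) := by rw [h1]; infer_instance
    have : Nonempty F.Elem := ⟨(e₀ 0).1.1⟩
    have : kappa G σ F (β / (T : ℝ) ^ 2) = 0 := by simp [kappa]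
    rw [hκdef, this] at hκ0
    simp at hκ0
  have hlam2 : lam ^ 2 * β ^ 2 * d = T * κ := by
    rw [hlam, Real.sq_sqrt hq.le]
    field_simp
  set x := β * √(d * κ * T) with hx
  have hx0 : 0 ≤ x := by positivity
  -- This choice of `λ` equalizes the two main errors: `T κ` is both `λ² β² d` and `λ` times the
  -- target rate.
  have hlx : lam * x = T * κ := by
    have h1 : (lam * x) ^ 2 = (T * κ) ^ 2 := by
      rw [hx, mul_pow, mul_pow, Real.sq_sqrt (by positivity), ← hlam2]
      have : lam ^ 2 * (β ^ 2 * (d * κ * T)) = lam ^ 2 * β ^ 2 * d * (T * κ) := by ring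
      rw [this, ← hlam2]
      ring
    exact (pow_left_inj₀ (by positivity) hTκ.le two_ne_zero).1 h1
  have hTβ : β ≤ T := by
    refine le_trans ?_ hT
    refine le_mul_of_one_le_right hβ0.le ?_
    rw [Real.one_le_sqrt]
    exact_mod_cast hH
  have e1 : T * (lam * (β / (T : ℝ) ^ 2)) ≤ lam := by
    have : T * (lam * (β / (T : ℝ) ^ 2)) = lam * (β / T) := by field_simp
    rw [this]
    exact mul_le_of_le_one_right hlam0.le ((div_le_one hT0).2 hTβ)
  -- The accuracy `β/T²` turns the left side into `5 H/T²`; then `β² H ≤ T²` and `λ β² ≥ 1` give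
  -- `H/T² ≤ λ`.
  have e2 : T * (5 / 24 * (T * (G.H * (24 * (β / (T : ℝ) ^ 2) ^ 2 / β ^ 2)))) ≤ 5 * lam := by
    have h1 : T * (5 / 24 * (T * (G.H * (24 * (β / (T : ℝ) ^ 2) ^ 2 / β ^ 2)))) =
        5 * (G.H / (T : ℝ) ^ 2) := by field_simp
    have h2 : β ^ 2 * G.H ≤ (T : ℝ) ^ 2 := by
      have := pow_le_pow_left₀ (by positivity) hT 2
      rwa [mul_pow, Real.sq_sqrt (Nat.cast_nonneg _)] at this
    have h3 : G.H / (T : ℝ) ^ 2 ≤ lam := by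
      rw [div_le_iff₀ (by positivity)]
      calc (G.H : ℝ) ≤ lam * β ^ 2 * G.H := le_mul_of_one_le_left (Nat.cast_nonneg _) hlamβ
        _ ≤ lam * (T : ℝ) ^ 2 := by
          rw [mul_assoc]
          exact mul_le_mul_of_nonneg_left h2 hlam0.le
    rw [h1]
    linarith
  refine le_of_mul_le_mul_left (hmain.trans ?_) hlam0
  rw [hlam2]
  have e3 : lam ≤ lam * d := le_mul_of_one_le_right hlam0.le hd
  have e4 : 0 < lam * d := by positivity
  rw [mul_left_comm lam, mul_add lam, hlx]
  simp only [mul_add] at e1 e2 ⊢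
  -- The constant is `14 (2 + 6) = 112` on `T κ`; the lower-order terms `14 (1 + 5) λ = 84 λ` fit
  -- below `112 λ d`.
  linarith

end Learning

end MarkovGames

end

theorem theorem3 :
    ∃ C : ℝ, 0 < C ∧
      ∀ (X : Type u) (A : Type v) (B : Type w) [MeasurableSpace X]
        [Fintype A] [Nonempty A] [MeasurableSpace A] [DiscreteMeasurableSpace A]
        [Fintype B] [Nonempty B] [MeasurableSpace B] [DiscreteMeasurableSpace B]
        (G : MarkovGames.MarkovGame X A B) (σ : MarkovGames.TieBreak X A B)
        (F : MarkovGames.FunctionClass.{u, v, w, z} X A B G.H)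
        (T : ℕ) (β d η lam : ℝ),
        MarkovGames.Realizable G σ F →
        MarkovGames.Complete G σ F →
        1 < β →
        MarkovGames.BoundedBy F β →
        MarkovGames.kappa G σ F (β / (T : ℝ) ^ 2) ≠ ⊤ →
        1 ≤ d →
        (∀ m : ℝ, 0 < m → m ≤ 1 →
          (MarkovGames.decoupling G σ F T m : ENNReal) ≤ ENNReal.ofReal d) →
        η = 1 / (4 * β ^ 2) →
        lam = √(T * (MarkovGames.kappa G σ F (β / (T : ℝ) ^ 2)).toReal / (β ^ 2 * d)) →
        1 ≤ lam * β ^ 2 →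
        β * √(G.H : ℝ) ≤ T →
        MarkovGames.boosterRegret G σ F η lam T ≤
          C * (β * √(d * (MarkovGames.kappa G σ F (β / (T : ℝ) ^ 2)).toReal * T) + d) := by
  refine ⟨112, by norm_num, ?_⟩
  intro X A B _ _ _ _ _ _ _ _ _ G σ F T β d η lam _ hC hβ hF hκ hd hdec hη hlam hlamβ hT
  -- A probability prior forces each class to be nonempty, which supplies the dummy run `e₀` that
  -- fills the records not yet played.
  have (h : Fin G.H) : Nonempty (F.Θ h) := nonempty_of_isProbabilityMeasure (F.prior h)
  let a : A := Classical.arbitrary A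
  let b : B := Classical.arbitrary B
  let f : F.Elem := fun h => Classical.arbitrary (F.Θ h)
  exact MarkovGames.boosterRegret_le σ hF hβ.le
    (fun _ => ((f, f), fun _ => (G.x₁, a, b, G.x₁))) hC hη hκ hd hdec hlam hlamβ hT
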